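/- Let $\mathcal H$ be a finite-dimensional Hilbert space and $\mathcal M\subseteq\mathcal B(\mathcal H)$ a (unital) von Neumann subalgebra. Let $(\mathcal P_t=e^{t\mathcal L})_{t\ge 0}$ be a quantum Markov semigroup on $\mathcal M$, that is, a continuous semigroup of completely positive unital maps with $\mathcal P_0=\mathrm{id}$, and assume that it extends to a quantum Markov semigroup on $\mathcal B(\mathcal H)$. Assume that it is GNS-symmetric with respect to a full-rank invariant density operator $\sigma\in\mathcal M$: $\operatorname{tr}(\sigma X^\dagger \mathcal P_t(Y))=\operatorname{tr}(\sigma \mathcal P_t(X)^\dagger Y)$ for all $X,Y\in\mathcal M$, $t\ge 0$. Then the fixed points of $(\mathcal P_t)$ form a $*$-subalgebra $\mathcal F\subseteq\mathcal M$, and $E=\lim_{t\to\infty}\mathcal P_t$ exists and is a conditional expectation of $\mathcal M$ onto $\mathcal F$. A lower star denotes the adjoint on $\mathcal M$ with respect to $(X,Y)\mapsto\operatorname{tr}(XY)$, states are density operators in the algebra, and $D$ is the Umegaki relative entropy. Define - the spectral gap $\lambda(\mathcal L)=\inf\{-\langle X,\mathcal L(X)\rangle_\sigma/\|X-E(X)\|_\sigma^2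 : X\in\mathcal M,\ X\ne E(X)\}$, where $\langle X,Y\rangle_\sigma=\int_0^1\operatorname{tr}(X^\dagger\sigma^{1-s}Y\sigma^s)\,ds$ and $\inf\emptyset=+\infty$; - the indices $C_\tau(\mathcal M:\mathcal F)=\inf\{c>0:\rho\le cE_*(\rho)\text{ for all states }\rho\in\mathcal M\}$ and $C_{\tau,\mathrm{cb}}(\mathcal M:\mathcal F)=\sup_{k}C(E\otimes\mathrm{id}_{\mathbb M_k})$, where $C(E\otimes\mathrm{id}_{\mathbb M_k})$ is the same infimum for $E\otimes\mathrm{id}_{\mathbb M_k}$ on $\mathcal M\otimes\mathbb M_k$; - $\alpha_{\mathrm{MLSI}}(\mathcal L)$, the best (largest) $\alpha>0$ such that $\alpha D(\rho\|E_*(\rho))\le \mathrm{EP}_{\mathcal L}(\rho):=-\frac{d}{dt}\big|_{t=0^+}D(\mathcal P_{t*}(\rho)\|E_*(\rho))$ for all states $\rho\in\mathcal M$, and $\alpha_{\mathrm{CMLSI}}(\mathcal L)$, the best $\alpha>0$ for which the same inequality holds for $\mathcal P_t\otimes\mathrm{id}_{\mathbb M_k}$ and $E\otimes\mathrm{id}_{\mathbb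 M_k}$ on $\mathcal M\otimes\mathbb M_k$ for every $k\in\mathbb N$ (suprema in $[0,+\infty]$). Then $(\mathcal P_t)$ satisfies the complete modified logarithmic Sobolev inequality, i.e. $\alpha_{\mathrm{CMLSI}}(\mathcal L)>0$, and $$\frac{\lambda(\mathcal L)}{C_{\tau,\mathrm{cb}}(\mathcal M:\mathcal F)}\le\alpha_{\mathrm{CMLSI}}(\mathcal L)\le 2\lambda(\mathcal L),\qquad \frac{\lambda(\mathcal L)}{C_{\tau}(\mathcal M:\mathcal F)}\le\alpha_{\mathrm{MLSI}}(\mathcal L)\le 2\lambda(\mathcal L).$$ Moreover, a real number $\alpha>0$ satisfies $\alpha\le\alpha_{\mathrm{CMLSI}}(\mathcal L)$ if and only if, for all $k\in\mathbb N$, all $t\ge0$ and all states $\rho\in\mathcal M\otimes\mathbb M_k$, $$D\big((\mathcal P_{t*}\otimes\mathrm{id})(\rho)\,\big\|\,(E_*\otimes\mathrm{id})(\rho)\big)\le e^{-\alpha t}D\big(\rho\,\big\|\,(E_*\otimes\mathrm{id})(\rho)\big).$$ -/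

import Mathlib

open Filter Matrix
open scoped NNReal Topology ComplexOrder

namespace QuantumMarkov

noncomputable section

/-! A finite-dimensional von Neumann algebra `M` acting on `H = ℂⁿ` is a (unital) star subalgebra
of the `n × n` complex matrices. -/

/-- The `(a, b)`-block of a matrix over `H ⊗ ℂᵏ`. -/
def block {n : Type*} {k : ℕ} (X : Matrix (n × Fin k) (n × Fin k) ℂ) (a b : Fin k) :
    Matrix n n ℂ :=
  Matrix.of fun i j => X (i, a) (j, b)

/-- The amplification `M ⊗ 𝕄ₖ`, acting on `H ⊗ ℂᵏ`: the matrices all of whose `k × k` blocks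
lie in `M`. -/
def ampl {n : Type*} [Fintype n] [DecidableEq n] (M : StarSubalgebra ℂ (Matrix n n ℂ)) (k : ℕ) :
    StarSubalgebra ℂ (Matrix (n × Fin k) (n × Fin k) ℂ) where
  carrier := {X | ∀ a b, block X a b ∈ M}
  mul_mem' := by
    intro X Y hX hY a b
    have h : block (X * Y) a b = ∑ c, block X a c * block Y c b := by
      ext i j
      simp only [block, Matrix.of_apply, Matrix.mul_apply, Matrix.sum_apply, Fintype.sum_prod_type]
      rw [Finset.sum_comm]
    rw [h]
    exact sum_mem fun c _ => mul_mem (hX a c) (hY c b)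
  add_mem' := by
    intro X Y hX hY a b
    exact add_mem (hX a b) (hY a b)
  algebraMap_mem' := by
    intro r a b
    by_cases hab : a = b
    · have h : block (algebraMap ℂ (Matrix (n × Fin k) (n × Fin k) ℂ) r) a b
          = algebraMap ℂ (Matrix n n ℂ) r := by
        ext i j
        simp [block, Matrix.algebraMap_matrix_apply, hab]
      rw [h]
      exact algebraMap_mem M r
    · have h : block (algebraMap ℂ (Matrix (n × Fin k) (n × Fin k) ℂ) r) a b = 0 := by
        ext i j
        simp [block, Matrix.algebraMap_matrix_apply, hab]
      rw [h]
      exact zero_mem M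
  star_mem' := by
    intro X hX a b
    have h : block (star X) a b = star (block X b a) := by
      ext i j
      simp [block, Matrix.star_apply]
    rw [h]
    exact star_mem (hX b a)

/-- The amplification `Φ ⊗ id` on `M ⊗ 𝕄ₖ` of a linear map `Φ : M → M` (apply `Φ` blockwise). -/
def amplMap {n : Type*} [Fintype n] [DecidableEq n] {M : StarSubalgebra ℂ (Matrix n n ℂ)}
    (Φ : M →ₗ[ℂ] M) (k : ℕ) : ampl M k →ₗ[ℂ] ampl M k where
  toFun X := ⟨Matrix.of fun p q => (Φ ⟨block X.1 p.2 q.2, X.2 p.2 q.2⟩ : Matrix n n ℂ) p.1 q.1,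
    fun a b => (Φ ⟨block X.1 a b, X.2 a b⟩).2⟩
  map_add' X Y := by
    have h : ∀ a b, (⟨block (X + Y).1 a b, (X + Y).2 a b⟩ : M)
        = ⟨block X.1 a b, X.2 a b⟩ + ⟨block Y.1 a b, Y.2 a b⟩ := fun a b => rfl
    ext p q
    simp only [h, map_add]
    rfl
  map_smul' c X := by
    have h : ∀ a b, (⟨block (c • X).1 a b, (c • X).2 a b⟩ : M)
        = c • ⟨block X.1 a b, X.2 a b⟩ := fun a b => rfl
    ext p q
    simp only [h, map_smul]
    rfl

/-- Complete positivity of `Φ : M → M`: every `Φ ⊗ id` on `M ⊗ 𝕄ₖ` preserves positivity. -/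
def IsCompletelyPositive {n : Type*} [Fintype n] [DecidableEq n]
    {M : StarSubalgebra ℂ (Matrix n n ℂ)} (Φ : M →ₗ[ℂ] M) : Prop :=
  ∀ (k : ℕ) (X : ampl M k), (X : Matrix (n × Fin k) (n × Fin k) ℂ).PosSemidef →
    (amplMap Φ k X : Matrix (n × Fin k) (n × Fin k) ℂ).PosSemidef

/-- A quantum Markov semigroup on `M` (Heisenberg picture): a continuous semigroup of completely
positive unital maps. -/
structure IsQMS {n : Type*} [Fintype n] [DecidableEq n] {M : StarSubalgebra ℂ (Matrix n n ℂ)}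
    (P : ℝ≥0 → M →ₗ[ℂ] M) : Prop where
  completelyPositive : ∀ t, IsCompletelyPositive (P t)
  unital : ∀ t, P t 1 = 1
  zero : P 0 = LinearMap.id
  add : ∀ s t, P (s + t) = P s ∘ₗ P t
  continuous : ∀ X, Continuous fun t => P t X

/-- `L` is the generator: `L X = lim_{t → 0+} (P_t X - X) / t`. -/
def IsGenerator {n : Type*} [Fintype n] [DecidableEq n] {M : StarSubalgebra ℂ (Matrix n n ℂ)}
    (P : ℝ≥0 → M →ₗ[ℂ] M) (L : M →ₗ[ℂ] M) : Prop :=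
  ∀ X, Tendsto (fun t : ℝ≥0 => ((t : ℝ) : ℂ)⁻¹ • (P t X - X)) (𝓝[>] 0) (𝓝 (L X))

/-- The density operators in `M`. -/
def IsState {n : Type*} [Fintype n] [DecidableEq n] {M : StarSubalgebra ℂ (Matrix n n ℂ)}
    (ρ : M) : Prop :=
  (ρ : Matrix n n ℂ).PosSemidef ∧ (ρ : Matrix n n ℂ).trace = 1

/-- `P` is GNS-symmetric with respect to the full-rank invariant state `σ` (detailed balance). -/
structure IsGNSSymmetric {n : Type*} [Fintype n] [DecidableEq n]
    {M : StarSubalgebra ℂ (Matrix n n ℂ)} (P : ℝ≥0 → M →ₗ[ℂ] M) (σ : M) : Prop where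
  isState : IsState σ
  fullRank : (σ : Matrix n n ℂ).PosDef
  invariant : ∀ (t : ℝ≥0) (X : M),
    (σ * P t X : Matrix n n ℂ).trace = (σ * X : Matrix n n ℂ).trace
  detailedBalance : ∀ (t : ℝ≥0) (X Y : M),
    (σ * (X : Matrix n n ℂ)ᴴ * P t Y : Matrix n n ℂ).trace
      = (σ * (P t X : Matrix n n ℂ)ᴴ * Y : Matrix n n ℂ).trace

/-- `E` is a conditional expectation of `M` onto the subalgebra `F`. -/
structure IsCondExp {n : Type*} [Fintype n] [DecidableEq n]
    {M : StarSubalgebra ℂ (Matrix n n ℂ)} (F : StarSubalgebra ℂ M) (E : M →ₗ[ℂ] M) : Prop where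
  completelyPositive : IsCompletelyPositive E
  unital : E 1 = 1
  mem : ∀ X, E X ∈ F
  id_on : ∀ X ∈ F, E X = X
  bimodule : ∀ a ∈ F, ∀ b ∈ F, ∀ X, E (a * X * b) = a * E X * b

/-- The bilinear trace form `(X, Y) ↦ tr (X Y)` on `M`. -/
def traceForm {n : Type*} [Fintype n] [DecidableEq n] (M : StarSubalgebra ℂ (Matrix n n ℂ)) :
    LinearMap.BilinForm ℂ M :=
  LinearMap.mk₂ ℂ (fun X Y => (X * Y : Matrix n n ℂ).trace)
    (by intros; simp [add_mul]) (by intros; simp)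
    (by intros; simp [mul_add]) (by intros; simp)

theorem traceForm_nondegenerate {n : Type*} [Fintype n] [DecidableEq n]
    (M : StarSubalgebra ℂ (Matrix n n ℂ)) : (traceForm M).Nondegenerate := by
  constructor
  · intro X hX
    have h : (X * (X : Matrix n n ℂ)ᴴ : Matrix n n ℂ).trace = 0 := hX (star X)
    exact Subtype.ext (Matrix.trace_mul_conjTranspose_self_eq_zero_iff.1 h)
  · intro X hX
    have h : ((X : Matrix n n ℂ)ᴴ * X : Matrix n n ℂ).trace = 0 := hX (star X)
    exact Subtype.ext (Matrix.trace_conjTranspose_mul_self_eq_zero_iff.1 h)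

instance instFiniteDimensional {n : Type*} [Fintype n] [DecidableEq n]
    (M : StarSubalgebra ℂ (Matrix n n ℂ)) : FiniteDimensional ℂ M :=
  FiniteDimensional.of_injective M.subtype.toAlgHom.toLinearMap Subtype.val_injective

/-- The adjoint `Φ_* : M → M` of `Φ : M → M` for the trace form. -/
def preadjoint {n : Type*} [Fintype n] [DecidableEq n] {M : StarSubalgebra ℂ (Matrix n n ℂ)}
    (Φ : M →ₗ[ℂ] M) : M →ₗ[ℂ] M :=
  (traceForm M).leftAdjointOfNondegenerate (traceForm_nondegenerate M) Φ

/-- The defining property `tr (Φ_*(X) Y) = tr (X Φ(Y))` of `Φ_*`. -/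
theorem trace_preadjoint_mul {n : Type*} [Fintype n] [DecidableEq n]
    {M : StarSubalgebra ℂ (Matrix n n ℂ)} (Φ : M →ₗ[ℂ] M) (X Y : M) :
    (preadjoint Φ X * Y : Matrix n n ℂ).trace = (X * Φ Y : Matrix n n ℂ).trace :=
  (traceForm M).isAdjointPairLeftAdjointOfNondegenerate (traceForm_nondegenerate M) Φ X Y

open Classical in
/-- The relative entropy `D(ρ‖σ) = tr (ρ ln ρ - ρ ln σ)` of positive matrices if
`supp ρ ⊆ supp σ` (that is, `ker σ ⊆ ker ρ`), and `+∞` otherwise. On the kernel of its argument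
the logarithm is `0`, so the trace only sees `ln σ` on the support of `σ`. -/
def relEntropy {n : Type*} [Fintype n] [DecidableEq n] (ρ σ : Matrix n n ℂ) : EReal :=
  if ∀ v : n → ℂ, σ *ᵥ v = 0 → ρ *ᵥ v = 0 then
    (((ρ * cfc Real.log ρ - ρ * cfc Real.log σ).trace.re : ℝ) : EReal)
  else ⊤

/-- The entropy production `-(d/dt)|_{t=0} D(P_{t*}(ρ)‖E_*(ρ)) ∈ [0, +∞]` of a state `ρ`, as the
one-sided derivative at `t = 0`; it may be `+∞` if `ρ` does not have full rank. -/
def entropyProduction {n : Type*} [Fintype n] [DecidableEq n]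
    {M : StarSubalgebra ℂ (Matrix n n ℂ)} (P : ℝ≥0 → M →ₗ[ℂ] M) (E : M →ₗ[ℂ] M) (ρ : M) : EReal :=
  liminf (fun t : ℝ≥0 =>
    (relEntropy (ρ : Matrix n n ℂ) (preadjoint E ρ)
      - relEntropy (preadjoint (P t) ρ : Matrix n n ℂ) (preadjoint E ρ)) / ((t : ℝ) : EReal))
    (𝓝[>] 0)

/-- The modified logarithmic Sobolev inequality with constant `α`. -/
def MLSI {n : Type*} [Fintype n] [DecidableEq n] {M : StarSubalgebra ℂ (Matrix n n ℂ)}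
    (P : ℝ≥0 → M →ₗ[ℂ] M) (E : M →ₗ[ℂ] M) (α : ℝ) : Prop :=
  ∀ ρ : M, IsState ρ →
    (α : EReal) * relEntropy (ρ : Matrix n n ℂ) (preadjoint E ρ) ≤ entropyProduction P E ρ

/-- The complete modified logarithmic Sobolev inequality: the modified logarithmic Sobolev
inequality with constant `α` for all amplifications `P_t ⊗ id`. -/
def CMLSI {n : Type*} [Fintype n] [DecidableEq n] {M : StarSubalgebra ℂ (Matrix n n ℂ)}
    (P : ℝ≥0 → M →ₗ[ℂ] M) (E : M →ₗ[ℂ] M) (α : ℝ) : Prop :=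
  ∀ k : ℕ, MLSI (fun t => amplMap (P t) k) (amplMap E k) α

/-- The best constant in the modified logarithmic Sobolev inequality. -/
def alphaMLSI {n : Type*} [Fintype n] [DecidableEq n] {M : StarSubalgebra ℂ (Matrix n n ℂ)}
    (P : ℝ≥0 → M →ₗ[ℂ] M) (E : M →ₗ[ℂ] M) : EReal :=
  ⨆ (α : ℝ) (_ : 0 < α ∧ MLSI P E α), (α : EReal)

/-- The best constant in the complete modified logarithmic Sobolev inequality. -/
def alphaCMLSI {n : Type*} [Fintype n] [DecidableEq n] {M : StarSubalgebra ℂ (Matrix n n ℂ)}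
    (P : ℝ≥0 → M →ₗ[ℂ] M) (E : M →ₗ[ℂ] M) : EReal :=
  ⨆ (α : ℝ) (_ : 0 < α ∧ CMLSI P E α), (α : EReal)

/-- The Pimsner-Popa index of `E`: the infimum of the `c > 0` with `ρ ≤ c E_*(ρ)` for all
states `ρ ∈ M`. -/
def index {n : Type*} [Fintype n] [DecidableEq n] {M : StarSubalgebra ℂ (Matrix n n ℂ)}
    (E : M →ₗ[ℂ] M) : EReal :=
  ⨅ (c : ℝ) (_ : 0 < c ∧ ∀ ρ : M, IsState ρ →
    ((c : ℂ) • (preadjoint E ρ : Matrix n n ℂ) - ρ).PosSemidef), (c : EReal)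

/-- The complete Pimsner-Popa index of `E`. -/
def indexCB {n : Type*} [Fintype n] [DecidableEq n] {M : StarSubalgebra ℂ (Matrix n n ℂ)}
    (E : M →ₗ[ℂ] M) : EReal :=
  ⨆ k : ℕ, index (amplMap E k)

/-- The inner product `⟨X, Y⟩_σ = ∫₀¹ tr (X† σ^{1-s} Y σ^s) ds` for `σ` of full rank. -/
def innerBKM {n : Type*} [Fintype n] [DecidableEq n] (σ X Y : Matrix n n ℂ) : ℂ :=
  ∫ s in (0 : ℝ)..1,
    (Xᴴ * cfc (fun x : ℝ => x ^ (1 - s)) σ * Y * cfc (fun x : ℝ => x ^ s) σ).trace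

/-- The spectral gap `λ(L) = inf_X (-⟨X, L X⟩_σ) / ‖X - E X‖_σ²`, the infimum over all `X ∈ M`
with `X ≠ E X` (it is `+∞` if there is no such `X`, that is, if `L = 0`). -/
def spectralGap {n : Type*} [Fintype n] [DecidableEq n] {M : StarSubalgebra ℂ (Matrix n n ℂ)}
    (L E : M →ₗ[ℂ] M) (σ : M) : EReal :=
  ⨅ (X : M) (_ : X ≠ E X),
    ((-(innerBKM (σ : Matrix n n ℂ) X (L X)).re
      / (innerBKM (σ : Matrix n n ℂ) (X - E X : M) (X - E X : M)).re : ℝ) : EReal)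

end

end QuantumMarkov

open QuantumMarkov

/-! Detailed balance makes every `P t` a symmetric contraction for the GNS inner product of σ, so
P_t = Σ e^{-lt} Q_l with E = Q_0, and the spectral gap g is the least nonzero rate. It also forces
`P t` to respect the modular grading of σ, so Kraus operators can be chosen with ωK = νKω. Both
facts hold at every invariant state ω = E_*ρ with ρ faithful, since detailed balance passes from σ
to all of them (`SpectralResolution.proj_star_mul`). Moreover `P t` is symmetric for the BKM inner
product tr(X†J_ω(Y)), J_ω(Y) = ∫ω^{1-s}Yω^s ds, with the same Q_l. Hence the gap may be used at ω =
E_*ρ instead of σ.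

Lower bound. Let ρ be faithful, ω = E_*ρ, ρ = J_ω(X), G = log ρ - log ω, and Y_j = ν_j⁻¹ρK_j - K_jρ
for modular Kraus operators of P_t. Weighted by the reciprocal logarithmic mean, the quadratic form
Σ_j⟨Y_j, Y_j⟩ equals 2 tr ρ(X - P_t X) when the mean is taken at ω and 2 tr ρ(G - P_t G) when it is
taken at ρ. The reciprocal logarithmic mean is an integral of inverses of linear functions, hence
antitone, so ρ ≤ cω gives tr ρ(X - P_t X) ≤ c tr ρ(G - P_t G) (`IsModularKraus.dirichlet_le`). The
left side is at least (1 - e^{-gt})χ²(ρ, ω), and D(ρ‖ω) ≤ χ²(ρ, ω) (`relEnt_le_logForm`). A time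
step u therefore multiplies D by at most 1 - (1 - e^{-gu})/c, up to an error O(u²), and iteration
yields decay at rate g/c. States that are not faithful are reached by mixing with σ.

Amplifications satisfy the same hypotheses with the same rates, and the index is finite uniformly in
k because a single positive element of N ⊗ 𝕄_d, d = dim N, generates all positive elements of all
amplifications by scalar compressions (`SpectralResolution.exists_forall_ampl_le`). This gives the
complete inequality.

Upper bound. Perturbing σ along an eigenvector of rate g produces a relative entropy bounded below
by a multiple of e^{-2gt}, so no decay rate exceeds 2g (`SpectralResolution.decay_rate_le`).

The Sobolev inequality and exponential decay are equivalent: one direction differentiates at t = 0,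
the other applies the inequality along the orbit, where E_*ρ does not change, and uses Gronwall. -/

namespace QuantumMarkov

noncomputable section

set_option linter.unusedSectionVars false

/-! ### Spectral projections and double operator sums. -/

section SpectralCalculus

variable {n : Type*} [Fintype n] [DecidableEq n]

/-- The spectrum is finite, hence discrete. Thus the functional calculus multiplies and adds for
arbitrary functions, including indicators of points and `Real.log` at 0. -/
theorem continuousOn_spectrum (A : Matrix n n ℂ) (f : ℝ → ℝ) :
    ContinuousOn f (spectrum ℝ A) :=
  A.finite_real_spectrum.continuousOn f

/-- The real eigenvalues of a matrix. -/
def eigs (A : Matrix n n ℂ) : Finset ℝ := A.finite_real_spectrum.toFinset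

theorem mem_eigs {A : Matrix n n ℂ} {a : ℝ} : a ∈ eigs A ↔ a ∈ spectrum ℝ A := by
  simp [eigs]

/-- The spectral projection of a Hermitian matrix at the real number `a`. -/
def specProj (A : Matrix n n ℂ) (a : ℝ) : Matrix n n ℂ := cfc (fun x : ℝ => if x = a then 1 else 0) A

theorem specProj_conjTranspose (A : Matrix n n ℂ) (a : ℝ) : (specProj A a)ᴴ = specProj A a :=
  (cfc_predicate (R := ℝ) (p := IsSelfAdjoint) (fun x : ℝ => if x = a then 1 else 0) A)

theorem cfc_conjTranspose (f : ℝ → ℝ) (A : Matrix n n ℂ) : (cfc f A)ᴴ = cfc f A :=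
  (cfc_predicate (R := ℝ) (p := IsSelfAdjoint) f A)

theorem cfc_mul_specProj (A : Matrix n n ℂ) (f : ℝ → ℝ) (a : ℝ) :
    cfc f A * specProj A a = (f a : ℂ) • specProj A a := by
  rw [specProj, ← cfc_mul _ _ A (continuousOn_spectrum _ _) (continuousOn_spectrum _ _)]
  have h : (fun x : ℝ => f x * if x = a then 1 else 0)
      = fun x : ℝ => f a • (if x = a then (1 : ℝ) else 0) := by
    funext x; by_cases hx : x = a <;> simp [hx]
  rw [h, cfc_smul (f a) _ A (continuousOn_spectrum _ _)]
  ext i j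
  simp

theorem specProj_mul_cfc (A : Matrix n n ℂ) (f : ℝ → ℝ) (a : ℝ) :
    specProj A a * cfc f A = (f a : ℂ) • specProj A a := by
  rw [← cfc_mul_specProj]
  exact cfc_commute_cfc _ _ _

theorem specProj_mul_specProj (A : Matrix n n ℂ) (a b : ℝ) :
    specProj A a * specProj A b = if a = b then specProj A a else 0 := by
  rw [specProj, cfc_mul_specProj]
  by_cases h : a = b
  · subst h; simp [specProj]
  · simp [h, Ne.symm h]

theorem specProj_of_notMem {A : Matrix n n ℂ} {a : ℝ} (ha : a ∉ eigs A) : specProj A a = 0 := by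
  rw [specProj, cfc_congr (g := fun _ => 0), cfc_const_zero]
  intro x hx
  have : x ≠ a := by rintro rfl; exact ha (mem_eigs.2 hx)
  simp [this]

theorem cfc_eq_sum {A : Matrix n n ℂ} (f : ℝ → ℝ) :
    cfc f A = ∑ a ∈ eigs A, (f a : ℂ) • specProj A a := by
  have h : ∀ a, ((f a : ℂ) • specProj A a)
      = cfc (fun x : ℝ => f a * (if x = a then (1 : ℝ) else 0)) A := by
    intro a
    rw [cfc_const_mul (f a) _ A (continuousOn_spectrum _ _)]
    ext i j
    simp [specProj]
  simp_rw [h]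
  rw [← cfc_sum _ A _ (fun _ _ => continuousOn_spectrum _ _)]
  apply cfc_congr
  intro x hx
  simp [Finset.sum_apply, mem_eigs.2 hx]

theorem sum_specProj {A : Matrix n n ℂ} (hA : A.IsHermitian) :
    ∑ a ∈ eigs A, specProj A a = 1 := by
  have h := cfc_eq_sum (A := A) (fun _ => 1)
  rw [cfc_const_one ℝ A hA.isSelfAdjoint] at h
  simpa using h.symm

/-- On the finite spectrum any function agrees with a Lagrange interpolation polynomial. A matrix
that is not Hermitian has the default value 0 as its functional calculus. -/
theorem cfc_mem {N : StarSubalgebra ℂ (Matrix n n ℂ)} {A : Matrix n n ℂ} (hA : A ∈ N)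
    (f : ℝ → ℝ) : cfc f A ∈ N := by
  by_cases h : A.IsHermitian
  · have h2 : cfc f A = cfc (Lagrange.interpolate (eigs A) id f).eval A := by
      apply cfc_congr
      intro x hx
      exact (Lagrange.eval_interpolate_at_node (v := id) f (Set.injOn_id _) (mem_eigs.2 hx)).symm
    rw [h2, cfc_polynomial _ A h.isSelfAdjoint]
    generalize Lagrange.interpolate (eigs A) id f = q
    rw [Polynomial.aeval_eq_sum_range]
    refine sum_mem fun i _ => ?_
    have : (q.coeff i) • A ^ i = ((q.coeff i : ℝ) : ℂ) • A ^ i := by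
      ext i j; simp
    rw [this]
    exact SMulMemClass.smul_mem _ (pow_mem hA i)
  · rw [cfc_apply_of_not_predicate A (fun h' : IsSelfAdjoint A => h h')]
    exact zero_mem N

theorem specProj_mem {N : StarSubalgebra ℂ (Matrix n n ℂ)} {A : Matrix n n ℂ} (hA : A ∈ N)
    (a : ℝ) : specProj A a ∈ N := cfc_mem hA _

theorem eigs_pos {A : Matrix n n ℂ} (hA : A.PosDef) {a : ℝ} (ha : a ∈ eigs A) : 0 < a := by
  rw [mem_eigs, hA.1.spectrum_real_eq_range_eigenvalues] at ha
  obtain ⟨i, rfl⟩ := ha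
  exact hA.eigenvalues_pos i

theorem eigs_nonneg {A : Matrix n n ℂ} (hA : A.PosSemidef) {a : ℝ} (ha : a ∈ eigs A) : 0 ≤ a := by
  rw [mem_eigs, hA.1.spectrum_real_eq_range_eigenvalues] at ha
  obtain ⟨i, rfl⟩ := ha
  exact hA.eigenvalues_nonneg i

theorem mul_specProj {A : Matrix n n ℂ} (hA : A.IsHermitian) (a : ℝ) :
    A * specProj A a = (a : ℂ) • specProj A a := by
  have h := cfc_mul_specProj A id a
  rwa [cfc_id ℝ A hA.isSelfAdjoint] at h

theorem specProj_mul {A : Matrix n n ℂ} (hA : A.IsHermitian) (a : ℝ) :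
    specProj A a * A = (a : ℂ) • specProj A a := by
  have h := specProj_mul_cfc A id a
  rwa [cfc_id ℝ A hA.isSelfAdjoint] at h

/-- The double operator sum `∑ F(a, b) Q_a Y R_b` over the spectral projections `Q_a` of `A` and
`R_b` of `B`. -/
def dop (F : ℝ → ℝ → ℝ) (A B : Matrix n n ℂ) : Matrix n n ℂ →ₗ[ℂ] Matrix n n ℂ :=
  ∑ a ∈ eigs A, ∑ b ∈ eigs B, (F a b : ℂ) •
    (LinearMap.mulRight ℂ (specProj B b) ∘ₗ LinearMap.mulLeft ℂ (specProj A a))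

theorem dop_apply (F : ℝ → ℝ → ℝ) (A B Y : Matrix n n ℂ) :
    dop F A B Y = ∑ a ∈ eigs A, ∑ b ∈ eigs B,
      (F a b : ℂ) • (specProj A a * Y * specProj B b) := by
  simp [dop, LinearMap.sum_apply]

theorem dop_mem {N : StarSubalgebra ℂ (Matrix n n ℂ)} {A B Y : Matrix n n ℂ} (hA : A ∈ N)
    (hB : B ∈ N) (hY : Y ∈ N) (F : ℝ → ℝ → ℝ) : dop F A B Y ∈ N := by
  rw [dop_apply]
  exact sum_mem fun a _ => sum_mem fun b _ => SMulMemClass.smul_mem _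
    (mul_mem (mul_mem (specProj_mem hA a) hY) (specProj_mem hB b))

theorem dop_congr {F G : ℝ → ℝ → ℝ} {A B : Matrix n n ℂ}
    (h : ∀ a ∈ eigs A, ∀ b ∈ eigs B, F a b = G a b) (Y : Matrix n n ℂ) :
    dop F A B Y = dop G A B Y := by
  rw [dop_apply, dop_apply]
  exact Finset.sum_congr rfl fun a ha => Finset.sum_congr rfl fun b hb => by rw [h a ha b hb]

theorem specProj_dop_specProj (F : ℝ → ℝ → ℝ) (A B Y : Matrix n n ℂ) (a b : ℝ) :
    specProj A a * dop F A B Y * specProj B b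
      = (F a b : ℂ) • (specProj A a * Y * specProj B b) := by
  by_cases ha : a ∈ eigs A
  · by_cases hb : b ∈ eigs B
    · rw [dop_apply, Finset.mul_sum, Finset.sum_mul, Finset.sum_eq_single a]
      · rw [Finset.mul_sum, Finset.sum_mul, Finset.sum_eq_single b]
        · rw [Matrix.mul_smul, Matrix.smul_mul]
          simp only [← Matrix.mul_assoc]
          rw [specProj_mul_specProj, if_pos rfl]
          simp only [Matrix.mul_assoc]
          rw [specProj_mul_specProj, if_pos rfl]
        · intro c _ hc
          rw [Matrix.mul_smul, Matrix.smul_mul]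
          simp only [Matrix.mul_assoc]
          rw [specProj_mul_specProj, if_neg hc]
          simp
        · exact fun h => absurd hb h
      · intro c _ hc
        rw [Finset.mul_sum, Finset.sum_mul]
        refine Finset.sum_eq_zero fun d _ => ?_
        rw [Matrix.mul_smul, Matrix.smul_mul]
        simp only [← Matrix.mul_assoc]
        rw [specProj_mul_specProj, if_neg (Ne.symm hc)]
        simp
      · exact fun h => absurd ha h
    · simp [specProj_of_notMem hb]
  · simp [specProj_of_notMem ha]

/-- The maps Y ↦ Q_a Y R_b are mutually orthogonal idempotents, so symbols multiply pointwise.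
Inverting such an operator amounts to inverting its symbol on pairs of eigenvalues. -/
theorem dop_dop (F G : ℝ → ℝ → ℝ) (A B Y : Matrix n n ℂ) :
    dop F A B (dop G A B Y) = dop (fun a b => F a b * G a b) A B Y := by
  rw [dop_apply F, dop_apply (fun a b => F a b * G a b)]
  refine Finset.sum_congr rfl fun a _ => Finset.sum_congr rfl fun b _ => ?_
  rw [specProj_dop_specProj, smul_smul]
  push_cast
  rfl

theorem dop_left (f : ℝ → ℝ) (A : Matrix n n ℂ) {B : Matrix n n ℂ} (hB : B.IsHermitian)
    (Y : Matrix n n ℂ) : dop (fun a _ => f a) A B Y = cfc f A * Y := by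
  rw [dop_apply, cfc_eq_sum, Finset.sum_mul]
  refine Finset.sum_congr rfl fun a _ => ?_
  rw [← Finset.smul_sum, ← Finset.mul_sum, sum_specProj hB, Matrix.mul_one, Matrix.smul_mul]

theorem dop_right (f : ℝ → ℝ) {A : Matrix n n ℂ} (hA : A.IsHermitian) (B : Matrix n n ℂ)
    (Y : Matrix n n ℂ) : dop (fun _ b => f b) A B Y = Y * cfc f B := by
  rw [dop_apply, cfc_eq_sum, Finset.mul_sum, Finset.sum_comm]
  refine Finset.sum_congr rfl fun a _ => ?_
  rw [← Finset.smul_sum, ← Finset.sum_mul, ← Finset.sum_mul, sum_specProj hA, Matrix.one_mul,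
    Matrix.mul_smul]

theorem dop_one {A B : Matrix n n ℂ} (hA : A.IsHermitian) (hB : B.IsHermitian)
    (Y : Matrix n n ℂ) : dop (fun _ _ => 1) A B Y = Y := by
  rw [dop_left (fun _ => 1) A hB, cfc_const_one ℝ A hA.isSelfAdjoint, Matrix.one_mul]

theorem dop_add_fun (F G : ℝ → ℝ → ℝ) (A B Y : Matrix n n ℂ) :
    dop (fun a b => F a b + G a b) A B Y = dop F A B Y + dop G A B Y := by
  simp only [dop_apply, Complex.ofReal_add, add_smul, Finset.sum_add_distrib]

theorem dop_sub_fun (F G : ℝ → ℝ → ℝ) (A B Y : Matrix n n ℂ) :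
    dop (fun a b => F a b - G a b) A B Y = dop F A B Y - dop G A B Y := by
  simp only [dop_apply, Complex.ofReal_sub, sub_smul, Finset.sum_sub_distrib]

theorem dop_const_mul (c : ℝ) (F : ℝ → ℝ → ℝ) (A B Y : Matrix n n ℂ) :
    dop (fun a b => c * F a b) A B Y = (c : ℂ) • dop F A B Y := by
  simp only [dop_apply, Complex.ofReal_mul, mul_smul, Finset.smul_sum]

theorem dop_conjTranspose (F : ℝ → ℝ → ℝ) (A B Y : Matrix n n ℂ) :
    (dop F A B Y)ᴴ = dop (fun b a => F a b) B A Yᴴ := by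
  rw [dop_apply, dop_apply, Finset.sum_comm]
  simp only [Matrix.conjTranspose_sum, Matrix.conjTranspose_smul, Matrix.conjTranspose_mul,
    specProj_conjTranspose, Matrix.mul_assoc]
  simp

/-- The Hilbert–Schmidt weight `‖Q_a Y R_b‖²`. -/
def hsWeight (A B Y : Matrix n n ℂ) (a b : ℝ) : ℝ :=
  ((specProj A a * Y * specProj B b)ᴴ * (specProj A a * Y * specProj B b)).trace.re

theorem trace_conjTranspose_mul_self_re_nonneg (Y : Matrix n n ℂ) : 0 ≤ (Yᴴ * Y).trace.re :=
  (Complex.le_def.1 (Matrix.posSemidef_conjTranspose_mul_self Y).trace_nonneg).1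

theorem hsWeight_nonneg (A B Y : Matrix n n ℂ) (a b : ℝ) : 0 ≤ hsWeight A B Y a b :=
  trace_conjTranspose_mul_self_re_nonneg _

theorem trace_specProj_sandwich (A B X Y : Matrix n n ℂ) (a b : ℝ) :
    (Xᴴ * (specProj A a * Y * specProj B b)).trace
      = ((specProj A a * X * specProj B b)ᴴ * (specProj A a * Y * specProj B b)).trace := by
  simp only [Matrix.conjTranspose_mul, specProj_conjTranspose]
  have h : specProj B b * (Xᴴ * specProj A a) * (specProj A a * Y * specProj B b)
      = specProj B b * (Xᴴ * (specProj A a * Y) * specProj B b) := by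
    have := specProj_mul_specProj A a a
    rw [if_pos rfl] at this
    calc _ = specProj B b * (Xᴴ * ((specProj A a * specProj A a) * Y) * specProj B b) := by
          simp only [Matrix.mul_assoc]
      _ = _ := by rw [this]
  rw [h, Matrix.trace_mul_comm (specProj B b), Matrix.mul_assoc _ (specProj B b),
    specProj_mul_specProj, if_pos rfl]
  simp only [Matrix.mul_assoc]

/-- The quadratic form is diagonal in the blocks Q_a Y R_b, with nonnegative weights. Positivity of
a form thereby reduces to positivity of its symbol. -/
theorem trace_mul_dop_re (F : ℝ → ℝ → ℝ) (A B Y : Matrix n n ℂ) :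
    (Yᴴ * dop F A B Y).trace.re = ∑ a ∈ eigs A, ∑ b ∈ eigs B, F a b * hsWeight A B Y a b := by
  rw [dop_apply, Finset.mul_sum, Matrix.trace_sum, Complex.re_sum]
  refine Finset.sum_congr rfl fun a _ => ?_
  rw [Finset.mul_sum, Matrix.trace_sum, Complex.re_sum]
  refine Finset.sum_congr rfl fun b _ => ?_
  rw [Matrix.mul_smul, Matrix.trace_smul, smul_eq_mul, Complex.re_ofReal_mul,
    trace_specProj_sandwich, hsWeight]

theorem trace_dop_mul (F : ℝ → ℝ → ℝ) (A B X Y : Matrix n n ℂ) :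
    (Xᴴ * dop F A B Y).trace = ((dop F A B X)ᴴ * Y).trace := by
  rw [dop_conjTranspose, dop_apply, dop_apply, Finset.mul_sum, Finset.sum_mul, Matrix.trace_sum,
    Matrix.trace_sum]
  simp only [Finset.mul_sum, Finset.sum_mul, Matrix.trace_sum]
  rw [Finset.sum_comm]
  refine Finset.sum_congr rfl fun b _ => Finset.sum_congr rfl fun a _ => ?_
  rw [Matrix.mul_smul, Matrix.smul_mul, Matrix.trace_smul, Matrix.trace_smul]
  congr 1
  rw [← Matrix.mul_assoc, Matrix.trace_mul_comm]
  simp only [Matrix.mul_assoc]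

end SpectralCalculus

/-! ### The logarithmic mean and its reciprocal as integrals. -/

section LogMean

/-- The reciprocal of the logarithmic mean. -/
def invLogMean (x y : ℝ) : ℝ := ∫ s in (0 : ℝ)..1, ((1 - s) * x + s * y)⁻¹

/-- The logarithmic mean. -/
def logMean (x y : ℝ) : ℝ := ∫ s in (0 : ℝ)..1, x ^ (1 - s) * y ^ s

theorem segment_pos {x y s : ℝ} (hx : 0 < x) (hy : 0 < y) (hs : s ∈ Set.Icc (0 : ℝ) 1) :
    0 < (1 - s) * x + s * y := by
  obtain ⟨h0, h1⟩ := hs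
  rcases eq_or_lt_of_le h0 with rfl | h
  · simpa using hx
  · have := mul_pos h hy
    have := mul_nonneg (sub_nonneg.2 h1) hx.le
    linarith

theorem continuousOn_inv_segment {x y : ℝ} (hx : 0 < x) (hy : 0 < y) :
    ContinuousOn (fun s : ℝ => ((1 - s) * x + s * y)⁻¹) (Set.Icc 0 1) := by
  apply ContinuousOn.inv₀ (by fun_prop)
  intro s hs
  exact (segment_pos hx hy hs).ne'

theorem intervalIntegrable_inv_segment {x y : ℝ} (hx : 0 < x) (hy : 0 < y) :
    IntervalIntegrable (fun s : ℝ => ((1 - s) * x + s * y)⁻¹) MeasureTheory.volume 0 1 := by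
  apply ContinuousOn.intervalIntegrable
  rw [Set.uIcc_of_le zero_le_one]
  exact continuousOn_inv_segment hx hy

/-- This integrates the derivative of log along the segment from x to y. Multiplying by x - y
instead of dividing keeps the case x = y inside the formula. -/
theorem sub_mul_invLogMean {x y : ℝ} (hx : 0 < x) (hy : 0 < y) :
    (x - y) * invLogMean x y = Real.log x - Real.log y := by
  have h : ∫ s in (0 : ℝ)..1, (y - x) * ((1 - s) * x + s * y)⁻¹
      = Real.log ((1 - 1) * x + 1 * y) - Real.log ((1 - 0) * x + 0 * y) := by
    apply intervalIntegral.integral_eq_sub_of_hasDerivAt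
      (f := fun s => Real.log ((1 - s) * x + s * y))
    · intro s hs
      rw [Set.uIcc_of_le zero_le_one] at hs
      have h1 : HasDerivAt (fun s : ℝ => (1 - s) * x + s * y) (y - x) s := by
        have := (((hasDerivAt_id s).const_sub 1).mul_const x).add ((hasDerivAt_id s).mul_const y)
        exact this.congr_deriv (by ring)
      have := h1.log (segment_pos hx hy hs).ne'
      rwa [div_eq_mul_inv] at this
    · exact (intervalIntegrable_inv_segment hx hy).const_mul _
  rw [intervalIntegral.integral_const_mul] at h
  simp only [sub_self, zero_mul, one_mul, zero_add, sub_zero, add_zero] at h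
  rw [invLogMean]
  linarith

theorem invLogMean_pos {x y : ℝ} (hx : 0 < x) (hy : 0 < y) : 0 < invLogMean x y := by
  apply intervalIntegral.intervalIntegral_pos_of_pos_on (intervalIntegrable_inv_segment hx hy)
    _ zero_lt_one
  intro s hs
  exact inv_pos.2 (segment_pos hx hy ⟨hs.1.le, hs.2.le⟩)

theorem continuous_rpow_mul_rpow {x y : ℝ} (hx : 0 < x) (hy : 0 < y) :
    Continuous fun s : ℝ => x ^ (1 - s) * y ^ s := by
  have h1 : Continuous fun s : ℝ => x ^ (1 - s) :=
    (Real.continuous_const_rpow hx.ne').comp (by fun_prop)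
  exact h1.mul (Real.continuous_const_rpow hy.ne')

theorem log_sub_mul_logMean {x y : ℝ} (hx : 0 < x) (hy : 0 < y) :
    (Real.log x - Real.log y) * logMean x y = x - y := by
  have h : ∫ s in (0 : ℝ)..1, (Real.log y - Real.log x) * (x ^ (1 - s) * y ^ s)
      = x ^ (1 - 1 : ℝ) * y ^ (1 : ℝ) - x ^ (1 - 0 : ℝ) * y ^ (0 : ℝ) := by
    apply intervalIntegral.integral_eq_sub_of_hasDerivAt
      (f := fun s : ℝ => x ^ (1 - s) * y ^ s)
    · intro s _
      have h1 : HasDerivAt (fun s : ℝ => x ^ (1 - s)) (Real.log x * (-1) * x ^ (1 - s)) s :=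
        ((hasDerivAt_id s).const_sub 1).const_rpow hx
      have h2 : HasDerivAt (fun s : ℝ => y ^ s) (Real.log y * 1 * y ^ s) s :=
        (hasDerivAt_id s).const_rpow hy
      exact (h1.mul h2).congr_deriv (by ring)
    · exact ((continuous_rpow_mul_rpow hx hy).intervalIntegrable _ _).const_mul _
  rw [intervalIntegral.integral_const_mul] at h
  simp only [sub_self, Real.rpow_zero, one_mul, Real.rpow_one, sub_zero, mul_one] at h
  rw [logMean]
  linarith

theorem logMean_mul_invLogMean {x y : ℝ} (hx : 0 < x) (hy : 0 < y) :
    logMean x y * invLogMean x y = 1 := by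
  by_cases h : x = y
  -- On the diagonal the two product formulas are vacuous, so both integrals are evaluated directly.
  · subst h
    have h1 : logMean x x = x := by
      have : ∀ s : ℝ, x ^ (1 - s) * x ^ s = x := fun s => by
        rw [← Real.rpow_add hx]; simp
      simp [logMean, this]
    have h2 : invLogMean x x = x⁻¹ := by
      have : ∀ s : ℝ, ((1 - s) * x + s * x)⁻¹ = x⁻¹ := fun s => by ring_nf
      simp [invLogMean, this]
    rw [h1, h2, mul_inv_cancel₀ hx.ne']
  · have h3 := sub_ne_zero.2 h
    apply mul_left_cancel₀ h3
    calc (x - y) * (logMean x y * invLogMean x y)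
        = (x - y) * invLogMean x y * logMean x y := by ring
      _ = (x - y) * 1 := by rw [sub_mul_invLogMean hx hy, log_sub_mul_logMean hx hy, mul_one]

/-- Homogeneity of degree one, in the shape needed when a modular eigenvalue is moved from one
argument to the other. -/
theorem logMean_mul_left {x y c : ℝ} (hx : 0 < x) (hy : 0 < y) (hc : 0 < c) :
    logMean (c * x) y = c * logMean x (c⁻¹ * y) := by
  rw [logMean, logMean, ← intervalIntegral.integral_const_mul]
  congr 1
  funext s
  rw [Real.mul_rpow hc.le hx.le, Real.mul_rpow (inv_nonneg.2 hc.le) hy.le, Real.rpow_sub hc,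
    Real.inv_rpow hc.le, Real.rpow_one]
  field_simp

end LogMean

/-! ### Quadratic forms of the reciprocal logarithmic mean, and Klein's inequality. -/

section LogForm

variable {n : Type*} [Fintype n] [DecidableEq n]

/-- The quadratic form of the reciprocal logarithmic mean of `c` times left multiplication by `A`
and right multiplication by `B`. -/
def logForm (c : ℝ) (A B Y : Matrix n n ℂ) : ℝ :=
  (Yᴴ * dop (fun a b => invLogMean (c * a) b) A B Y).trace.re

theorem logForm_nonneg {c : ℝ} (hc : 0 < c) {A B : Matrix n n ℂ} (hA : A.PosDef) (hB : B.PosDef)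
    (Y : Matrix n n ℂ) : 0 ≤ logForm c A B Y := by
  rw [logForm, trace_mul_dop_re]
  exact Finset.sum_nonneg fun a ha => Finset.sum_nonneg fun b hb =>
    mul_nonneg (invLogMean_pos (mul_pos hc (eigs_pos hA ha)) (eigs_pos hB hb)).le
      (hsWeight_nonneg _ _ _ _ _)

/-- For each s the integrand is the form of the inverse of (1-s)cL_A + sR_B, where L and R are left
and right multiplication. This operator is linear in (A, B), so monotonicity can be checked for
fixed s. -/
theorem logForm_eq_integral {c : ℝ} (hc : 0 < c) {A B : Matrix n n ℂ} (hA : A.PosDef)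
    (hB : B.PosDef) (Y : Matrix n n ℂ) :
    IntervalIntegrable (fun s : ℝ =>
      (Yᴴ * dop (fun a b => ((1 - s) * (c * a) + s * b)⁻¹) A B Y).trace.re)
      MeasureTheory.volume 0 1 ∧
    logForm c A B Y = ∫ s in (0 : ℝ)..1,
      (Yᴴ * dop (fun a b => ((1 - s) * (c * a) + s * b)⁻¹) A B Y).trace.re := by
  have hi : ∀ a ∈ eigs A, ∀ b ∈ eigs B, IntervalIntegrable (fun s : ℝ =>
      ((1 - s) * (c * a) + s * b)⁻¹ * hsWeight A B Y a b) MeasureTheory.volume 0 1 :=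
    fun a ha b hb => (intervalIntegrable_inv_segment (mul_pos hc (eigs_pos hA ha))
      (eigs_pos hB hb)).mul_const _
  have hi2 : ∀ a ∈ eigs A, IntervalIntegrable (fun s : ℝ => ∑ b ∈ eigs B,
      ((1 - s) * (c * a) + s * b)⁻¹ * hsWeight A B Y a b) MeasureTheory.volume 0 1 := by
    intro a ha
    simpa only [Finset.sum_fn] using IntervalIntegrable.sum (eigs B) (hi a ha)
  simp only [logForm, trace_mul_dop_re]
  constructor
  · simpa only [Finset.sum_fn] using IntervalIntegrable.sum (eigs A) hi2
  · rw [intervalIntegral.integral_finsetSum hi2]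
    refine Finset.sum_congr rfl fun a ha => ?_
    rw [intervalIntegral.integral_finsetSum (hi a ha)]
    refine Finset.sum_congr rfl fun b hb => ?_
    rw [intervalIntegral.integral_mul_const, invLogMean]

theorem trace_re_comm (X Y : Matrix n n ℂ) : (Xᴴ * Y).trace.re = (Yᴴ * X).trace.re := by
  have : (Xᴴ * Y).trace = star (Yᴴ * X).trace := by
    rw [← Matrix.trace_conjTranspose, Matrix.conjTranspose_mul, Matrix.conjTranspose_conjTranspose]
  rw [this]
  simp

theorem trace_conj_re_nonneg {A : Matrix n n ℂ} (hA : A.PosSemidef) (Z : Matrix n n ℂ) :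
    0 ≤ (Zᴴ * (A * Z)).trace.re := by
  have := (hA.conjTranspose_mul_mul_same Z).trace_nonneg
  rw [Matrix.mul_assoc] at this
  exact (Complex.le_def.1 this).1

theorem trace_conj_re_nonneg' {A : Matrix n n ℂ} (hA : A.PosSemidef) (Z : Matrix n n ℂ) :
    0 ≤ (Zᴴ * (Z * A)).trace.re := by
  have := (hA.mul_mul_conjTranspose_same Z).trace_nonneg
  rw [Matrix.trace_mul_comm] at this
  exact (Complex.le_def.1 this).1

theorem dop_segment {A B : Matrix n n ℂ} (hA : A.IsHermitian) (hB : B.IsHermitian) (s c : ℝ)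
    (Z : Matrix n n ℂ) : dop (fun a b => (1 - s) * (c * a) + s * b) A B Z
      = (((1 - s) * c : ℝ) : ℂ) • (A * Z) + (s : ℂ) • (Z * B) := by
  rw [dop_add_fun (fun a _ => (1 - s) * (c * a)) (fun _ b => s * b),
    dop_const_mul s (fun _ b => b)]
  have h1 : (fun (a : ℝ) (_ : ℝ) => (1 - s) * (c * a)) = fun a _ => ((1 - s) * c) * id a := by
    funext a _; simp [mul_assoc]
  rw [h1, dop_const_mul ((1 - s) * c) (fun a _ => id a), dop_left id A hB,
    dop_right (fun b => b) hA B, cfc_id ℝ A hA.isSelfAdjoint, cfc_id' ℝ B hB.isSelfAdjoint]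

/-- Inversion reverses operator order. With G and G' the operators (1-s)cL + sR of (A, B) and (A',
B'), the hypotheses say G ≤ kG', and the claim is G'⁻¹ ≤ kG⁻¹, tested on Y through W = G⁻¹Y and Z =
G'⁻¹Y. -/
theorem segmentForm_le {c : ℝ} (hc : 0 < c) {A B A' B' : Matrix n n ℂ} (hA : A.PosDef)
    (hB : B.PosDef) (hA' : A'.PosDef) (hB' : B'.PosDef) {k : ℝ} (hk : 0 < k)
    (h1 : ((k : ℂ) • A' - A).PosSemidef) (h2 : ((k : ℂ) • B' - B).PosSemidef)
    (Y : Matrix n n ℂ) {s : ℝ} (hs : s ∈ Set.Icc (0 : ℝ) 1) :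
    (Yᴴ * dop (fun a b => ((1 - s) * (c * a) + s * b)⁻¹) A' B' Y).trace.re
      ≤ k * (Yᴴ * dop (fun a b => ((1 - s) * (c * a) + s * b)⁻¹) A B Y).trace.re := by
  set W := dop (fun a b => ((1 - s) * (c * a) + s * b)⁻¹) A B Y with hW
  set Z := dop (fun a b => ((1 - s) * (c * a) + s * b)⁻¹) A' B' Y with hZ
  have inv : ∀ {C D : Matrix n n ℂ}, C.PosDef → D.PosDef →
      dop (fun a b => (1 - s) * (c * a) + s * b) C D
        (dop (fun a b => ((1 - s) * (c * a) + s * b)⁻¹) C D Y) = Y := by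
    intro C D hC hD
    rw [dop_dop, dop_congr (G := fun _ _ => 1), dop_one hC.1 hD.1]
    intro a ha b hb
    exact mul_inv_cancel₀ (segment_pos (mul_pos hc (eigs_pos hC ha)) (eigs_pos hD hb) hs).ne'
  have hWY := inv hA hB
  have hZY := inv hA' hB'
  rw [← hW] at hWY
  rw [← hZ] at hZY
  set G := dop (fun a b => (1 - s) * (c * a) + s * b) A B with hG
  -- G ≤ kG' evaluated at Z, where G'Z = Y.
  have hle : (Zᴴ * G Z).trace.re ≤ k * (Zᴴ * Y).trace.re := by
    have e : (k : ℂ) • (Zᴴ * Y) - Zᴴ * G Z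
        = (((1 - s) * c : ℝ) : ℂ) • (Zᴴ * (((k : ℂ) • A' - A) * Z))
          + (s : ℂ) • (Zᴴ * (Z * ((k : ℂ) • B' - B))) := by
      conv_lhs => rw [← hZY, hG, dop_segment hA'.1 hB'.1, dop_segment hA.1 hB.1]
      simp only [Matrix.sub_mul, Matrix.mul_sub, Matrix.mul_add, Matrix.mul_smul, Matrix.smul_mul,
        smul_add, smul_sub]
      simp only [smul_smul, mul_comm (k : ℂ)]
      abel
    have e2 := congrArg (fun M => (Matrix.trace M).re) e
    simp only [Matrix.trace_sub, Matrix.trace_add, Matrix.trace_smul, smul_eq_mul, Complex.sub_re,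
      Complex.add_re, Complex.re_ofReal_mul] at e2
    have p1 := mul_nonneg (mul_nonneg (sub_nonneg.2 hs.2) hc.le) (trace_conj_re_nonneg h1 Z)
    have p2 := mul_nonneg hs.1 (trace_conj_re_nonneg' h2 Z)
    linarith
  -- Completing the square: expanding ⟨W - k⁻¹Z, G(W - k⁻¹Z)⟩ ≥ 0 with GW = Y and the bound on ⟨Z,
  -- GZ⟩ leaves k⁻¹⟨Y, Z⟩ ≤ ⟨Y, W⟩.
  have hpos : 0 ≤ ((W - (k⁻¹ : ℂ) • Z)ᴴ * G (W - (k⁻¹ : ℂ) • Z)).trace.re := by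
    rw [hG, trace_mul_dop_re]
    exact Finset.sum_nonneg fun a ha => Finset.sum_nonneg fun b hb =>
      mul_nonneg (segment_pos (mul_pos hc (eigs_pos hA ha)) (eigs_pos hB hb) hs).le
        (hsWeight_nonneg _ _ _ _ _)
  have hsym : (Wᴴ * G Z).trace = (Yᴴ * Z).trace := by
    rw [hG, trace_dop_mul, ← hG, hWY]
  have hex : ((W - (k⁻¹ : ℂ) • Z)ᴴ * G (W - (k⁻¹ : ℂ) • Z)).trace.re
      = (Yᴴ * W).trace.re - 2 * k⁻¹ * (Yᴴ * Z).trace.re + k⁻¹ * (k⁻¹ * (Zᴴ * G Z).trace.re) := by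
    have : (k⁻¹ : ℂ) = ((k⁻¹ : ℝ) : ℂ) := by simp
    rw [map_sub, map_smul, hWY, this]
    simp only [Matrix.conjTranspose_sub, Matrix.conjTranspose_smul, Matrix.sub_mul, Matrix.mul_sub,
      Matrix.smul_mul, Matrix.mul_smul, Matrix.trace_sub, Matrix.trace_smul, smul_eq_mul,
      Complex.sub_re, hsym, Complex.star_def, Complex.conj_ofReal, Complex.re_ofReal_mul]
    rw [trace_re_comm W Y, trace_re_comm Z Y]
    ring
  rw [hex] at hpos
  rw [trace_re_comm Z Y] at hle
  have hk' := inv_pos.2 hk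
  have h3 : k⁻¹ * (k⁻¹ * (Zᴴ * G Z).trace.re) ≤ k⁻¹ * (Yᴴ * Z).trace.re := by
    apply mul_le_mul_of_nonneg_left _ hk'.le
    rw [inv_mul_le_iff₀ hk]
    exact hle
  have h4 : k⁻¹ * (Yᴴ * Z).trace.re ≤ (Yᴴ * W).trace.re := by linarith
  rwa [inv_mul_le_iff₀ hk] at h4

/-- The logarithmic form is antitone in the pair of positive matrices. -/
theorem logForm_le {c : ℝ} (hc : 0 < c) {A B A' B' : Matrix n n ℂ} (hA : A.PosDef)
    (hB : B.PosDef) (hA' : A'.PosDef) (hB' : B'.PosDef) {k : ℝ} (hk : 0 < k)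
    (h1 : ((k : ℂ) • A' - A).PosSemidef) (h2 : ((k : ℂ) • B' - B).PosSemidef)
    (Y : Matrix n n ℂ) : logForm c A' B' Y ≤ k * logForm c A B Y := by
  obtain ⟨i1, e1⟩ := logForm_eq_integral hc hA hB Y
  obtain ⟨i2, e2⟩ := logForm_eq_integral hc hA' hB' Y
  rw [e1, e2, ← intervalIntegral.integral_const_mul]
  exact intervalIntegral.integral_mono_on zero_le_one i2 (i1.const_mul k)
    fun s hs => segmentForm_le hc hA hB hA' hB' hk h1 h2 Y hs

theorem dop_sub_one {A B : Matrix n n ℂ} (hA : A.IsHermitian) (hB : B.IsHermitian) :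
    dop (fun a b => a - b) A B 1 = A - B := by
  rw [dop_sub_fun (fun a _ => a) (fun _ b => b), dop_left (fun a => a) A hB,
    dop_right (fun b => b) hA B, cfc_id' ℝ A hA.isSelfAdjoint, cfc_id' ℝ B hB.isSelfAdjoint,
    Matrix.one_mul, Matrix.mul_one]

/-- A noncommutative mean value formula: A - B is the double operator sum of a - b at the identity,
and the symbols multiply to log a - log b. -/
theorem log_sub_log {A B : Matrix n n ℂ} (hA : A.PosDef) (hB : B.PosDef) :
    cfc Real.log A - cfc Real.log B = dop invLogMean A B (A - B) := by
  rw [← dop_sub_one hA.1 hB.1, dop_dop,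
    dop_congr (G := fun a b => Real.log a - Real.log b), dop_sub_fun, dop_left _ A hB.1,
    dop_right _ hA.1, Matrix.mul_one, Matrix.one_mul]
  intro a ha b hb
  rw [mul_comm, sub_mul_invLogMean (eigs_pos hA ha) (eigs_pos hB hb)]

theorem trace_sub_mul_log_sub {A B : Matrix n n ℂ} (hA : A.PosDef) (hB : B.PosDef) :
    ((A - B) * (cfc Real.log A - cfc Real.log B)).trace.re = logForm 1 A B (A - B) := by
  rw [log_sub_log hA hB, logForm, (hA.1.sub hB.1).eq]
  simp only [one_mul]

/-- The relative entropy as a real number. -/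
def relEnt (ρ τ : Matrix n n ℂ) : ℝ := (ρ * cfc Real.log ρ - ρ * cfc Real.log τ).trace.re

/-- Klein's inequality. -/
theorem trace_sub_le_relEnt {ρ τ : Matrix n n ℂ} (hρ : ρ.PosSemidef) (hτ : τ.PosDef) :
    (ρ - τ).trace.re ≤ relEnt ρ τ := by
  have h := trace_mul_dop_re (fun a b => a * Real.log a - a * Real.log b - (a - b)) ρ τ 1
  have e : dop (fun a b => a * Real.log a - a * Real.log b - (a - b)) ρ τ 1
      = ρ * cfc Real.log ρ - ρ * cfc Real.log τ - (ρ - τ) := by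
    rw [dop_sub_fun, dop_sub_one hρ.1 hτ.1, dop_sub_fun,
      ← dop_dop (fun a _ => a) (fun a _ => Real.log a),
      ← dop_dop (fun a _ => a) (fun _ b => Real.log b), dop_left _ ρ hτ.1, dop_left _ ρ hτ.1,
      dop_right _ hρ.1, dop_left _ ρ hτ.1, cfc_id' ℝ ρ hρ.1.isSelfAdjoint, Matrix.mul_one,
      Matrix.one_mul]
  have hs : 0 ≤ ∑ a ∈ eigs ρ, ∑ b ∈ eigs τ,
      (a * Real.log a - a * Real.log b - (a - b)) * hsWeight ρ τ 1 a b := by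
    refine Finset.sum_nonneg fun a ha => Finset.sum_nonneg fun b hb =>
      mul_nonneg ?_ (hsWeight_nonneg _ _ _ _ _)
    have hb' := eigs_pos hτ hb
    -- The scalar inequality is log x ≤ x - 1 at x = b/a. At a = 0 the expression is just b.
    rcases (eigs_nonneg hρ ha).eq_or_lt with rfl | ha'
    · simpa using hb'.le
    · have h1 := Real.log_le_sub_one_of_pos (div_pos hb' ha')
      rw [Real.log_div hb'.ne' ha'.ne'] at h1
      have h2 := mul_le_mul_of_nonneg_left h1 ha'.le
      have h3 : a * (b / a - 1) = b - a := by field_simp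
      linarith
  rw [e, Matrix.conjTranspose_one, Matrix.one_mul, Matrix.trace_sub, Complex.sub_re] at h
  rw [relEnt]
  linarith

theorem relEnt_nonneg {ρ τ : Matrix n n ℂ} (hρ : ρ.PosSemidef) (hτ : τ.PosDef)
    (h : ρ.trace = τ.trace) : 0 ≤ relEnt ρ τ := by
  have := trace_sub_le_relEnt hρ hτ
  rw [Matrix.trace_sub, h, sub_self] at this
  simpa using this

end LogForm

/-! ### Comparison of the relative entropy with the χ²-divergence. -/

section ChiSquare

variable {n : Type*} [Fintype n] [DecidableEq n]

/-- Convexity in the first argument, as a tangent inequality: the two sides differ by exactly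
D(ρ'‖ρ) ≥ 0. -/
theorem relEnt_sub_relEnt_le {ρ ρ' : Matrix n n ℂ} (τ : Matrix n n ℂ) (hρ : ρ.PosDef)
    (hρ' : ρ'.PosSemidef) (h : ρ.trace = ρ'.trace) :
    relEnt ρ τ - relEnt ρ' τ ≤ ((ρ - ρ') * (cfc Real.log ρ - cfc Real.log τ)).trace.re := by
  have := relEnt_nonneg hρ' hρ h.symm
  simp only [relEnt, Matrix.sub_mul, Matrix.mul_sub, Matrix.trace_sub, Complex.sub_re] at this ⊢
  linarith

theorem logForm_smul (c : ℝ) (A B Y : Matrix n n ℂ) (t : ℝ) :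
    logForm c A B ((t : ℂ) • Y) = t ^ 2 * logForm c A B Y := by
  simp only [logForm, map_smul, Matrix.conjTranspose_smul, Matrix.smul_mul, Matrix.mul_smul,
    Matrix.trace_smul, smul_eq_mul, Complex.star_def, Complex.conj_ofReal, Complex.re_ofReal_mul]
  ring

theorem eq_of_specProj_mul_mul_specProj {A B Y Y' : Matrix n n ℂ} (hA : A.IsHermitian)
    (hB : B.IsHermitian)
    (h : ∀ a ∈ eigs A, ∀ b ∈ eigs B,
      specProj A a * Y * specProj B b = specProj A a * Y' * specProj B b) : Y = Y' := by
  rw [← dop_one hA hB Y, ← dop_one hA hB Y', dop_apply, dop_apply]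
  exact Finset.sum_congr rfl fun a ha => Finset.sum_congr rfl fun b hb => by rw [h a ha b hb]

theorem logForm_pos {c : ℝ} (hc : 0 < c) {A B : Matrix n n ℂ} (hA : A.PosDef) (hB : B.PosDef)
    {Y : Matrix n n ℂ} (hY : Y ≠ 0) : 0 < logForm c A B Y := by
  apply lt_of_le_of_ne (logForm_nonneg hc hA hB Y)
  intro h0
  apply hY
  have hnn : ∀ a ∈ eigs A, ∀ b ∈ eigs B, 0 ≤ invLogMean (c * a) b * hsWeight A B Y a b :=
    fun a ha b hb => mul_nonneg (invLogMean_pos (mul_pos hc (eigs_pos hA ha)) (eigs_pos hB hb)).le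
      (hsWeight_nonneg _ _ _ _ _)
  rw [logForm, trace_mul_dop_re, eq_comm,
    Finset.sum_eq_zero_iff_of_nonneg fun a ha => Finset.sum_nonneg (hnn a ha)] at h0
  refine eq_of_specProj_mul_mul_specProj hA.1 hB.1 fun a ha b hb => ?_
  have h1 := (Finset.sum_eq_zero_iff_of_nonneg (hnn a ha)).1 (h0 a ha) b hb
  have h2 := (mul_eq_zero.1 h1).resolve_left
    (invLogMean_pos (mul_pos hc (eigs_pos hA ha)) (eigs_pos hB hb)).ne'
  rw [Matrix.mul_zero, Matrix.zero_mul]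
  apply Matrix.trace_conjTranspose_mul_self_eq_zero_iff.1
  have h3 := (Matrix.posSemidef_conjTranspose_mul_self
    (specProj A a * Y * specProj B b)).trace_nonneg
  exact Complex.ext h2 (Complex.le_def.1 h3).2.symm

theorem posDef_segment {σ ρ : Matrix n n ℂ} (hσ : σ.PosDef) (hρ : ρ.PosDef) {t : ℝ}
    (ht : t ∈ Set.Icc (0 : ℝ) 1) : (σ + (t : ℂ) • (ρ - σ)).PosDef := by
  have e : σ + (t : ℂ) • (ρ - σ) = ((1 - t : ℝ) : ℂ) • σ + (t : ℂ) • ρ := by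
    push_cast
    module
  rw [e]
  rcases ht.1.eq_or_lt with rfl | h
  · simpa using hσ
  · exact Matrix.PosDef.posSemidef_add
      (hσ.posSemidef.smul (Complex.zero_le_real.2 (sub_nonneg.2 ht.2)))
      (hρ.smul (Complex.zero_lt_real.2 h))

theorem trace_mul_log_sub_eq {A B η : Matrix n n ℂ} (hA : A.PosDef) (hB : B.PosDef)
    (hη : η.IsHermitian) {t : ℝ} (h : A - B = (t : ℂ) • η) :
    (η * (cfc Real.log A - cfc Real.log B)).trace.re = t * logForm 1 A B η := by
  rw [log_sub_log hA hB, h, logForm, map_smul, Matrix.mul_smul, Matrix.trace_smul, smul_eq_mul,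
    Complex.re_ofReal_mul, hη.eq]
  simp only [one_mul]

/-- The relative entropy is bounded by the `χ²`-divergence. -/
theorem relEnt_le_logForm {ρ σ : Matrix n n ℂ} (hρ : ρ.PosDef) (hσ : σ.PosDef)
    (htr : ρ.trace = σ.trace) : relEnt ρ σ ≤ logForm 1 σ σ (ρ - σ) := by
  -- Along r(t) = σ + tη let f be the entropy and φ its slope. Since r(t) ≥ (1-t)σ, antitonicity
  -- bounds the growth of φ by χ/(1-t), so f + (1-t)φ grows at rate at most χ, which gives f(1) ≤ χ.
  -- Finite differences replace derivatives below.
  set η := ρ - σ with hη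
  have hηH : η.IsHermitian := hρ.1.sub hσ.1
  set r : ℝ → Matrix n n ℂ := fun t => σ + (t : ℂ) • η with hr
  have hpd : ∀ t ∈ Set.Icc (0 : ℝ) 1, (r t).PosDef := fun t ht => posDef_segment hσ hρ ht
  have htr' : ∀ t, (r t).trace = σ.trace := fun t => by
    simp [hr, hη, Matrix.trace_add, Matrix.trace_smul, Matrix.trace_sub, htr]
  have hsub : ∀ s t, r t - r s = ((t - s : ℝ) : ℂ) • η := fun s t => by
    simp only [hr]
    push_cast
    module
  set f : ℝ → ℝ := fun t => relEnt (r t) σ with hf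
  set φ : ℝ → ℝ := fun t => (η * (cfc Real.log (r t) - cfc Real.log σ)).trace.re with hφ
  set χ := logForm 1 σ σ η with hχ
  have hr0 : r 0 = σ := by simp [hr]
  have hr1 : r 1 = ρ := by simp [hr, hη]
  have hf0 : f 0 = 0 := by simp [hf, hr0, relEnt]
  have hφ0 : φ 0 = 0 := by simp [hφ, hr0]
  have sub_le_tangent : ∀ s ∈ Set.Icc (0 : ℝ) 1, ∀ t ∈ Set.Icc (0 : ℝ) 1, f t - f s ≤ (t - s) * φ t := by
    intro s hs t ht
    have := relEnt_sub_relEnt_le σ (hpd t ht) (hpd s hs).posSemidef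
      ((htr' t).trans (htr' s).symm)
    rw [hsub, Matrix.smul_mul, Matrix.trace_smul, smul_eq_mul, Complex.re_ofReal_mul] at this
    exact this
  have tangent_sub_le : ∀ s t, 0 ≤ s → s ≤ t → t < 1 → φ t - φ s ≤ (t - s) * ((1 - t)⁻¹ * χ) := by
    intro s t h0 hst h1
    have e : φ t - φ s = (t - s) * logForm 1 (r t) (r s) η := by
      rw [← trace_mul_log_sub_eq (hpd t ⟨h0.trans hst, h1.le⟩) (hpd s ⟨h0, hst.trans h1.le⟩) hηH
        (hsub s t)]
      simp only [hφ, Matrix.mul_sub, Matrix.trace_sub, Complex.sub_re]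
      ring
    rw [e]
    have h1' : 0 < (1 - t)⁻¹ := inv_pos.2 (sub_pos.2 h1)
    have hne : (1 - (t : ℂ)) ≠ 0 := by
      have : ((1 - t : ℝ) : ℂ) ≠ 0 := by exact_mod_cast (sub_pos.2 h1).ne'
      simpa using this
    apply mul_le_mul_of_nonneg_left _ (sub_nonneg.2 hst)
    -- Both r(t) and r(s) dominate (1-t)σ, because s ≤ t.
    apply logForm_le one_pos hσ hσ (hpd t ⟨h0.trans hst, h1.le⟩) (hpd s ⟨h0, hst.trans h1.le⟩) h1'
    · have : (((1 - t)⁻¹ : ℝ) : ℂ) • r t - σ = (((1 - t)⁻¹ * t : ℝ) : ℂ) • ρ := by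
        simp only [hr, hη]
        push_cast
        match_scalars <;> (field_simp; try ring)
      rw [this]
      exact hρ.posSemidef.smul (Complex.zero_le_real.2 (mul_nonneg h1'.le (h0.trans hst)))
    · have : (((1 - t)⁻¹ : ℝ) : ℂ) • r s - σ = (((1 - t)⁻¹ * s : ℝ) : ℂ) • ρ
          + (((1 - t)⁻¹ * (t - s) : ℝ) : ℂ) • σ := by
        simp only [hr, hη]
        push_cast
        match_scalars <;> (field_simp; try ring)
      rw [this]
      exact (hρ.posSemidef.smul (Complex.zero_le_real.2 (mul_nonneg h1'.le h0))).add
        (hσ.posSemidef.smul (Complex.zero_le_real.2 (mul_nonneg h1'.le (sub_nonneg.2 hst))))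
  have main : ∀ N : ℕ, 0 < N → f 1 ≤ χ + φ 1 / N := by
    intro N hN
    have hN' : (0 : ℝ) < N := by exact_mod_cast hN
    -- The discrete form of f + (1-t)φ. The weight is N - i - 1 rather than N - i because both
    -- finite-difference bounds are taken at the right endpoint (i+1)/N.
    have ind : ∀ i : ℕ, i + 1 ≤ N →
        N * f (i / N) + (N - i - 1) * φ (i / N) ≤ i * χ := by
      intro i
      induction i with
      | zero => intro _; simp [hf0, hφ0]
      | succ i ih =>
        intro hi
        have ih' := ih (by omega)
        have hiN : ((i + 1 : ℕ) : ℝ) + 1 ≤ N := by exact_mod_cast hi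
        push_cast at hiN ⊢
        have hi0 : (0 : ℝ) ≤ i := Nat.cast_nonneg i
        have m1 : (i : ℝ) / N ∈ Set.Icc (0 : ℝ) 1 :=
          ⟨by positivity, by rw [div_le_one hN']; linarith⟩
        have m2 : ((i : ℝ) + 1) / N ∈ Set.Icc (0 : ℝ) 1 :=
          ⟨by positivity, by rw [div_le_one hN']; linarith⟩
        have d : ((i : ℝ) + 1) / N - i / N = 1 / N := by ring
        have s1 := sub_le_tangent _ m1 _ m2
        have s2 := tangent_sub_le (i / N) ((i + 1) / N) m1.1 (by rw [← sub_nonneg, d]; positivity)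
          (by rw [div_lt_one hN']; linarith)
        rw [d] at s1 s2
        have hpos : (0 : ℝ) < N - i - 1 := by linarith
        have e : (1 - ((i : ℝ) + 1) / N)⁻¹ = N / (N - i - 1) := by
          have : 1 - ((i : ℝ) + 1) / N = (N - i - 1) / N := by field_simp; ring
          rw [this, inv_div]
        rw [e] at s2
        have e2 : 1 / (N : ℝ) * (N / (N - i - 1) * χ) = χ / (N - i - 1) := by field_simp
        rw [e2] at s2
        have s2' := mul_le_mul_of_nonneg_left s2 hpos.le
        rw [mul_div_cancel₀ χ hpos.ne'] at s2'
        have s1' := mul_le_mul_of_nonneg_left s1 hN'.le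
        rw [← mul_assoc, mul_one_div_cancel hN'.ne', one_mul] at s1'
        nlinarith
    obtain ⟨M, rfl⟩ : ∃ M, N = M + 1 := ⟨N - 1, by omega⟩
    have h1 := ind M le_rfl
    push_cast at h1 hN' ⊢
    have h2 : (M : ℝ) + 1 - M - 1 = 0 := by ring
    rw [h2, zero_mul, add_zero] at h1
    have hM0 : (0 : ℝ) ≤ M := Nat.cast_nonneg M
    have m1 : (M : ℝ) / (M + 1) ∈ Set.Icc (0 : ℝ) 1 :=
      ⟨by positivity, by rw [div_le_one hN']; linarith⟩
    -- The bound on φ degenerates at t = 1, so the last step uses only the tangent inequality. It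
    -- costs φ(1)/N, which vanishes in the limit.
    have s1 := sub_le_tangent _ m1 1 ⟨zero_le_one, le_rfl⟩
    have e : (1 : ℝ) - M / (M + 1) = 1 / (M + 1) := by field_simp; ring
    rw [e] at s1
    have hχ0 : 0 ≤ χ := logForm_nonneg one_pos hσ hσ η
    have h3 : f (M / (M + 1)) ≤ χ := by nlinarith
    have e3 : 1 / ((M : ℝ) + 1) * φ 1 = φ 1 / (M + 1) := by ring
    linarith
  have lim : Tendsto (fun N : ℕ => χ + φ 1 / N) atTop (𝓝 (χ + 0)) :=
    (tendsto_const_div_atTop_nhds_zero_nat (φ 1)).const_add χ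
  rw [add_zero] at lim
  have := ge_of_tendsto lim (eventually_atTop.2 ⟨1, fun N hN => main N hN⟩)
  simpa [hf, hr1] using this

/-- The tangent inequality from σ + 2η back to σ + η gains the form at (σ + η, σ), while D(σ + η‖σ)
≥ 0. The factor 2 comes from σ + η ≤ 2σ. The lemma bounds the entropy of small perturbations from
below. -/
theorem logForm_le_relEnt {σ η : Matrix n n ℂ} (hσ : σ.PosDef) (hη : η.IsHermitian)
    (h1 : (σ + η).PosDef) (h2 : (σ + (2 : ℂ) • η).PosDef) (h3 : (σ - η).PosSemidef)
    (htr : η.trace = 0) : logForm 1 σ σ η ≤ 2 * relEnt (σ + (2 : ℂ) • η) σ := by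
  have a1 := relEnt_sub_relEnt_le σ h1 h2.posSemidef (by
    simp [Matrix.trace_add, Matrix.trace_smul, htr])
  have e : σ + η - (σ + (2 : ℂ) • η) = (-1 : ℂ) • η := by module
  have a2 := trace_mul_log_sub_eq h1 hσ hη (t := 1) (by simp)
  have a3 := relEnt_nonneg h1.posSemidef hσ (by simp [Matrix.trace_add, htr])
  have a4 := logForm_le one_pos h1 hσ hσ hσ (k := 2) two_pos
    (by
      have : ((2 : ℝ) : ℂ) • σ - (σ + η) = σ - η := by push_cast; module
      rwa [this])
    (by
      have : ((2 : ℝ) : ℂ) • σ - σ = σ := by push_cast; module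
      rw [this]
      exact hσ.posSemidef) η
  rw [e, Matrix.smul_mul, Matrix.trace_smul, neg_one_smul, Complex.neg_re, a2] at a1
  linarith

end ChiSquare

/-! ### Kraus operators adapted to the modular structure. -/

section Kraus

variable {n : Type*} [Fintype n] [DecidableEq n] {N : StarSubalgebra ℂ (Matrix n n ℂ)}

/-- `K` is a family of Kraus operators of `Φ`. -/
def IsKraus {J : Type*} [Fintype J] (Φ : N →ₗ[ℂ] N) (K : J → Matrix n n ℂ) : Prop :=
  ∀ X : N, (Φ X : Matrix n n ℂ) = ∑ j, (K j)ᴴ * X * K j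

theorem IsKraus.map_star {J : Type*} [Fintype J] {Φ : N →ₗ[ℂ] N} {K : J → Matrix n n ℂ}
    (hK : IsKraus Φ K) (X : N) : Φ (star X) = star (Φ X) := by
  apply Subtype.ext
  have h1 := hK (star X)
  have h2 := congrArg Matrix.conjTranspose (hK X)
  rw [Matrix.conjTranspose_sum] at h2
  simp only [Matrix.conjTranspose_mul, Matrix.conjTranspose_conjTranspose] at h2
  rw [h1]
  refine Eq.trans ?_ h2.symm
  exact Finset.sum_congr rfl fun j _ => Matrix.mul_assoc _ _ _

theorem eq_of_trace_mul_eq {X Y : Matrix n n ℂ} (hX : X ∈ N) (hY : Y ∈ N)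
    (h : ∀ Z ∈ N, (X * Z).trace = (Y * Z).trace) : X = Y := by
  have h1 : ((X - Y) * (X - Y)ᴴ).trace = 0 := by
    have h2 : (X - Y)ᴴ ∈ N := star_mem (sub_mem hX hY)
    rw [Matrix.sub_mul, Matrix.trace_sub, h _ h2, sub_self]
  exact sub_eq_zero.1 (Matrix.trace_mul_conjTranspose_self_eq_zero_iff.1 h1)

/-- Symmetry of `Φ` in the GNS inner product of `ω`. -/
def GNSSymm (ω : Matrix n n ℂ) (Φ : N →ₗ[ℂ] N) : Prop :=
  ∀ X Y : N, (ω * (X : Matrix n n ℂ)ᴴ * Φ Y).trace = (ω * (Φ X : Matrix n n ℂ)ᴴ * Y).trace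

theorem GNSSymm.trace_mul {ω : Matrix n n ℂ} {Φ : N →ₗ[ℂ] N} (h : GNSSymm ω Φ)
    (hs : ∀ X, Φ (star X) = star (Φ X)) (X Y : N) :
    (ω * X * Φ Y : Matrix n n ℂ).trace = (ω * Φ X * Y : Matrix n n ℂ).trace := by
  have := h (star X) Y
  rw [hs] at this
  have e : ∀ Z : N, ((star Z : N) : Matrix n n ℂ)ᴴ = Z := fun Z =>
    Matrix.conjTranspose_conjTranspose _
  rwa [e, e] at this

/-- GNS symmetry together with preservation of adjoints makes Φ respect the modular grading. Moving
Φ across both tr(ωZΦ(X)) and tr(ωXΦ(Z)), for X with ωX = bX and Xω = cX, gives c ωΦ(X) = b Φ(X)ω, so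
only blocks with a/d = b/c survive. -/
theorem specProj_mul_map_mul_specProj {ω : Matrix n n ℂ} (hω : ω.IsHermitian) (hωN : ω ∈ N)
    {Φ : N →ₗ[ℂ] N} (h : GNSSymm ω Φ) (hs : ∀ X, Φ (star X) = star (Φ X)) {X : N} {b c : ℝ}
    (h1 : ω * X = (b : ℂ) • (X : Matrix n n ℂ)) (h2 : X * ω = (c : ℂ) • (X : Matrix n n ℂ))
    {a d : ℝ} (hne : c * a ≠ b * d) :
    specProj ω a * Φ X * specProj ω d = 0 := by
  have e : (c : ℂ) • (ω * Φ X) = (b : ℂ) • (Φ X * ω) := by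
    apply eq_of_trace_mul_eq (N := N) (SMulMemClass.smul_mem _ (mul_mem hωN (Φ X).2))
      (SMulMemClass.smul_mem _ (mul_mem (Φ X).2 hωN))
    intro Z hZ
    have g1 := h.trace_mul hs ⟨Z, hZ⟩ X
    have g2 := h.trace_mul hs X ⟨Z, hZ⟩
    simp only at g1 g2
    rw [h1] at g2
    have r : (Φ X * ω * Z : Matrix n n ℂ).trace
        = (c : ℂ) * ((Φ ⟨Z, hZ⟩ : Matrix n n ℂ) * X).trace := by
      rw [Matrix.mul_assoc, Matrix.trace_mul_comm, g1, Matrix.mul_assoc ω, Matrix.trace_mul_comm ω,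
        Matrix.mul_assoc, h2, Matrix.mul_smul, Matrix.trace_smul, smul_eq_mul]
    rw [Matrix.smul_mul, Matrix.smul_mul, Matrix.trace_smul, Matrix.trace_smul, r, ← g2,
      Matrix.smul_mul, Matrix.trace_smul, Matrix.trace_mul_comm (X : Matrix n n ℂ)]
    simp only [smul_eq_mul]
    ring
  have e2 := congrArg (fun M => specProj ω a * M * specProj ω d) e
  simp only [Matrix.mul_smul, Matrix.smul_mul] at e2
  rw [← Matrix.mul_assoc, specProj_mul hω, Matrix.mul_assoc _ ((Φ X : Matrix n n ℂ) * ω),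
    Matrix.mul_assoc _ ω, mul_specProj hω] at e2
  simp only [Matrix.mul_smul, Matrix.smul_mul, smul_smul, ← Matrix.mul_assoc] at e2
  have e3 : (((c * a - b * d : ℝ)) : ℂ) • (specProj ω a * Φ X * specProj ω d) = 0 := by
    push_cast
    rw [sub_smul, e2, sub_self]
  refine (smul_eq_zero.1 e3).resolve_left ?_
  exact_mod_cast sub_ne_zero.2 hne

/-- The component of `K` on which `X ↦ ω X ω⁻¹` acts as multiplication by `ν`. -/
def modPart (ω : Matrix n n ℂ) (ν : ℝ) (K : Matrix n n ℂ) : Matrix n n ℂ :=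
  dop (fun a b => if a = ν * b then 1 else 0) ω ω K

theorem mul_modPart {ω : Matrix n n ℂ} (hω : ω.IsHermitian) (ν : ℝ) (K : Matrix n n ℂ) :
    ω * modPart ω ν K = (ν : ℂ) • (modPart ω ν K * ω) := by
  have h1 := dop_left (fun a => a) ω hω (modPart ω ν K)
  have h2 := dop_right (fun a => a) hω ω (modPart ω ν K)
  rw [cfc_id' ℝ ω hω.isSelfAdjoint] at h1 h2
  rw [← h1, ← h2, ← dop_const_mul ν (fun _ b => b), modPart, dop_dop, dop_dop]
  apply dop_congr
  intro a _ b _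
  by_cases h : a = ν * b <;> simp [h]

/-- Each Kraus operator is split into its modular components. Cross terms between different
components would change the modular degree, which Φ cannot do, so they can be dropped. -/
theorem IsKraus.exists_modular {J : Type*} [Fintype J] {Φ : N →ₗ[ℂ] N} {K : J → Matrix n n ℂ}
    (hK : IsKraus Φ K) {ω : Matrix n n ℂ} (hω : ω.PosDef) (hωN : ω ∈ N) (h : GNSSymm ω Φ) :
    ∃ (R : Finset ℝ) (K' : J × R → Matrix n n ℂ) (ν : J × R → ℝ), IsKraus Φ K' ∧
      ∀ j, 0 < ν j ∧ ω * K' j = (ν j : ℂ) • (K' j * ω) := by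
  classical
  refine ⟨(eigs ω ×ˢ eigs ω).image fun p => p.1 / p.2, fun p => modPart ω p.2 (K p.1),
    fun p => p.2, ?_, ?_⟩
  swap
  · rintro ⟨j, ν, hν⟩
    refine ⟨?_, mul_modPart hω.1 _ _⟩
    obtain ⟨⟨a, b⟩, hab, rfl⟩ := Finset.mem_image.1 hν
    rw [Finset.mem_product] at hab
    exact div_pos (eigs_pos hω hab.1) (eigs_pos hω hab.2)
  set R := (eigs ω ×ˢ eigs ω).image fun p => p.1 / p.2 with hR
  -- By linearity it suffices to treat an X contained in a single spectral block of ω.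
  have key : ∀ (X : N) (b c : ℝ), b ∈ eigs ω → c ∈ eigs ω →
      (X : Matrix n n ℂ) = specProj ω b * X * specProj ω c →
      (Φ X : Matrix n n ℂ)
        = ∑ p : J × R, (modPart ω p.2 (K p.1))ᴴ * X * modPart ω p.2 (K p.1) := by
    intro X b c hb hc hX
    have h1 : ω * X = (b : ℂ) • (X : Matrix n n ℂ) := by
      conv_lhs => rw [hX]
      rw [← Matrix.mul_assoc, ← Matrix.mul_assoc, mul_specProj hω.1, Matrix.smul_mul,
        Matrix.smul_mul, ← hX]
    have h2 : X * ω = (c : ℂ) • (X : Matrix n n ℂ) := by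
      conv_lhs => rw [hX]
      rw [Matrix.mul_assoc, specProj_mul hω.1, Matrix.mul_smul, ← hX]
    refine eq_of_specProj_mul_mul_specProj hω.1 hω.1 fun a ha d hd => ?_
    have comp : ∀ ν j, specProj ω a * ((modPart ω ν (K j))ᴴ * X * modPart ω ν (K j)) * specProj ω d
        = if b = ν * a ∧ c = ν * d then
          specProj ω a * ((K j)ᴴ * X * K j) * specProj ω d else 0 := by
      intro ν j
      have e1 : specProj ω c * modPart ω ν (K j) * specProj ω d
          = if c = ν * d then specProj ω c * K j * specProj ω d else 0 := by
        rw [modPart, specProj_dop_specProj]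
        split_ifs <;> simp
      have e2 : specProj ω a * (modPart ω ν (K j))ᴴ * specProj ω b
          = if b = ν * a then specProj ω a * (K j)ᴴ * specProj ω b else 0 := by
        rw [modPart, dop_conjTranspose, specProj_dop_specProj]
        split_ifs <;> simp
      have e3 : ∀ L : Matrix n n ℂ, specProj ω a * (Lᴴ * X * L) * specProj ω d
          = (specProj ω a * Lᴴ * specProj ω b) * X * (specProj ω c * L * specProj ω d) := by
        intro L
        conv_lhs => rw [hX]
        simp only [Matrix.mul_assoc]
      rw [e3, e1, e2, e3]
      by_cases hb' : b = ν * a <;> by_cases hc' : c = ν * d <;> simp [hb', hc']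
    rw [Finset.mul_sum, Finset.sum_mul]
    simp only [comp]
    -- If the block respects the grading, exactly the component ν = b/a contributes and it carries
    -- the whole block. Otherwise both sides vanish.
    by_cases hcase : c * a = b * d
    · have ha0 := (eigs_pos hω ha).ne'
      have hd0 := (eigs_pos hω hd).ne'
      rw [hK X, Finset.mul_sum, Finset.sum_mul, Fintype.sum_prod_type]
      refine Finset.sum_congr rfl fun j _ => ?_
      have hmem : b / a ∈ R :=
        Finset.mem_image.2 ⟨(b, a), Finset.mem_product.2 ⟨hb, ha⟩, rfl⟩
      rw [Finset.sum_eq_single (⟨b / a, hmem⟩ : R)]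
      · rw [if_pos]
        constructor
        · field_simp
        · field_simp
          linarith
      · rintro ⟨ν, hν⟩ _ hne
        rw [if_neg]
        rintro ⟨h3, -⟩
        apply hne
        apply Subtype.ext
        simp only
        rw [h3]
        field_simp
      · exact fun h => absurd (Finset.mem_univ _) h
    · rw [specProj_mul_map_mul_specProj hω.1 hωN h hK.map_star h1 h2 hcase]
      symm
      refine Finset.sum_eq_zero fun p _ => ?_
      rw [if_neg]
      rintro ⟨h3, h4⟩
      apply hcase
      rw [h3, h4]
      ring
  intro X
  have hX : X = ∑ b ∈ eigs ω, ∑ c ∈ eigs ω, (⟨specProj ω b * X * specProj ω c,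
      mul_mem (mul_mem (specProj_mem hωN b) X.2) (specProj_mem hωN c)⟩ : N) := by
    apply Subtype.ext
    have := dop_one hω.1 hω.1 (X : Matrix n n ℂ)
    rw [dop_apply] at this
    simp only [Complex.ofReal_one, one_smul] at this
    push_cast
    exact this.symm
  have lin : ∀ Z : N, (∑ p : J × R, (modPart ω p.2 (K p.1))ᴴ * Z * modPart ω p.2 (K p.1))
      = (∑ p : J × R, LinearMap.mulRight ℂ (modPart ω p.2 (K p.1)) ∘ₗ
        LinearMap.mulLeft ℂ ((modPart ω p.2 (K p.1))ᴴ) ∘ₗ N.subtype.toAlgHom.toLinearMap) Z := by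
    intro Z
    simp [LinearMap.sum_apply]
  rw [lin]
  generalize hT : (∑ p : J × R, LinearMap.mulRight ℂ (modPart ω p.2 (K p.1)) ∘ₗ
        LinearMap.mulLeft ℂ ((modPart ω p.2 (K p.1))ᴴ) ∘ₗ N.subtype.toAlgHom.toLinearMap) = T
    at lin ⊢
  rw [hX]
  simp only [map_sum]
  push_cast
  refine Finset.sum_congr rfl fun b hb => Finset.sum_congr rfl fun c hc => ?_
  rw [← lin]
  apply key _ b c hb hc
  simp only [← Matrix.mul_assoc]
  rw [specProj_mul_specProj, if_pos rfl]
  simp only [Matrix.mul_assoc]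
  rw [specProj_mul_specProj, if_pos rfl]

end Kraus

/-! ### Commutation of modular eigenvectors with functions of ω. -/

section Intertwining

variable {n : Type*} [Fintype n] [DecidableEq n]

theorem specProj_mul_mul_specProj_eq_zero {ω K : Matrix n n ℂ} {ν : ℝ} (hω : ω.IsHermitian)
    (h : ω * K = (ν : ℂ) • (K * ω)) {a b : ℝ} (hab : a ≠ ν * b) :
    specProj ω a * K * specProj ω b = 0 := by
  have e2 := congrArg (fun M => specProj ω a * M * specProj ω b) h
  simp only [Matrix.mul_smul, Matrix.smul_mul] at e2
  rw [← Matrix.mul_assoc, specProj_mul hω, Matrix.mul_assoc _ (K * ω),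
    Matrix.mul_assoc _ ω, mul_specProj hω] at e2
  simp only [Matrix.mul_smul, Matrix.smul_mul, smul_smul, ← Matrix.mul_assoc] at e2
  have e3 : (((a - ν * b : ℝ)) : ℂ) • (specProj ω a * K * specProj ω b) = 0 := by
    push_cast
    rw [sub_smul, e2, sub_self]
  refine (smul_eq_zero.1 e3).resolve_left ?_
  exact_mod_cast sub_ne_zero.2 hab

/-- K maps the d-eigenspace of ω to its νd-eigenspace. Moving K through a double operator sum
therefore only rescales one variable of the symbol. -/
theorem mul_specProj_of_modular {ω K : Matrix n n ℂ} {ν : ℝ} (hν : 0 < ν) (hω : ω.IsHermitian)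
    (h : ω * K = (ν : ℂ) • (K * ω)) (d : ℝ) :
    K * specProj ω d = specProj ω (ν * d) * K := by
  refine eq_of_specProj_mul_mul_specProj hω hω fun a _ b _ => ?_
  have l : specProj ω a * (K * specProj ω d) * specProj ω b
      = if d = b then specProj ω a * K * specProj ω b else 0 := by
    simp only [Matrix.mul_assoc]
    rw [specProj_mul_specProj]
    split_ifs with hdb
    · rw [hdb]
    · simp
  have r : specProj ω a * (specProj ω (ν * d) * K) * specProj ω b
      = if a = ν * d then specProj ω a * K * specProj ω b else 0 := by
    simp only [← Matrix.mul_assoc]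
    rw [specProj_mul_specProj]
    split_ifs <;> simp
  rw [l, r]
  by_cases hab : a = ν * b
  · have : d = b ↔ a = ν * d := by
      rw [hab]
      constructor
      · rintro rfl; rfl
      · intro h'
        exact (mul_left_cancel₀ hν.ne' h').symm
    simp only [this]
  · rw [specProj_mul_mul_specProj_eq_zero hω h hab]
    simp

theorem conjTranspose_modular {ω K : Matrix n n ℂ} {ν : ℝ} (hν : 0 < ν) (hω : ω.IsHermitian)
    (h : ω * K = (ν : ℂ) • (K * ω)) : ω * Kᴴ = ((ν⁻¹ : ℝ) : ℂ) • (Kᴴ * ω) := by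
  have h1 := congrArg Matrix.conjTranspose h
  simp only [Matrix.conjTranspose_smul, Matrix.conjTranspose_mul, hω.eq, Complex.star_def,
    Complex.conj_ofReal] at h1
  rw [h1, smul_smul, ← Complex.ofReal_mul, inv_mul_cancel₀ hν.ne', Complex.ofReal_one, one_smul]

theorem dop_mul_of_modular {ω K : Matrix n n ℂ} {ν : ℝ} (hν : 0 < ν) (hω : ω.IsHermitian)
    (h : ω * K = (ν : ℂ) • (K * ω)) (F : ℝ → ℝ → ℝ) (X : Matrix n n ℂ) :
    dop F ω ω X * K = dop (fun a b => F a (ν * b)) ω ω (X * K) := by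
  refine eq_of_specProj_mul_mul_specProj hω hω fun a _ b _ => ?_
  rw [specProj_dop_specProj]
  calc specProj ω a * (dop F ω ω X * K) * specProj ω b
      = specProj ω a * dop F ω ω X * (K * specProj ω b) := by simp only [Matrix.mul_assoc]
    _ = specProj ω a * dop F ω ω X * specProj ω (ν * b) * K := by
        rw [mul_specProj_of_modular hν hω h]; simp only [Matrix.mul_assoc]
    _ = _ := by
        rw [specProj_dop_specProj, Matrix.smul_mul, Matrix.mul_assoc _ _ K,
          ← mul_specProj_of_modular hν hω h]
        simp only [Matrix.mul_assoc]

theorem mul_dop_of_modular {ω K : Matrix n n ℂ} {ν : ℝ} (hν : 0 < ν) (hω : ω.IsHermitian)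
    (h : ω * K = (ν : ℂ) • (K * ω)) (F : ℝ → ℝ → ℝ) (X : Matrix n n ℂ) :
    K * dop F ω ω X = dop (fun a b => F (ν⁻¹ * a) b) ω ω (K * X) := by
  have h' : ∀ a, specProj ω a * K = K * specProj ω (ν⁻¹ * a) := fun a => by
    rw [mul_specProj_of_modular hν hω h, ← mul_assoc, mul_inv_cancel₀ hν.ne', one_mul]
  refine eq_of_specProj_mul_mul_specProj hω hω fun a _ b _ => ?_
  rw [specProj_dop_specProj]
  calc specProj ω a * (K * dop F ω ω X) * specProj ω b
      = K * (specProj ω (ν⁻¹ * a) * dop F ω ω X * specProj ω b) := by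
        rw [← Matrix.mul_assoc, h']; simp only [Matrix.mul_assoc]
    _ = _ := by
        rw [specProj_dop_specProj, Matrix.mul_smul, ← Matrix.mul_assoc, ← Matrix.mul_assoc, ← h']
        simp only [Matrix.mul_assoc]

/-- Only blocks with a = νb survive in K, and there log a = log ν + log b. Thus commuting with log ω
produces a scalar. -/
theorem log_mul_of_modular {ω K : Matrix n n ℂ} {ν : ℝ} (hν : 0 < ν) (hω : ω.PosDef)
    (h : ω * K = (ν : ℂ) • (K * ω)) :
    cfc Real.log ω * K = K * cfc Real.log ω + (Real.log ν : ℂ) • K := by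
  refine eq_of_specProj_mul_mul_specProj hω.1 hω.1 fun a ha b hb => ?_
  rw [Matrix.mul_add, Matrix.add_mul, Matrix.mul_smul, Matrix.smul_mul,
    ← Matrix.mul_assoc, specProj_mul_cfc, ← Matrix.mul_assoc,
    Matrix.mul_assoc _ (cfc Real.log ω), cfc_mul_specProj, Matrix.smul_mul, Matrix.smul_mul,
    Matrix.mul_smul]
  by_cases hab : a = ν * b
  · rw [← add_smul, hab, Real.log_mul hν.ne' (eigs_pos hω hb).ne']
    push_cast
    rw [add_comm]
  · rw [specProj_mul_mul_specProj_eq_zero hω.1 h hab]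
    simp

end Intertwining

/-! ### The entropy production of a single channel. -/

section EntropyProduction

variable {n : Type*} [Fintype n] [DecidableEq n] {N : StarSubalgebra ℂ (Matrix n n ℂ)}

/-- `K` is a family of Kraus operators of `Φ` consisting of eigenvectors of `X ↦ ω X ω⁻¹` with
eigenvalues `ν`. -/
structure IsModularKraus {J : Type*} [Fintype J] (ω : Matrix n n ℂ) (Φ : N →ₗ[ℂ] N)
    (K : J → Matrix n n ℂ) (ν : J → ℝ) : Prop where
  kraus : IsKraus Φ K
  pos : ∀ j, 0 < ν j
  modular : ∀ j, ω * K j = (ν j : ℂ) • (K j * ω)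

variable {J : Type*} [Fintype J] {ω : Matrix n n ℂ} {Φ : N →ₗ[ℂ] N} {K : J → Matrix n n ℂ}
  {ν : J → ℝ}

theorem IsKraus.sum_trace (hK : IsKraus Φ K) (Y : Matrix n n ℂ) (X : N) :
    ∑ j, (Y * ((K j)ᴴ * X * K j)).trace = (Y * Φ X : Matrix n n ℂ).trace := by
  rw [hK X, Finset.mul_sum, Matrix.trace_sum]

theorem cfc_inv_mul {ω : Matrix n n ℂ} (hω : ω.PosDef) : ω * cfc (fun x : ℝ => x⁻¹) ω = 1 := by
  have h1 := dop_left (fun a => a) ω hω.1 (cfc (fun x : ℝ => x⁻¹) ω)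
  rw [cfc_id' ℝ ω hω.1.isSelfAdjoint, ← Matrix.mul_one (cfc (fun x : ℝ => x⁻¹) ω),
    ← dop_left (fun a => a⁻¹) ω hω.1, dop_dop, dop_congr (G := fun _ _ => 1),
    dop_one hω.1 hω.1] at h1
  · rw [dop_left (fun a => a⁻¹) ω hω.1, Matrix.mul_one] at h1
    exact h1.symm
  · intro a ha b _
    exact mul_inv_cancel₀ (eigs_pos hω ha).ne'

/-- By GNS symmetry the operators K_j† with weights ν_j⁻¹ also represent Φ when tested against the
algebra. Writing Y = ωZ lets Φ be moved to Z, and the modular relation turns K† past ω into the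
weight. -/
theorem IsModularKraus.sum_trace (h : IsModularKraus ω Φ K ν) (hω : ω.PosDef) (hωN : ω ∈ N)
    (hg : GNSSymm ω Φ) (Y X : N) :
    ∑ j, (((ν j)⁻¹ : ℝ) : ℂ) * (Y * (K j * X * (K j)ᴴ) : Matrix n n ℂ).trace
      = (Y * Φ X : Matrix n n ℂ).trace := by
  set Z : N := ⟨cfc (fun x : ℝ => x⁻¹) ω, cfc_mem hωN _⟩ * Y with hZ
  have hωZ : ω * (Z : Matrix n n ℂ) = Y := by
    rw [hZ]
    change ω * (cfc (fun x : ℝ => x⁻¹) ω * (Y : Matrix n n ℂ)) = Y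
    rw [← Matrix.mul_assoc, cfc_inv_mul hω, Matrix.one_mul]
  have h1 := hg.trace_mul h.kraus.map_star Z X
  rw [hωZ] at h1
  rw [h1, h.kraus Z, Finset.mul_sum, Finset.sum_mul, Matrix.trace_sum]
  refine Finset.sum_congr rfl fun j _ => ?_
  have h2 := conjTranspose_modular (h.pos j) hω.1 (h.modular j)
  calc (((ν j)⁻¹ : ℝ) : ℂ) * (Y * (K j * X * (K j)ᴴ) : Matrix n n ℂ).trace
      = (((ν j)⁻¹ : ℝ) : ℂ) * (((K j)ᴴ * ω) * (Z * K j * X) : Matrix n n ℂ).trace := by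
        rw [← hωZ, Matrix.mul_assoc ((K j)ᴴ), Matrix.trace_mul_comm ((K j)ᴴ)]
        simp only [Matrix.mul_assoc]
    _ = (ω * (K j)ᴴ * (Z * K j * X) : Matrix n n ℂ).trace := by
        rw [h2, Matrix.smul_mul, Matrix.trace_smul, smul_eq_mul]
    _ = _ := by simp only [Matrix.mul_assoc]

theorem logMean_comm (x y : ℝ) : logMean x y = logMean y x := by
  have := intervalIntegral.integral_comp_sub_left (a := 0) (b := 1)
    (fun s : ℝ => x ^ (1 - s) * y ^ s) 1
  simp only [sub_sub_cancel, sub_self, sub_zero] at this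
  rw [logMean, ← this, logMean]
  congr 1
  funext s
  ring

/-- `J_ω(Y) = ∫₀¹ ω^{1-s} Y ω^s ds`. -/
def bkm (ω : Matrix n n ℂ) : Matrix n n ℂ →ₗ[ℂ] Matrix n n ℂ := dop logMean ω ω

theorem bkm_conjTranspose (ω Y : Matrix n n ℂ) : (bkm ω Y)ᴴ = bkm ω Yᴴ := by
  rw [bkm, dop_conjTranspose]
  exact dop_congr (fun a _ b _ => logMean_comm _ _) _

theorem trace_bkm_mul (ω X Y : Matrix n n ℂ) : (bkm ω X * Y).trace = (X * bkm ω Y).trace := by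
  have h1 := trace_dop_mul logMean ω ω Xᴴ Y
  have h2 := bkm_conjTranspose ω Xᴴ
  rw [bkm] at h2 ⊢
  rw [h2] at h1
  simpa using h1.symm

theorem bkm_mem {Y : Matrix n n ℂ} (hωN : ω ∈ N) (hY : Y ∈ N) : bkm ω Y ∈ N :=
  dop_mem hωN hωN hY _

/-- GNS symmetry upgrades to BKM symmetry: homogeneity of the logarithmic mean gives K J(Y) K† = ν⁻¹
J(K Y K†), and the two Kraus representations of Φ are exchanged. -/
theorem IsModularKraus.trace_bkm_mul_map (h : IsModularKraus ω Φ K ν) (hω : ω.PosDef)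
    (hωN : ω ∈ N) (hg : GNSSymm ω Φ) (Y Z : N) :
    (bkm ω Y * Φ Z).trace = (bkm ω (Φ Y) * Z).trace := by
  have key : ∀ j, K j * bkm ω Y * (K j)ᴴ
      = (((ν j)⁻¹ : ℝ) : ℂ) • bkm ω (K j * Y * (K j)ᴴ) := by
    intro j
    have hν := h.pos j
    rw [bkm, mul_dop_of_modular hν hω.1 (h.modular j),
      dop_mul_of_modular (inv_pos.2 hν) hω.1 (conjTranspose_modular hν hω.1 (h.modular j)),
      ← dop_const_mul]
    apply dop_congr
    intro a ha b hb
    have hb' := eigs_pos hω hb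
    rw [logMean_mul_left (eigs_pos hω ha) (mul_pos (inv_pos.2 hν) hb') (inv_pos.2 hν)]
    simp [hν.ne']
  rw [← h.kraus.sum_trace]
  have e1 : ∀ j, (bkm ω Y * ((K j)ᴴ * Z * K j)).trace
      = (((ν j)⁻¹ : ℝ) : ℂ) * (bkm ω Z * (K j * Y * (K j)ᴴ) : Matrix n n ℂ).trace := by
    intro j
    rw [trace_bkm_mul ω Z, ← smul_eq_mul (_ : ℂ) (Matrix.trace _), ← Matrix.trace_smul,
      ← Matrix.mul_smul, ← key,
      Matrix.trace_mul_comm (Z : Matrix n n ℂ), Matrix.trace_mul_comm (bkm ω Y)]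
    rw [Matrix.mul_assoc _ (K j), Matrix.trace_mul_comm ((K j)ᴴ * (Z : Matrix n n ℂ)),
      ← Matrix.mul_assoc]
  simp only [e1]
  rw [h.sum_trace hω hωN hg ⟨bkm ω Z, bkm_mem hωN Z.2⟩ Y, trace_bkm_mul ω (Φ Y),
    Matrix.trace_mul_comm]

/-- The entropy production of one step of the channel dominates its BKM Dirichlet form. -/
theorem IsModularKraus.dirichlet_le (h : IsModularKraus ω Φ K ν) (hω : ω.PosDef) (hωN : ω ∈ N)
    (hg : GNSSymm ω Φ) (h1 : Φ 1 = 1) {ρ X G : N} (hρ : (ρ : Matrix n n ℂ).PosDef)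
    (hρX : (ρ : Matrix n n ℂ) = bkm ω X) {c : ℝ} (hc : 0 < c)
    (hle : ((c : ℂ) • ω - ρ).PosSemidef)
    (hG : (G : Matrix n n ℂ) = cfc Real.log (ρ : Matrix n n ℂ) - cfc Real.log ω) :
    (ρ * X - ρ * Φ X : Matrix n n ℂ).trace.re
      ≤ c * (ρ * G - ρ * Φ G : Matrix n n ℂ).trace.re := by
  set lρ : N := ⟨cfc Real.log (ρ : Matrix n n ℂ), cfc_mem ρ.2 _⟩ with hlρ
  set lω : N := ⟨cfc Real.log ω, cfc_mem hωN _⟩ with hlω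
  have hG' : G = lρ - lω := Subtype.ext hG
  have hcomm : (lρ : Matrix n n ℂ) * ρ = ρ * lρ := by
    have := cfc_commute_cfc Real.log id (ρ : Matrix n n ℂ)
    rw [cfc_id ℝ _ hρ.1.isSelfAdjoint] at this
    exact this
  -- The same Y_j serves both forms. Applying the reciprocal logarithmic mean to it gives the
  -- commutator [G, K_j] at ρ and [X, K_j] at ω. Pairing back with Y_j and summing gives 2 tr ρ(Z -
  -- ΦZ) for Z = G and Z = X.
  set Y : J → Matrix n n ℂ := fun j => (((ν j)⁻¹ : ℝ) : ℂ) • (ρ * K j) - K j * ρ with hY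
  have hYH : ∀ j, (Y j)ᴴ = (((ν j)⁻¹ : ℝ) : ℂ) • ((K j)ᴴ * ρ) - ρ * (K j)ᴴ := by
    intro j
    simp only [hY, Matrix.conjTranspose_sub, Matrix.conjTranspose_smul, Matrix.conjTranspose_mul,
      hρ.1.eq, Complex.star_def, Complex.conj_ofReal]
  have A := h.sum_trace hω hωN hg
  have B := fun Y : N => h.kraus.sum_trace (Y : Matrix n n ℂ)
  -- the logarithmic form at `ρ`
  have s1 : ∑ j, logForm (ν j)⁻¹ (ρ : Matrix n n ℂ) ρ (Y j)
      = 2 * (ρ * G - ρ * Φ G : Matrix n n ℂ).trace.re := by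
    have e : ∀ j, ((Y j)ᴴ * dop (fun a b => invLogMean ((ν j)⁻¹ * a) b) ρ ρ (Y j)).trace
        = (((ν j)⁻¹ : ℝ) : ℂ) * ((ρ * lρ : N) * (K j * (1 : N) * (K j)ᴴ) : Matrix n n ℂ).trace
          + ((((ν j)⁻¹ : ℝ) : ℂ) * (ρ * (K j * lω * (K j)ᴴ) : Matrix n n ℂ).trace
            - (((ν j)⁻¹ : ℝ) : ℂ) * ((ρ * lω : N) * (K j * (1 : N) * (K j)ᴴ) : Matrix n n ℂ).trace)
          - (((ν j)⁻¹ : ℝ) : ℂ) * (ρ * (K j * lρ * (K j)ᴴ) : Matrix n n ℂ).trace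
          - (ρ * ((K j)ᴴ * lρ * K j) : Matrix n n ℂ).trace
          - (((lω * ρ : N) : Matrix n n ℂ) * ((K j)ᴴ * (1 : N) * K j)).trace
          + (ρ * ((K j)ᴴ * lω * K j) : Matrix n n ℂ).trace
          + (((lρ * ρ : N) : Matrix n n ℂ) * ((K j)ᴴ * (1 : N) * K j)).trace := by
      intro j
      have hν := inv_pos.2 (h.pos j)
      have hY1 : Y j = dop (fun a b => (ν j)⁻¹ * a - b) ρ ρ (K j) := by
        rw [dop_sub_fun (fun a _ => (ν j)⁻¹ * a), dop_const_mul _ (fun a _ => a),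
          dop_left (fun a => a) _ hρ.1, dop_right (fun a => a) hρ.1,
          cfc_id' ℝ _ hρ.1.isSelfAdjoint]
      have hY2 : dop (fun a b => invLogMean ((ν j)⁻¹ * a) b) ρ ρ (Y j)
          = lρ * K j - K j * lρ + (Real.log (ν j)⁻¹ : ℂ) • K j := by
        rw [hY1, dop_dop, dop_congr (G := fun a b =>
          (Real.log a - Real.log b) + Real.log (ν j)⁻¹ * 1), dop_add_fun, dop_sub_fun,
          dop_left _ _ hρ.1, dop_right _ hρ.1, dop_const_mul _ (fun _ _ => 1), dop_one hρ.1 hρ.1]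
        intro a ha b hb
        rw [mul_comm, sub_mul_invLogMean (mul_pos hν (eigs_pos hρ ha)) (eigs_pos hρ hb),
          Real.log_mul hν.ne' (eigs_pos hρ ha).ne']
        ring
      -- The scalar left by the modular factor is a commutator with log ω, which turns [log ρ, K]
      -- into [G, K].
      have hlog : (Real.log (ν j)⁻¹ : ℂ) • K j = K j * lω - lω * K j := by
        have := log_mul_of_modular (h.pos j) hω (h.modular j)
        rw [hlω]
        simp only
        rw [this, Real.log_inv]
        push_cast
        module
      rw [hY2, hlog, hYH]
      have c1 : ∀ M : Matrix n n ℂ, ((K j)ᴴ * M).trace = (M * (K j)ᴴ).trace :=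
        fun M => Matrix.trace_mul_comm _ _
      simp only [Matrix.sub_mul, Matrix.mul_sub, Matrix.mul_add, Matrix.smul_mul,
        Matrix.trace_add, Matrix.trace_sub, Matrix.trace_smul, smul_eq_mul,
        MulMemClass.coe_mul, OneMemClass.coe_one, Matrix.mul_one]
      simp only [Matrix.mul_assoc, c1]
      have c2 : ∀ M : Matrix n n ℂ, (ρ * ((K j)ᴴ * (K j * M)) : Matrix n n ℂ).trace
          = (M * (ρ * ((K j)ᴴ * K j)) : Matrix n n ℂ).trace := by
        intro M
        rw [Matrix.trace_mul_comm M]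
        simp only [Matrix.mul_assoc]
      rw [c2, c2]
      ring
    have e' : ((∑ j, logForm (ν j)⁻¹ (ρ : Matrix n n ℂ) ρ (Y j) : ℝ))
        = (∑ j, ((Y j)ᴴ * dop (fun a b => invLogMean ((ν j)⁻¹ * a) b) ρ ρ (Y j)).trace).re := by
      rw [Complex.re_sum]; rfl
    rw [e']
    simp only [e, Finset.sum_add_distrib, Finset.sum_sub_distrib, A, B, h1, hG', map_sub]
    simp only [MulMemClass.coe_mul, OneMemClass.coe_one, Matrix.mul_one, AddSubgroupClass.coe_sub,
      Matrix.mul_sub, Matrix.trace_sub, Complex.sub_re, Complex.add_re, hcomm]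
    rw [Matrix.trace_mul_comm (lω : Matrix n n ℂ)]
    ring
  -- the logarithmic form at `ω`
  have s2 : ∑ j, logForm (ν j)⁻¹ ω ω (Y j) = 2 * (ρ * X - ρ * Φ X : Matrix n n ℂ).trace.re := by
    have e : ∀ j, ((Y j)ᴴ * dop (fun a b => invLogMean ((ν j)⁻¹ * a) b) ω ω (Y j)).trace
        = (((ν j)⁻¹ : ℝ) : ℂ) * ((ρ * X : N) * (K j * (1 : N) * (K j)ᴴ) : Matrix n n ℂ).trace
          - (((ν j)⁻¹ : ℝ) : ℂ) * (ρ * (K j * X * (K j)ᴴ) : Matrix n n ℂ).trace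
          - (ρ * ((K j)ᴴ * X * K j) : Matrix n n ℂ).trace
          + (((X * ρ : N) : Matrix n n ℂ) * ((K j)ᴴ * (1 : N) * K j)).trace := by
      intro j
      have hν := h.pos j
      -- Since ρ = J_ω(X), both ν⁻¹ρK and Kρ are the logarithmic mean with symbol (ν⁻¹a, b), applied
      -- to XK and KX respectively.
      have hY1 : Y j = dop (fun a b => logMean ((ν j)⁻¹ * a) b) ω ω (X * K j - K j * X) := by
        rw [map_sub, ← mul_dop_of_modular hν hω.1 (h.modular j), hY]
        simp only
        rw [hρX, bkm, dop_mul_of_modular hν hω.1 (h.modular j), ← dop_const_mul]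
        congr 1
        apply dop_congr
        intro a ha b hb
        rw [logMean_mul_left (eigs_pos hω ha) (eigs_pos hω hb) (inv_pos.2 hν), inv_inv]
      have hY2 : dop (fun a b => invLogMean ((ν j)⁻¹ * a) b) ω ω (Y j) = X * K j - K j * X := by
        rw [hY1, dop_dop, dop_congr (G := fun _ _ => 1), dop_one hω.1 hω.1]
        intro a ha b hb
        rw [mul_comm, logMean_mul_invLogMean (mul_pos (inv_pos.2 hν) (eigs_pos hω ha))
          (eigs_pos hω hb)]
      rw [hY2, hYH]
      have c1 : ∀ M : Matrix n n ℂ, ((K j)ᴴ * M).trace = (M * (K j)ᴴ).trace :=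
        fun M => Matrix.trace_mul_comm _ _
      simp only [Matrix.sub_mul, Matrix.mul_sub, Matrix.smul_mul,
        Matrix.trace_sub, Matrix.trace_smul, smul_eq_mul,
        MulMemClass.coe_mul, OneMemClass.coe_one, Matrix.mul_one]
      simp only [Matrix.mul_assoc, c1]
      have c2 : ∀ M : Matrix n n ℂ, (ρ * ((K j)ᴴ * (K j * M)) : Matrix n n ℂ).trace
          = (M * (ρ * ((K j)ᴴ * K j)) : Matrix n n ℂ).trace := by
        intro M
        rw [Matrix.trace_mul_comm M]
        simp only [Matrix.mul_assoc]
      rw [c2]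
      ring
    have e' : ((∑ j, logForm (ν j)⁻¹ ω ω (Y j) : ℝ))
        = (∑ j, ((Y j)ᴴ * dop (fun a b => invLogMean ((ν j)⁻¹ * a) b) ω ω (Y j)).trace).re := by
      rw [Complex.re_sum]; rfl
    rw [e']
    simp only [e, Finset.sum_add_distrib, Finset.sum_sub_distrib, A, B, h1]
    simp only [MulMemClass.coe_mul, OneMemClass.coe_one, Matrix.mul_one,
      Matrix.trace_sub, Complex.sub_re, Complex.add_re]
    rw [Matrix.trace_mul_comm (X : Matrix n n ℂ)]
    ring
  -- Here ρ ≤ cω is used in both arguments of the antitone form.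
  have s3 : ∑ j, logForm (ν j)⁻¹ ω ω (Y j)
      ≤ c * ∑ j, logForm (ν j)⁻¹ (ρ : Matrix n n ℂ) ρ (Y j) := by
    rw [Finset.mul_sum]
    exact Finset.sum_le_sum fun j _ => logForm_le (inv_pos.2 (h.pos j)) hρ hρ hω hω hc hle hle _
  rw [s1, s2] at s3
  linarith

end EntropyProduction

/-! ### Self-duality of the positive cone and Choi's theorem on a subalgebra. -/

section Positivity

variable {n : Type*} [Fintype n] [DecidableEq n] {N : StarSubalgebra ℂ (Matrix n n ℂ)}

theorem posSemidef_cfc {A : Matrix n n ℂ} {f : ℝ → ℝ} (hf : ∀ x, 0 ≤ f x) :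
    (cfc f A).PosSemidef := by
  have h : cfc f A = (cfc (fun x => √(f x)) A)ᴴ * cfc (fun x => √(f x)) A := by
    rw [cfc_conjTranspose, ← cfc_mul _ _ A (continuousOn_spectrum _ _) (continuousOn_spectrum _ _)]
    congr 1
    funext x
    exact (Real.mul_self_sqrt (hf x)).symm
  rw [h]
  exact Matrix.posSemidef_conjTranspose_mul_self _

/-- The positive cone of a star subalgebra is self-dual for the trace. -/
theorem posSemidef_of_trace_mul_nonneg {W : Matrix n n ℂ} (hW : W.IsHermitian) (hWN : W ∈ N)
    (h : ∀ Z ∈ N, Z.PosSemidef → 0 ≤ (W * Z).trace.re) : W.PosSemidef := by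
  -- Testing against the negative part f(W), which lies in N, gives -tr f(W)² ≥ 0, hence f(W) = 0.
  set f : ℝ → ℝ := fun x => max (-x) 0 with hf
  have hZ := h _ (cfc_mem hWN f) (posSemidef_cfc fun x => le_max_right _ _)
  have e : W * cfc f W = -((cfc f W)ᴴ * cfc f W) := by
    have h1 : W * cfc f W = cfc (fun x => x * f x) W := by
      rw [cfc_mul _ _ W (continuousOn_spectrum _ _) (continuousOn_spectrum _ _),
        cfc_id' ℝ W hW.isSelfAdjoint]
    rw [h1, cfc_conjTranspose,
      ← cfc_mul _ _ W (continuousOn_spectrum _ _) (continuousOn_spectrum _ _), ← cfc_neg]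
    congr 1
    funext x
    rcases le_total 0 x with hx | hx
    · simp [hf, hx]
    · simp [hf, hx]
  rw [e, Matrix.trace_neg, Complex.neg_re] at hZ
  have h2 := (Matrix.posSemidef_conjTranspose_mul_self (cfc f W)).trace_nonneg
  have h3 := trace_conjTranspose_mul_self_re_nonneg (cfc f W)
  have h4 : cfc f W = 0 := Matrix.trace_conjTranspose_mul_self_eq_zero_iff.1
    (Complex.ext (by simpa using le_antisymm (by linarith) h3) (Complex.le_def.1 h2).2.symm)
  have h5 : cfc f W = cfc (fun _ => (0 : ℝ)) W := by rw [h4, cfc_const_zero]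
  rw [hW.posSemidef_iff_eigenvalues_nonneg]
  intro i
  have h6 := eqOn_of_cfc_eq_cfc (R := ℝ) (p := IsSelfAdjoint) h5
    (continuousOn_spectrum _ _) (continuousOn_spectrum _ _) hW.isSelfAdjoint
    (x := hW.eigenvalues i) (by rw [hW.spectrum_real_eq_range_eigenvalues]; exact ⟨i, rfl⟩)
  have h7 := le_max_left (-hW.eigenvalues i) 0
  simp only [hf] at h6
  simp only [Pi.zero_apply]
  linarith

theorem exists_eq_conjTranspose_mul_self {A : Matrix n n ℂ} (hA : A.PosSemidef) :
    ∃ B : Matrix n n ℂ, A = Bᴴ * B ∧ ∀ N : StarSubalgebra ℂ (Matrix n n ℂ), A ∈ N → B ∈ N := by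
  refine ⟨cfc (fun x => √x) A, ?_, fun N hN => cfc_mem hN _⟩
  rw [cfc_conjTranspose, ← cfc_mul _ _ A (continuousOn_spectrum _ _) (continuousOn_spectrum _ _)]
  conv_lhs => rw [← cfc_id' ℝ A hA.1.isSelfAdjoint]
  apply cfc_congr
  intro x hx
  exact (Real.mul_self_sqrt (eigs_nonneg hA (mem_eigs.2 hx))).symm

/-- The orthogonal projection onto a star subalgebra for the trace form. -/
def traceProj (N : StarSubalgebra ℂ (Matrix n n ℂ)) : Matrix n n ℂ →ₗ[ℂ] N :=
  ((traceForm N).toDual (traceForm_nondegenerate N)).symm.toLinearMap ∘ₗ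
    LinearMap.mk₂ ℂ (fun (X : Matrix n n ℂ) (Y : N) => (X * Y).trace)
      (by intros; simp [add_mul]) (by intros; simp)
      (by intros; simp [mul_add]) (by intros; simp)

theorem trace_traceProj_mul (X : Matrix n n ℂ) (Y : N) :
    (traceProj N X * Y : Matrix n n ℂ).trace = (X * Y : Matrix n n ℂ).trace :=
  LinearMap.BilinForm.apply_toDual_symm_apply (B := traceForm N)
    (hB := traceForm_nondegenerate N) _ Y

theorem traceProj_eq {X : Matrix n n ℂ} {W : N}
    (h : ∀ Z : N, (W * Z : Matrix n n ℂ).trace = (X * Z : Matrix n n ℂ).trace) :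
    traceProj N X = W :=
  Subtype.ext (eq_of_trace_mul_eq (traceProj N X).2 W.2 fun Z hZ =>
    (trace_traceProj_mul X ⟨Z, hZ⟩).trans (h ⟨Z, hZ⟩).symm)

theorem isHermitian_of_trace {X : Matrix n n ℂ} (hX : X.IsHermitian) {W : Matrix n n ℂ}
    (hW : W ∈ N) (h : ∀ Z ∈ N, (W * Z).trace = (X * Z).trace) : W.IsHermitian := by
  apply eq_of_trace_mul_eq (N := N) (star_mem hW) hW
  intro Z hZ
  have h1 : (Wᴴ * Z).trace = star (W * Zᴴ).trace := by
    rw [← Matrix.trace_conjTranspose, Matrix.conjTranspose_mul, Matrix.conjTranspose_conjTranspose,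
      Matrix.trace_mul_comm]
  change (Wᴴ * Z).trace = _
  have h2 := h _ (star_mem hZ)
  rw [Matrix.star_eq_conjTranspose] at h2
  rw [h1, h2, h _ hZ, ← Matrix.trace_conjTranspose, Matrix.conjTranspose_mul,
    Matrix.conjTranspose_conjTranspose, hX.eq, Matrix.trace_mul_comm]

theorem trace_mul_re_nonneg {X Z : Matrix n n ℂ} (hX : X.PosSemidef) (hZ : Z.PosSemidef) :
    0 ≤ (X * Z).trace.re := by
  obtain ⟨B, rfl, -⟩ := exists_eq_conjTranspose_mul_self hZ
  have h := (hX.mul_mul_conjTranspose_same B).trace_nonneg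
  rw [Matrix.mul_assoc, Matrix.trace_mul_comm, Matrix.mul_assoc] at h
  exact (Complex.le_def.1 h).1

theorem posSemidef_traceProj {X : Matrix n n ℂ} (hX : X.PosSemidef) :
    (traceProj N X : Matrix n n ℂ).PosSemidef := by
  apply posSemidef_of_trace_mul_nonneg (N := N)
    (isHermitian_of_trace hX.1 (traceProj N X).2 fun Z hZ => trace_traceProj_mul X ⟨Z, hZ⟩)
    (traceProj N X).2
  intro Z hZ hZp
  have := trace_traceProj_mul X (⟨Z, hZ⟩ : N)
  simp only at this
  rw [this]
  exact trace_mul_re_nonneg hX hZp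

theorem traceProj_coe (X : N) : traceProj N X = X := traceProj_eq fun _ => rfl

/-- The matrix over `H ⊗ ℂᵏ` whose only nonzero block is `Z`, at `(a, b)`. -/
def blockSingle {k : ℕ} (Z : Matrix n n ℂ) (a b : Fin k) : Matrix (n × Fin k) (n × Fin k) ℂ :=
  Matrix.of fun p q => if p.2 = a ∧ q.2 = b then Z p.1 q.1 else 0

theorem block_blockSingle {k : ℕ} (Z : Matrix n n ℂ) (a b c d : Fin k) :
    block (blockSingle Z a b) c d = if c = a ∧ d = b then Z else 0 := by
  ext i j
  simp only [block, blockSingle, Matrix.of_apply]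
  split_ifs <;> rfl

theorem blockSingle_mem {k : ℕ} {Z : Matrix n n ℂ} (hZ : Z ∈ N) (a b : Fin k) :
    blockSingle Z a b ∈ ampl N k := by
  intro c d
  rw [block_blockSingle]
  split_ifs
  · exact hZ
  · exact zero_mem N

theorem trace_mul_ampl {k : ℕ} (X Y : Matrix (n × Fin k) (n × Fin k) ℂ) :
    (X * Y).trace = ∑ a, ∑ b, (block X a b * block Y b a).trace := by
  simp only [Matrix.trace, Matrix.diag, Matrix.mul_apply, block, Matrix.of_apply,
    Fintype.sum_prod_type]
  rw [Finset.sum_comm]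
  refine Finset.sum_congr rfl fun a _ => ?_
  simp only [fun i : n => Finset.sum_comm (s := (Finset.univ : Finset n))
    (t := (Finset.univ : Finset (Fin k))) (f := fun j b => X (i, a) (j, b) * Y (j, b) (i, a))]
  rw [Finset.sum_comm]

theorem trace_mul_blockSingle {k : ℕ} (X : Matrix (n × Fin k) (n × Fin k) ℂ) (Z : Matrix n n ℂ)
    (a b : Fin k) : (X * blockSingle Z b a).trace = (block X a b * Z).trace := by
  rw [trace_mul_ampl, Finset.sum_eq_single a, Finset.sum_eq_single b]
  · simp [block_blockSingle]
  · intro c _ hc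
    simp [block_blockSingle, hc]
  · simp
  · intro c _ hc
    simp [block_blockSingle, hc]
  · simp

/-- The projection for the amplified algebra acts blockwise. As it preserves positivity at every
level, `traceProj` is completely positive, and Φ ∘ `traceProj` extends Φ to all matrices. -/
theorem block_traceProj {k : ℕ} (X : Matrix (n × Fin k) (n × Fin k) ℂ) (a b : Fin k) :
    traceProj N (block X a b) = ⟨block (traceProj (ampl N k) X).1 a b,
      (traceProj (ampl N k) X).2 a b⟩ := by
  apply traceProj_eq
  intro Z
  have := trace_traceProj_mul X (⟨blockSingle (Z : Matrix n n ℂ) b a, blockSingle_mem Z.2 b a⟩ :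
    ampl N k)
  simpa only [trace_mul_blockSingle] using this

/-- Every completely positive map has Kraus operators. -/
theorem IsCompletelyPositive.exists_kraus {Φ : N →ₗ[ℂ] N} (hΦ : IsCompletelyPositive Φ) :
    ∃ K : n × Fin (Fintype.card n) → Matrix n n ℂ, IsKraus Φ K := by
  set k := Fintype.card n
  set e : n ≃ Fin k := Fintype.equivFin n
  -- The unnormalised maximally entangled vector, whose rank-one projector has the matrix units as
  -- blocks.
  set v : n × Fin k → ℂ := fun p => if e p.1 = p.2 then 1 else 0 with hv
  have hΩ : (Matrix.vecMulVec v (star v)).PosSemidef := Matrix.posSemidef_vecMulVec_self_star v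
  have hblock : ∀ a b, block (Matrix.vecMulVec v (star v)) a b
      = Matrix.single (e.symm a) (e.symm b) 1 := by
    intro a b
    ext i j
    simp only [block, Matrix.of_apply, Matrix.vecMulVec_apply, hv, Pi.star_apply,
      Matrix.single_apply, e.symm_apply_eq, eq_comm (a := a), eq_comm (a := b)]
    by_cases h1 : e i = a <;> by_cases h2 : e j = b <;> simp [h1, h2]
  -- This is the Choi matrix of Φ ∘ `traceProj`. Factoring it as B†B, each row of B reshapes into a
  -- Kraus operator.
  have hC := hΦ k _ (posSemidef_traceProj (N := ampl N k) hΩ)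
  obtain ⟨B, hB, -⟩ := exists_eq_conjTranspose_mul_self hC
  have hB' : ∀ i j l m, (Φ (traceProj N (Matrix.single l m 1)) : Matrix n n ℂ) i j
      = ∑ r, star (B r (i, e l)) * B r (j, e m) := by
    intro i j l m
    have h1 := congrFun (congrFun hB (i, e l)) (j, e m)
    rw [Matrix.mul_apply] at h1
    simp only [Matrix.conjTranspose_apply] at h1
    rw [← h1]
    have h2 := block_traceProj (N := N) (Matrix.vecMulVec v (star v)) (e l) (e m)
    rw [hblock, e.symm_apply_apply, e.symm_apply_apply] at h2
    rw [h2]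
    rfl
  refine ⟨fun r => Matrix.of fun l j => B r (j, e l), fun X => ?_⟩
  have hX : Φ X = ∑ l, ∑ m, (X : Matrix n n ℂ) l m • Φ (traceProj N (Matrix.single l m 1)) := by
    conv_lhs => rw [← traceProj_coe X, Matrix.matrix_eq_sum_single (X : Matrix n n ℂ)]
    simp only [map_sum, ← map_smul, Matrix.smul_single, smul_eq_mul, mul_one]
  ext i j
  rw [hX, Matrix.sum_apply]
  have h3 : ((∑ l, ∑ m, (X : Matrix n n ℂ) l m • Φ (traceProj N (Matrix.single l m 1)) : N) :
      Matrix n n ℂ) i j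
      = ∑ l, ∑ m, (X : Matrix n n ℂ) l m * ∑ r, star (B r (i, e l)) * B r (j, e m) := by
    push_cast
    simp only [Matrix.sum_apply]
    refine Finset.sum_congr rfl fun l _ => Finset.sum_congr rfl fun m _ => ?_
    rw [← hB']
    rfl
  rw [h3]
  simp only [Matrix.mul_apply, Matrix.conjTranspose_apply, Matrix.of_apply, Finset.mul_sum,
    Finset.sum_mul]
  rw [Finset.sum_comm' (t' := Finset.univ) (s' := fun _ => Finset.univ) (by simp)]
  have h4 : ∀ m : n, ∑ l, ∑ r, (X : Matrix n n ℂ) l m * (star (B r (i, e l)) * B r (j, e m))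
      = ∑ r, ∑ l, (X : Matrix n n ℂ) l m * (star (B r (i, e l)) * B r (j, e m)) :=
    fun m => Finset.sum_comm
  simp only [h4]
  rw [Finset.sum_comm]
  refine Finset.sum_congr rfl fun r _ => Finset.sum_congr rfl fun m _ =>
    Finset.sum_congr rfl fun l _ => by ring

end Positivity

/-! ### The Kadison–Schwarz defect and fixed points. -/

section SchwarzInequality

variable {n : Type*} [Fintype n] [DecidableEq n] {N : StarSubalgebra ℂ (Matrix n n ℂ)}
  {J : Type*} [Fintype J] {Φ : N →ₗ[ℂ] N} {K : J → Matrix n n ℂ}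

/-- The defect in the Schwarz inequality is an explicit sum of squares. Its positivity gives
contractivity in the GNS norm, and its vanishing at a fixed point gives commutation with each Kraus
operator. -/
theorem IsKraus.sum_schwarz (hK : IsKraus Φ K) (h1 : Φ 1 = 1) (X : N) :
    ∑ j, (X * K j - K j * Φ X : Matrix n n ℂ)ᴴ * (X * K j - K j * Φ X)
      = (Φ (star X * X) - star (Φ X) * Φ X : N) := by
  have hs := hK.map_star X
  have e1 : ∑ j, (K j)ᴴ * ((K j)) = 1 := by
    have := hK 1
    rw [h1] at this
    simpa using this.symm
  have e2 := hK X
  have e3 := hK (star X)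
  have e4 := hK (star X * X)
  rw [hs] at e3
  have hst : ∀ Z : N, ((star Z : N) : Matrix n n ℂ) = (Z : Matrix n n ℂ)ᴴ := fun _ => rfl
  simp only [MulMemClass.coe_mul, hst] at e3 e4
  have expand : ∀ j, (X * K j - K j * Φ X : Matrix n n ℂ)ᴴ * (X * K j - K j * Φ X)
      = (K j)ᴴ * ((X : Matrix n n ℂ)ᴴ * X) * K j - ((K j)ᴴ * (X : Matrix n n ℂ)ᴴ * K j) * Φ X
        - (Φ X : Matrix n n ℂ)ᴴ * ((K j)ᴴ * X * K j)
        + (Φ X : Matrix n n ℂ)ᴴ * ((K j)ᴴ * K j) * Φ X := by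
    intro j
    simp only [Matrix.conjTranspose_sub, Matrix.conjTranspose_mul, Matrix.sub_mul, Matrix.mul_sub,
      Matrix.mul_assoc]
    abel
  simp only [expand, Finset.sum_add_distrib, Finset.sum_sub_distrib, ← Finset.sum_mul,
    ← Finset.mul_sum, ← e3, ← e4, ← e2, e1]
  simp only [AddSubgroupClass.coe_sub, MulMemClass.coe_mul, hst, Matrix.mul_one]
  abel

theorem eq_zero_of_trace_mul_eq_zero {σ Z : Matrix n n ℂ} (hσ : σ.PosDef)
    (h : (σ * (Zᴴ * Z)).trace.re = 0) : Z = 0 := by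
  have h1 : (σ * (Zᴴ * Z)).trace = (Z * σ * Zᴴ).trace := by
    rw [← Matrix.mul_assoc, Matrix.trace_mul_comm, ← Matrix.mul_assoc]
  rw [h1] at h
  have h2 := hσ.posSemidef.mul_mul_conjTranspose_same Z
  have h3 : (Z * σ * Zᴴ).trace = 0 := Complex.ext h (Complex.le_def.1 h2.trace_nonneg).2.symm
  have h4 := h2.trace_eq_zero_iff.1 h3
  have h5 : Zᴴ = 0 := by
    apply Matrix.ext_of_mulVec_single
    intro i
    by_contra hne
    rw [Matrix.zero_mulVec] at hne
    have h6 := hσ.dotProduct_mulVec_pos hne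
    have h7 : star (Zᴴ *ᵥ Pi.single i 1) ⬝ᵥ (σ *ᵥ (Zᴴ *ᵥ Pi.single i 1))
        = star (Pi.single i (1 : ℂ)) ⬝ᵥ ((Z * σ * Zᴴ) *ᵥ Pi.single i 1) := by
      rw [Matrix.star_mulVec, Matrix.conjTranspose_conjTranspose, ← Matrix.dotProduct_mulVec,
        Matrix.mulVec_mulVec, Matrix.mulVec_mulVec]
    rw [h7, h4] at h6
    simp at h6
  simpa using congrArg Matrix.conjTranspose h5

theorem trace_mul_conj_re_nonneg {σ : Matrix n n ℂ} (hσ : σ.PosSemidef) (Z : Matrix n n ℂ) :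
    0 ≤ (σ * (Zᴴ * Z)).trace.re :=
  trace_mul_re_nonneg hσ (Matrix.posSemidef_conjTranspose_mul_self Z)

/-- Fixed points of a unital completely positive map with a faithful invariant state commute with
its Kraus operators. -/
theorem IsKraus.commute_of_fixed (hK : IsKraus Φ K) (h1 : Φ 1 = 1) {σ : Matrix n n ℂ}
    (hσ : σ.PosDef)
    (hinv : ∀ X : N, (σ * Φ X : Matrix n n ℂ).trace = (σ * X : Matrix n n ℂ).trace)
    {X : N} (hX : Φ X = X) (j : J) : (X : Matrix n n ℂ) * K j = K j * X := by
  have h2 := hK.sum_schwarz h1 X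
  rw [hX] at h2
  have h3 : ∑ j, (σ * ((X * K j - K j * X : Matrix n n ℂ)ᴴ * (X * K j - K j * X))).trace.re = 0 := by
    rw [← Complex.re_sum, ← Matrix.trace_sum, ← Finset.mul_sum, h2, AddSubgroupClass.coe_sub,
      Matrix.mul_sub, Matrix.trace_sub, hinv, sub_self, Complex.zero_re]
  rw [Finset.sum_eq_zero_iff_of_nonneg fun j _ => trace_mul_conj_re_nonneg hσ.posSemidef _] at h3
  exact sub_eq_zero.1 (eq_zero_of_trace_mul_eq_zero hσ (h3 j (Finset.mem_univ j)))

theorem IsKraus.trace_schwarz (hK : IsKraus Φ K) (h1 : Φ 1 = 1) {σ : Matrix n n ℂ}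
    (hσ : σ.PosDef)
    (hinv : ∀ X : N, (σ * Φ X : Matrix n n ℂ).trace = (σ * X : Matrix n n ℂ).trace) (X : N) :
    (σ * (Φ X : Matrix n n ℂ)ᴴ * Φ X).trace.re ≤ (σ * (X : Matrix n n ℂ)ᴴ * X).trace.re := by
  have h2 := hK.sum_schwarz h1 X
  have h3 : 0 ≤ ∑ j, (σ * ((X * K j - K j * Φ X : Matrix n n ℂ)ᴴ * (X * K j - K j * Φ X))).trace.re :=
    Finset.sum_nonneg fun j _ => trace_mul_conj_re_nonneg hσ.posSemidef _
  rw [← Complex.re_sum, ← Matrix.trace_sum, ← Finset.mul_sum, h2, AddSubgroupClass.coe_sub,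
    Matrix.mul_sub, Matrix.trace_sub, hinv, Complex.sub_re] at h3
  rw [Matrix.mul_assoc, Matrix.mul_assoc]
  exact sub_nonneg.1 h3

end SchwarzInequality

/-! ### Spectral resolution of a symmetric contraction semigroup. -/

section SpectralResolution

/-- χ(t) = χ(t/2)² is nonnegative, and a zero at t would propagate to t/2^k → 0, against χ(0) = 1.
So log χ is continuous and additive, hence linear; χ ≤ 1 fixes the sign of the rate. -/
theorem exists_eq_exp_of_multiplicative {χ : ℝ≥0 → ℝ} (h0 : χ 0 = 1)
    (hadd : ∀ s t, χ (s + t) = χ s * χ t) (hc : Continuous χ) (h1 : ∀ t, χ t ≤ 1) :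
    ∃ l : ℝ, 0 ≤ l ∧ ∀ t : ℝ≥0, χ t = Real.exp (-l * t) := by
  have hnn : ∀ t, 0 ≤ χ t := fun t => by
    have := hadd (t / 2) (t / 2)
    rw [add_halves] at this
    rw [this]
    exact mul_self_nonneg _
  have hpos : ∀ t, 0 < χ t := by
    intro t
    refine (hnn t).lt_of_ne' fun hz => ?_
    have hpow : ∀ k : ℕ, χ (t / 2 ^ k) = 0 := by
      intro k
      induction k with
      | zero => simpa using hz
      | succ k ih =>
        have := hadd (t / 2 ^ (k + 1)) (t / 2 ^ (k + 1))
        rw [← mul_self_eq_zero, ← this, ← ih]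
        congr 1
        rw [pow_succ, ← div_div, add_halves]
    have hlim : Tendsto (fun k : ℕ => t / 2 ^ k) atTop (𝓝 0) := by
      rw [← NNReal.tendsto_coe]
      push_cast
      have := tendsto_pow_atTop_nhds_zero_of_lt_one (r := (1 / 2 : ℝ)) (by norm_num) (by norm_num)
      have := this.const_mul (t : ℝ)
      simp only [mul_zero] at this
      refine this.congr fun k => ?_
      rw [one_div, inv_pow, div_eq_mul_inv]
    have := (hc.tendsto 0).comp hlim
    simp only [Function.comp_def, hpow, h0] at this
    exact zero_ne_one (tendsto_nhds_unique tendsto_const_nhds this)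
  set a : ℝ≥0 → ℝ := fun t => Real.log (χ t) with ha
  have aadd : ∀ s t, a (s + t) = a s + a t := fun s t => by
    simp only [ha, hadd, Real.log_mul (hpos s).ne' (hpos t).ne']
  have acont : Continuous a := hc.log fun t => (hpos t).ne'
  -- The additive function on the half line is extended to ℝ through positive and negative parts.
  let f : ℝ →+ ℝ :=
    { toFun := fun x => a x.toNNReal - a (-x).toNNReal
      map_zero' := by simp
      map_add' := by
        intro x y
        have key : (x + y).toNNReal + ((-x).toNNReal + (-y).toNNReal)
            = (-(x + y)).toNNReal + (x.toNNReal + y.toNNReal) := by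
          apply NNReal.coe_injective
          push_cast [Real.coe_toNNReal']
          have hm : ∀ z : ℝ, max z 0 - max (-z) 0 = z := fun z => by
            rcases le_total 0 z with h | h
            · simp [h]
            · simp [h]
          linarith [hm x, hm y, hm (x + y)]
        have := congrArg a key
        simp only [aadd] at this
        linarith }
  have fcont : Continuous f :=
    (acont.comp continuous_real_toNNReal).sub
      (acont.comp (continuous_real_toNNReal.comp continuous_neg))
  have flin : ∀ x : ℝ, f x = x * f 1 := fun x => by
    have := map_real_smul f fcont x 1
    simpa using this
  have fa : ∀ t : ℝ≥0, f t = a t := fun t => by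
    change a (t : ℝ).toNNReal - a (-(t : ℝ)).toNNReal = a t
    have ha0 : a 0 = 0 := by simp [ha, h0]
    rw [Real.toNNReal_coe, Real.toNNReal_of_nonpos (neg_nonpos.2 t.coe_nonneg), ha0, sub_zero]
  refine ⟨-f 1, ?_, fun t => ?_⟩
  · have h3 := fa 1
    rw [NNReal.coe_one] at h3
    rw [h3, neg_nonneg]
    exact Real.log_nonpos (hnn 1) (h1 1)
  · rw [neg_neg, mul_comm, ← flin, fa, Real.exp_log (hpos t)]

/-- A spectral resolution `T_t = ∑_{l ∈ S} e^{-l t} Q_l` of a semigroup of operators. -/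
structure SpectralResolution {V : Type*} [AddCommGroup V] [Module ℂ V] (T : ℝ≥0 → V →ₗ[ℂ] V)
    (S : Finset ℝ) (Q : ℝ → V →ₗ[ℂ] V) : Prop where
  nonneg : ∀ l ∈ S, 0 ≤ l
  of_notMem : ∀ l ∉ S, Q l = 0
  sum : ∑ l ∈ S, Q l = LinearMap.id
  mul : ∀ l m, Q l ∘ₗ Q m = if l = m then Q l else 0
  apply : ∀ t : ℝ≥0, T t = ∑ l ∈ S, (Real.exp (-l * t) : ℂ) • Q l

open Module.End in
/-- A continuous semigroup of symmetric contractions has a spectral resolution. -/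
theorem exists_spectralResolution {V : Type*} [NormedAddCommGroup V] [InnerProductSpace ℂ V]
    [FiniteDimensional ℂ V] {T : ℝ≥0 → V →ₗ[ℂ] V} (h0 : T 0 = LinearMap.id)
    (hadd : ∀ s t, T (s + t) = T s ∘ₗ T t) (hsym : ∀ t, (T t).IsSymmetric)
    (hcont : ∀ x, Continuous fun t => inner ℂ x (T t x)) (hcontr : ∀ t x, ‖T t x‖ ≤ ‖x‖) :
    ∃ (S : Finset ℝ) (Q : ℝ → V →ₗ[ℂ] V), SpectralResolution T S Q := by
  classical
  have hcomm : Pairwise (Function.onFun Commute T) := by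
    intro s t _
    change T s * T t = T t * T s
    rw [Module.End.mul_eq_comp, Module.End.mul_eq_comp, ← hadd, ← hadd, add_comm]
  -- Commuting symmetric operators have a common eigenbasis. Each joint eigenvalue t ↦ χ(t) is a
  -- real continuous character bounded by 1, hence e^{-lt}; Q_l selects the basis vectors of rate l.
  have hint := LinearMap.IsSymmetric.directSum_isInternal_of_pairwise_commute hsym hcomm
  set b := hint.collectedBasis fun χ => Module.finBasis ℂ
    (⨅ t, eigenspace (T t) (χ t) : Submodule ℂ V) with hb
  have : Finite (Σ χ : ℝ≥0 → ℂ, Fin (Module.finrank ℂ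
    (⨅ t, eigenspace (T t) (χ t) : Submodule ℂ V))) := Module.Finite.finite_basis b
  have := Fintype.ofFinite (Σ χ : ℝ≥0 → ℂ, Fin (Module.finrank ℂ
    (⨅ t, eigenspace (T t) (χ t) : Submodule ℂ V)))
  have hexp : ∀ i, ∃ l : ℝ, 0 ≤ l ∧ ∀ t : ℝ≥0, T t (b i) = (Real.exp (-l * t) : ℂ) • b i := by
    intro i
    have hmem : b i ∈ (⨅ t, eigenspace (T t) (i.1 t) : Submodule ℂ V) :=
      hint.collectedBasis_mem _ i
    have heig : ∀ t, T t (b i) = i.1 t • b i := fun t =>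
      mem_eigenspace_iff.1 ((Submodule.mem_iInf _).1 hmem t)
    have hne : b i ≠ 0 := b.ne_zero i
    have hnorm : 0 < ‖b i‖ := norm_pos_iff.2 hne
    have hin : inner ℂ (b i) (b i) ≠ 0 := inner_self_ne_zero.2 hne
    have hconj : ∀ t, (starRingEnd ℂ) (i.1 t) = i.1 t := by
      intro t
      have := hsym t (b i) (b i)
      rw [heig, inner_smul_left, inner_smul_right] at this
      exact mul_right_cancel₀ hin this
    have hre : ∀ t, ((i.1 t).re : ℂ) = i.1 t := fun t => Complex.conj_eq_iff_re.1 (hconj t)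
    have hχ0 : i.1 0 = 1 := by
      have := heig 0
      rw [h0, LinearMap.id_apply] at this
      have h : (i.1 0 - 1) • b i = 0 := by rw [sub_smul, one_smul, ← this, sub_self]
      exact sub_eq_zero.1 ((smul_eq_zero.1 h).resolve_right hne)
    have hχadd : ∀ s t, i.1 (s + t) = i.1 s * i.1 t := by
      intro s t
      have := heig (s + t)
      rw [hadd, LinearMap.comp_apply, heig t, map_smul, heig s, smul_smul] at this
      have h : (i.1 t * i.1 s - i.1 (s + t)) • b i = 0 := by rw [sub_smul, this, sub_self]
      rw [mul_comm]
      exact (sub_eq_zero.1 ((smul_eq_zero.1 h).resolve_right hne)).symm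
    have hχcont : Continuous i.1 := by
      have := (hcont (b i)).div_const (inner ℂ (b i) (b i))
      simpa only [heig, inner_smul_right, mul_div_cancel_right₀ _ hin] using this
    obtain ⟨l, hl, hl2⟩ := exists_eq_exp_of_multiplicative (χ := fun t => (i.1 t).re)
      (by simp [hχ0])
      (fun s t => by
        rw [hχadd, ← hre s, ← hre t, ← Complex.ofReal_mul, Complex.ofReal_re, hre, hre])
      (Complex.continuous_re.comp hχcont)
      (fun t => by
        have := hcontr t (b i)
        rw [heig, norm_smul] at this
        have h2 : ‖i.1 t‖ ≤ 1 := by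
          by_contra hgt
          push Not at hgt
          have := mul_lt_mul_of_pos_right hgt hnorm
          linarith
        exact (Complex.re_le_norm _).trans h2)
    exact ⟨l, hl, fun t => by rw [heig, ← hre, ← hl2]⟩
  choose lam hlam hT using hexp
  refine ⟨Finset.univ.image lam, fun l => b.constr ℂ fun i => if lam i = l then b i else 0, ?_⟩
  constructor
  · intro l hl
    obtain ⟨i, -, rfl⟩ := Finset.mem_image.1 hl
    exact hlam i
  · intro l hl
    refine b.ext fun i => ?_
    rw [Module.Basis.constr_basis, if_neg]
    · rfl
    · rintro rfl
      exact hl (Finset.mem_image_of_mem _ (Finset.mem_univ i))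
  · refine b.ext fun i => ?_
    simp only [LinearMap.sum_apply, Module.Basis.constr_basis, LinearMap.id_apply]
    rw [Finset.sum_ite_eq, if_pos (Finset.mem_image_of_mem _ (Finset.mem_univ i))]
  · intro l m
    refine b.ext fun i => ?_
    rw [LinearMap.comp_apply, Module.Basis.constr_basis]
    by_cases hm : lam i = m
    · subst hm
      rw [if_pos rfl, Module.Basis.constr_basis]
      by_cases hl : lam i = l
      · rw [if_pos hl, if_pos hl.symm, Module.Basis.constr_basis, if_pos hl]
      · rw [if_neg hl, if_neg (Ne.symm hl), LinearMap.zero_apply]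
    · rw [if_neg hm, map_zero]
      by_cases hl : l = m
      · rw [if_pos hl, Module.Basis.constr_basis, hl, if_neg hm]
      · rw [if_neg hl, LinearMap.zero_apply]
  · intro t
    refine b.ext fun i => ?_
    simp only [LinearMap.sum_apply, LinearMap.smul_apply, Module.Basis.constr_basis, hT]
    rw [Finset.sum_eq_single (lam i)]
    · simp
    · intro l _ hl
      simp [Ne.symm hl]
    · intro h
      exact absurd (Finset.mem_image_of_mem _ (Finset.mem_univ i)) h

namespace SpectralResolution

variable {V : Type*} [AddCommGroup V] [Module ℂ V] {T : ℝ≥0 → V →ₗ[ℂ] V} {S : Finset ℝ}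
  {Q : ℝ → V →ₗ[ℂ] V}

theorem apply_apply (h : SpectralResolution T S Q) (t : ℝ≥0) (x : V) :
    T t x = ∑ l ∈ S, (Real.exp (-l * t) : ℂ) • Q l x := by
  rw [h.apply, LinearMap.sum_apply]
  rfl

theorem sum_apply (h : SpectralResolution T S Q) (x : V) : ∑ l ∈ S, Q l x = x := by
  rw [← LinearMap.sum_apply, h.sum, LinearMap.id_apply]

theorem mul_apply (h : SpectralResolution T S Q) (l m : ℝ) (x : V) :
    Q l (Q m x) = if l = m then Q l x else 0 := by
  rw [← LinearMap.comp_apply, h.mul]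
  split_ifs <;> rfl

theorem semigroup_proj (h : SpectralResolution T S Q) (t : ℝ≥0) (l : ℝ) (x : V) :
    T t (Q l x) = (Real.exp (-l * t) : ℂ) • Q l x := by
  rw [h.apply_apply]
  by_cases hl : l ∈ S
  · rw [Finset.sum_eq_single l]
    · rw [h.mul_apply, if_pos rfl]
    · intro m _ hm
      rw [h.mul_apply, if_neg hm, smul_zero]
    · exact fun h' => absurd hl h'
  · rw [h.of_notMem l hl]
    simp

theorem proj_semigroup (h : SpectralResolution T S Q) (t : ℝ≥0) (l : ℝ) (x : V) :
    Q l (T t x) = (Real.exp (-l * t) : ℂ) • Q l x := by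
  rw [h.apply_apply, map_sum]
  by_cases hl : l ∈ S
  · rw [Finset.sum_eq_single l]
    · rw [map_smul, h.mul_apply, if_pos rfl]
    · intro m _ hm
      rw [map_smul, h.mul_apply, if_neg (Ne.symm hm), smul_zero]
    · exact fun h' => absurd hl h'
  · rw [h.of_notMem l hl]
    simp

theorem fixed_iff (h : SpectralResolution T S Q) (x : V) : Q 0 x = x ↔ ∀ t, T t x = x := by
  constructor
  · intro hx t
    rw [← hx, h.semigroup_proj]
    simp
  · intro hx
    have h1 : ∀ l ∈ S, l ≠ 0 → Q l x = 0 := by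
      intro l hl hl0
      -- Time 1 already separates the rates, since e^{-l} ≠ 1 for l ≠ 0.
      have h2 := h.proj_semigroup 1 l x
      rw [hx 1] at h2
      have h3 : ((1 : ℂ) - Real.exp (-l * (1 : ℝ≥0))) • Q l x = 0 := by
        rw [sub_smul, one_smul, ← h2, sub_self]
      refine (smul_eq_zero.1 h3).resolve_left fun h4 => ?_
      have h5 : Real.exp (-l * (1 : ℝ≥0)) = 1 := by exact_mod_cast (sub_eq_zero.1 h4).symm
      rw [Real.exp_eq_one_iff] at h5
      simp at h5
      exact hl0 h5
    conv_rhs => rw [← h.sum_apply x]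
    by_cases h0 : (0 : ℝ) ∈ S
    · rw [Finset.sum_eq_single 0 (fun l hl hl0 => h1 l hl hl0) (fun h' => absurd h0 h')]
    · rw [h.of_notMem 0 h0, Finset.sum_eq_zero]
      · rfl
      · intro l hl
        exact h1 l hl (by rintro rfl; exact h0 hl)

/-- The limit projection of the semigroup. -/
theorem tendsto [TopologicalSpace V] [ContinuousAdd V] [ContinuousSMul ℂ V]
    (h : SpectralResolution T S Q) (x : V) : Tendsto (fun t => T t x) atTop (𝓝 (Q 0 x)) := by
  have h1 : ∀ l ∈ S, Tendsto (fun t : ℝ≥0 => (Real.exp (-l * t) : ℂ) • Q l x) atTop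
      (𝓝 (if l = 0 then Q l x else 0)) := by
    intro l hl
    by_cases hl0 : l = 0
    · simpa [hl0] using tendsto_const_nhds
    · rw [if_neg hl0, ← zero_smul ℂ (Q l x)]
      refine Tendsto.smul_const ?_ _
      rw [← Complex.ofReal_zero]
      refine (Complex.continuous_ofReal.tendsto 0).comp (Real.tendsto_exp_atBot.comp ?_)
      have hlpos := lt_of_le_of_ne (h.nonneg l hl) (Ne.symm hl0)
      exact (NNReal.tendsto_coe_atTop.2 tendsto_id).const_mul_atTop_of_neg (neg_lt_zero.2 hlpos)
  have h2 := tendsto_finsetSum S h1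
  simp only [← h.apply_apply] at h2
  convert h2 using 2
  by_cases h0 : (0 : ℝ) ∈ S
  · rw [Finset.sum_ite_eq', if_pos h0]
  · rw [Finset.sum_ite_eq', if_neg h0, h.of_notMem 0 h0]
    rfl

/-- The generator of the semigroup. -/
theorem tendsto_generator [TopologicalSpace V] [ContinuousAdd V] [ContinuousSMul ℂ V]
    (h : SpectralResolution T S Q) (x : V) :
    Tendsto (fun t : ℝ≥0 => ((t : ℝ) : ℂ)⁻¹ • (T t x - x)) (𝓝[>] 0)
      (𝓝 ((∑ l ∈ S, ((-l : ℝ) : ℂ) • Q l) x)) := by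
  have h1 : ∀ l ∈ S, Tendsto (fun t : ℝ≥0 =>
      (((t : ℝ)⁻¹ * (Real.exp (-l * t) - 1) : ℝ) : ℂ) • Q l x) (𝓝[>] 0)
      (𝓝 (((-l : ℝ) : ℂ) • Q l x)) := by
    intro l _
    refine Tendsto.smul_const ?_ _
    refine (Complex.continuous_ofReal.tendsto _).comp ?_
    have hd : HasDerivAt (fun t : ℝ => Real.exp (-l * t)) (-l) 0 := by
      have := ((hasDerivAt_id (0 : ℝ)).const_mul (-l)).exp
      simpa using this
    have hs := hd.tendsto_slope_zero_right
    simp only [zero_add, mul_zero, Real.exp_zero, smul_eq_mul] at hs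
    refine hs.comp ?_
    refine tendsto_nhdsWithin_iff.2 ⟨?_, ?_⟩
    · exact (NNReal.continuous_coe.tendsto 0).mono_left nhdsWithin_le_nhds
    · filter_upwards [self_mem_nhdsWithin] with t ht
      exact NNReal.coe_pos.2 ht
  have h2 := tendsto_finsetSum S h1
  rw [LinearMap.sum_apply]
  simp only [LinearMap.smul_apply]
  refine h2.congr fun t => ?_
  have e : T t x - x = ∑ l ∈ S, ((Real.exp (-l * t) : ℂ) • Q l x - Q l x) := by
    rw [Finset.sum_sub_distrib, h.sum_apply, ← h.apply_apply]
  rw [e, Finset.smul_sum]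
  refine Finset.sum_congr rfl fun l _ => ?_
  push_cast
  rw [mul_smul, sub_smul, one_smul]

end SpectralResolution

end SpectralResolution

/-! ### Order estimates for Hermitian matrices. -/

section Order

variable {n : Type*} [Fintype n] [DecidableEq n] {N : StarSubalgebra ℂ (Matrix n n ℂ)}

theorem posSemidef_cfc_of_eigs {A : Matrix n n ℂ} {f : ℝ → ℝ} (hf : ∀ x ∈ eigs A, 0 ≤ f x) :
    (cfc f A).PosSemidef := by
  have : cfc f A = cfc (fun x => |f x|) A :=
    cfc_congr fun x hx => (abs_of_nonneg (hf x (mem_eigs.2 hx))).symm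
  rw [this]
  exact posSemidef_cfc fun x => abs_nonneg _

theorem exists_smul_one_le {A : Matrix n n ℂ} (hA : A.PosDef) :
    ∃ δ : ℝ, 0 < δ ∧ (A - (δ : ℂ) • (1 : Matrix n n ℂ)).PosSemidef := by
  obtain ⟨δ, hδ, h⟩ : ∃ δ : ℝ, 0 < δ ∧ ∀ x ∈ eigs A, δ ≤ x := by
    rcases (eigs A).eq_empty_or_nonempty with h | h
    · exact ⟨1, one_pos, by simp [h]⟩
    · exact ⟨(eigs A).min' h, eigs_pos hA (Finset.min'_mem _ _), fun x hx => Finset.min'_le _ _ hx⟩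
  refine ⟨δ, hδ, ?_⟩
  have e : A - (δ : ℂ) • (1 : Matrix n n ℂ) = cfc (fun x : ℝ => x - δ) A := by
    rw [cfc_sub _ _ A (continuousOn_spectrum _ _) (continuousOn_spectrum _ _),
      cfc_id' ℝ A hA.1.isSelfAdjoint, cfc_const δ A hA.1.isSelfAdjoint]
    congr 1
    ext i j
    simp [Matrix.algebraMap_matrix_apply, Matrix.one_apply]
  rw [e]
  exact posSemidef_cfc_of_eigs fun x hx => sub_nonneg.2 (h x hx)

theorem exists_le_smul_one {A : Matrix n n ℂ} (hA : A.IsHermitian) :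
    ∃ C : ℝ, 0 < C ∧ ((C : ℂ) • (1 : Matrix n n ℂ) - A).PosSemidef := by
  obtain ⟨C, hC, h⟩ : ∃ C : ℝ, 0 < C ∧ ∀ x ∈ eigs A, x ≤ C := by
    rcases (eigs A).eq_empty_or_nonempty with h | h
    · exact ⟨1, one_pos, by simp [h]⟩
    · exact ⟨max 1 ((eigs A).max' h), lt_max_of_lt_left one_pos,
        fun x hx => (Finset.le_max' _ _ hx).trans (le_max_right _ _)⟩
  refine ⟨C, hC, ?_⟩
  have e : (C : ℂ) • (1 : Matrix n n ℂ) - A = cfc (fun x : ℝ => C - x) A := by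
    rw [cfc_sub _ _ A (continuousOn_spectrum _ _) (continuousOn_spectrum _ _),
      cfc_id' ℝ A hA.isSelfAdjoint, cfc_const C A hA.isSelfAdjoint]
    congr 1
    ext i j
    simp [Matrix.algebraMap_matrix_apply, Matrix.one_apply]
  rw [e]
  exact posSemidef_cfc_of_eigs fun x hx => sub_nonneg.2 (h x hx)

theorem PosSemidef.smul_real {A : Matrix n n ℂ} (hA : A.PosSemidef) {c : ℝ} (hc : 0 ≤ c) :
    ((c : ℂ) • A).PosSemidef := hA.smul (Complex.zero_le_real.2 hc)

theorem PosDef.smul_real {A : Matrix n n ℂ} (hA : A.PosDef) {c : ℝ} (hc : 0 < c) :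
    ((c : ℂ) • A).PosDef := hA.smul (Complex.zero_lt_real.2 hc)

/-- A positive definite matrix dominates a positive multiple of any Hermitian matrix. -/
theorem exists_smul_le {A B : Matrix n n ℂ} (hA : A.PosDef) (hB : B.IsHermitian) :
    ∃ ε : ℝ, 0 < ε ∧ ∀ s : ℝ, 0 ≤ s → s ≤ ε → (A - (s : ℂ) • B).PosDef := by
  obtain ⟨δ, hδ, h1⟩ := exists_smul_one_le hA
  obtain ⟨C, hC, h2⟩ := exists_le_smul_one hB
  refine ⟨δ / (2 * C), by positivity, fun s hs hsε => ?_⟩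
  have e : A - (s : ℂ) • B = ((A - (δ : ℂ) • (1 : Matrix n n ℂ))
      + (s : ℂ) • ((C : ℂ) • (1 : Matrix n n ℂ) - B)) + ((δ - s * C : ℝ) : ℂ) • 1 := by
    push_cast
    module
  rw [e]
  have h3 : s * C ≤ δ / 2 := by
    have := mul_le_mul_of_nonneg_right hsε hC.le
    calc s * C ≤ δ / (2 * C) * C := this
      _ = δ / 2 := by field_simp
  exact Matrix.PosDef.posSemidef_add (h1.add (PosSemidef.smul_real h2 hs))
    (PosDef.smul_real Matrix.PosDef.one (by linarith))

theorem posSemidef_of_tendsto {ι : Type*} {l : Filter ι} [l.NeBot] {A : ι → Matrix n n ℂ}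
    {B : Matrix n n ℂ} (h : Tendsto A l (𝓝 B)) (hA : ∀ᶠ i in l, (A i).PosSemidef) :
    B.PosSemidef := by
  rw [Matrix.posSemidef_iff_dotProduct_mulVec]
  have hcl : IsClosed {M : Matrix n n ℂ | M.IsHermitian} :=
    isClosed_eq (continuous_id.matrix_conjTranspose) continuous_id
  refine ⟨hcl.mem_of_tendsto h (hA.mono fun i hi => hi.1), fun x => ?_⟩
  have hc : Continuous fun M : Matrix n n ℂ => star x ⬝ᵥ (M *ᵥ x) :=
    continuous_const.dotProduct (continuous_id.matrix_mulVec continuous_const)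
  exact ge_of_tendsto ((hc.tendsto B).comp h) (hA.mono fun i hi => hi.dotProduct_mulVec_nonneg x)

theorem posSemidef_coe_sub_trans {A B C : Matrix n n ℂ} (h1 : (A - B).PosSemidef)
    (h2 : (B - C).PosSemidef) : (A - C).PosSemidef := by
  have : A - C = (A - B) + (B - C) := by abel
  rw [this]
  exact h1.add h2

end Order

/-! ### The Schrödinger picture. -/

section Preadjoint

variable {n : Type*} [Fintype n] [DecidableEq n] {N : StarSubalgebra ℂ (Matrix n n ℂ)}
  {Φ : N →ₗ[ℂ] N}

theorem preadjoint_eq {X W : N}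
    (h : ∀ Y : N, (W * Y : Matrix n n ℂ).trace = (X * Φ Y : Matrix n n ℂ).trace) :
    preadjoint Φ X = W :=
  Subtype.ext (eq_of_trace_mul_eq (preadjoint Φ X).2 W.2 fun Z hZ =>
    (trace_preadjoint_mul Φ X ⟨Z, hZ⟩).trans (h ⟨Z, hZ⟩).symm)

theorem IsCompletelyPositive.map_posSemidef (hΦ : IsCompletelyPositive Φ) {X : N}
    (hX : (X : Matrix n n ℂ).PosSemidef) : (Φ X : Matrix n n ℂ).PosSemidef := by
  obtain ⟨K, hK⟩ := hΦ.exists_kraus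
  rw [hK X]
  exact Matrix.posSemidef_sum _ fun j _ => hX.conjTranspose_mul_mul_same _

theorem IsCompletelyPositive.map_star (hΦ : IsCompletelyPositive Φ) (X : N) :
    Φ (star X) = star (Φ X) := by
  obtain ⟨K, hK⟩ := hΦ.exists_kraus
  exact hK.map_star X

theorem preadjoint_isHermitian (hs : ∀ X, Φ (star X) = star (Φ X)) {X : N}
    (hX : (X : Matrix n n ℂ).IsHermitian) : (preadjoint Φ X : Matrix n n ℂ).IsHermitian := by
  apply eq_of_trace_mul_eq (N := N) (star_mem (preadjoint Φ X).2) (preadjoint Φ X).2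
  intro Z hZ
  have h1 : ((preadjoint Φ X : Matrix n n ℂ)ᴴ * Z).trace
      = star ((preadjoint Φ X : Matrix n n ℂ) * Zᴴ).trace := by
    rw [← Matrix.trace_conjTranspose, Matrix.conjTranspose_mul, Matrix.conjTranspose_conjTranspose,
      Matrix.trace_mul_comm]
  have h2 := trace_preadjoint_mul Φ X (star ⟨Z, hZ⟩)
  have h3 := trace_preadjoint_mul Φ X ⟨Z, hZ⟩
  rw [hs] at h2
  have h4 : ((star (Φ ⟨Z, hZ⟩) : N) : Matrix n n ℂ) = (Φ ⟨Z, hZ⟩ : Matrix n n ℂ)ᴴ := rfl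
  have h5 : ((star (⟨Z, hZ⟩ : N) : N) : Matrix n n ℂ) = Zᴴ := rfl
  rw [h4, h5] at h2
  change ((preadjoint Φ X : Matrix n n ℂ)ᴴ * Z).trace = _
  rw [h1, h2, ← Matrix.trace_conjTranspose, Matrix.conjTranspose_mul,
    Matrix.conjTranspose_conjTranspose, hX.eq, Matrix.trace_mul_comm]
  exact h3.symm

theorem IsCompletelyPositive.preadjoint_posSemidef (hΦ : IsCompletelyPositive Φ) {X : N}
    (hX : (X : Matrix n n ℂ).PosSemidef) : (preadjoint Φ X : Matrix n n ℂ).PosSemidef := by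
  refine posSemidef_of_trace_mul_nonneg (N := N) (preadjoint_isHermitian hΦ.map_star hX.1)
    (preadjoint Φ X).2 fun Z hZ hZp => ?_
  have h := trace_preadjoint_mul Φ X ⟨Z, hZ⟩
  simp only at h
  rw [h]
  exact trace_mul_re_nonneg hX (hΦ.map_posSemidef (X := ⟨Z, hZ⟩) hZp)

theorem trace_preadjoint (h1 : Φ 1 = 1) (X : N) :
    (preadjoint Φ X : Matrix n n ℂ).trace = (X : Matrix n n ℂ).trace := by
  have h := trace_preadjoint_mul Φ X 1
  rw [h1] at h
  simpa using h

theorem isState_preadjoint (hΦ : IsCompletelyPositive Φ) (h1 : Φ 1 = 1) {ρ : N} (hρ : IsState ρ) :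
    IsState (preadjoint Φ ρ) :=
  ⟨hΦ.preadjoint_posSemidef hρ.1, (trace_preadjoint h1 ρ).trans hρ.2⟩

/-- A bound ρ ≥ εσ is preserved by a positive map that fixes the faithful σ. -/
theorem preadjoint_posDef (hΦ : IsCompletelyPositive Φ) {σ : N} (hσ : (σ : Matrix n n ℂ).PosDef)
    (hinv : preadjoint Φ σ = σ) {ρ : N} (hρ : (ρ : Matrix n n ℂ).PosDef) :
    (preadjoint Φ ρ : Matrix n n ℂ).PosDef := by
  obtain ⟨ε, hε, h⟩ := exists_smul_le hρ hσ.1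
  have h1 := hΦ.preadjoint_posSemidef (X := ρ - (ε : ℂ) • σ) (h ε hε.le le_rfl).posSemidef
  rw [map_sub, map_smul, hinv] at h1
  have e : (preadjoint Φ ρ : Matrix n n ℂ)
      = ((preadjoint Φ ρ - (ε : ℂ) • σ : N) : Matrix n n ℂ) + (ε : ℂ) • (σ : Matrix n n ℂ) := by
    simp
  rw [e]
  exact Matrix.PosDef.posSemidef_add h1 (PosDef.smul_real hσ hε)

theorem preadjoint_comp (Φ Ψ : N →ₗ[ℂ] N) (X : N) :
    preadjoint (Φ ∘ₗ Ψ) X = preadjoint Ψ (preadjoint Φ X) := by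
  apply preadjoint_eq
  intro Y
  rw [trace_preadjoint_mul, trace_preadjoint_mul]
  rfl

end Preadjoint

/-! ### The GNS inner product of the invariant state. -/

section Semigroup

variable {n : Type*} [Fintype n] [DecidableEq n] {N : StarSubalgebra ℂ (Matrix n n ℂ)}
  {P : ℝ≥0 → N →ₗ[ℂ] N} {σ : N}

theorem IsGNSSymmetric.gnsSymm (hσ : IsGNSSymmetric P σ) (t : ℝ≥0) :
    GNSSymm (σ : Matrix n n ℂ) (P t) := hσ.detailedBalance t

/-- The GNS inner product of a faithful state. -/
abbrev gnsCore {σ : N} (hσ : (σ : Matrix n n ℂ).PosDef) : InnerProductSpace.Core ℂ N where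
  inner X Y := (σ * (X : Matrix n n ℂ)ᴴ * Y : Matrix n n ℂ).trace
  conj_inner_symm X Y := by
    change star (Matrix.trace _) = _
    rw [← Matrix.trace_conjTranspose]
    simp only [Matrix.conjTranspose_mul, Matrix.conjTranspose_conjTranspose, hσ.1.eq]
    rw [← Matrix.mul_assoc, Matrix.trace_mul_comm, ← Matrix.mul_assoc]
  re_inner_nonneg X := by
    rw [Matrix.mul_assoc]
    exact trace_mul_conj_re_nonneg hσ.posSemidef _
  add_left X Y Z := by
    simp [Matrix.conjTranspose_add, Matrix.mul_add, Matrix.add_mul]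
  smul_left X Y c := by
    simp [Matrix.conjTranspose_smul]
  definite X h := by
    rw [Matrix.mul_assoc] at h
    exact Subtype.ext (eq_zero_of_trace_mul_eq_zero hσ (by rw [h, Complex.zero_re]))

/-- Detailed balance is symmetry for the GNS inner product, and the Schwarz inequality combined with
invariance of σ is contractivity. -/
theorem IsQMS.exists_spectralResolution (hP : IsQMS P) (hσ : IsGNSSymmetric P σ) :
    ∃ (S : Finset ℝ) (Q : ℝ → N →ₗ[ℂ] N), SpectralResolution P S Q := by
  let _ : NormedAddCommGroup N := (gnsCore hσ.fullRank).toNormedAddCommGroup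
  let _ : InnerProductSpace ℂ N := .ofCore (gnsCore hσ.fullRank).toCore
  have hin : ∀ X Y : N, inner ℂ X Y = (σ * (X : Matrix n n ℂ)ᴴ * Y : Matrix n n ℂ).trace :=
    fun _ _ => rfl
  apply QuantumMarkov.exists_spectralResolution hP.zero hP.add
  · intro t X Y
    rw [hin, hin]
    exact (hσ.detailedBalance t X Y).symm
  · intro X
    simp only [hin]
    have h := hP.continuous X
    exact (continuous_const.matrix_mul (continuous_subtype_val.comp h)).matrix_trace
  · intro t X
    obtain ⟨K, hK⟩ := (hP.completelyPositive t).exists_kraus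
    have h := hK.trace_schwarz (hP.unital t) hσ.fullRank (hσ.invariant t) X
    rw [← sq_le_sq₀ (norm_nonneg _) (norm_nonneg _), @norm_sq_eq_re_inner ℂ, @norm_sq_eq_re_inner ℂ]
    exact h

end Semigroup

/-! ### The fixed-point algebra and its conditional expectation. -/

section FixedPoints

variable {n : Type*} [Fintype n] [DecidableEq n] {N : StarSubalgebra ℂ (Matrix n n ℂ)}
  {P : ℝ≥0 → N →ₗ[ℂ] N} {σ : N} {S : Finset ℝ} {Q : ℝ → N →ₗ[ℂ] N}

theorem tendsto_coe_apply {ι : Type*} {l : Filter ι} {f : ι → N} {x : N} (h : Tendsto f l (𝓝 x)) :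
    Tendsto (fun i => (f i : Matrix n n ℂ)) l (𝓝 (x : Matrix n n ℂ)) :=
  (continuous_subtype_val.tendsto x).comp h

theorem tendsto_trace_mul {ι : Type*} {l : Filter ι} {f : ι → N} {x : N} (h : Tendsto f l (𝓝 x))
    (A : Matrix n n ℂ) :
    Tendsto (fun i => (A * f i : Matrix n n ℂ).trace) l (𝓝 (A * x : Matrix n n ℂ).trace) :=
  ((continuous_const.matrix_mul continuous_id).matrix_trace.tendsto _).comp (tendsto_coe_apply h)

theorem SpectralResolution.completelyPositive (hS : SpectralResolution P S Q) (hP : IsQMS P) :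
    IsCompletelyPositive (Q 0) := by
  intro k X hX
  refine posSemidef_of_tendsto (l := atTop)
    (A := fun t => (amplMap (P t) k X : Matrix (n × Fin k) (n × Fin k) ℂ)) ?_
    (Eventually.of_forall fun t => hP.completelyPositive t k X hX)
  refine tendsto_pi_nhds.2 fun p => tendsto_pi_nhds.2 fun q => ?_
  have h1 := tendsto_coe_apply (hS.tendsto (⟨block X.1 p.2 q.2, X.2 p.2 q.2⟩ : N))
  exact tendsto_pi_nhds.1 (tendsto_pi_nhds.1 h1 p.1) q.1

theorem SpectralResolution.proj_one (hS : SpectralResolution P S Q) (hP : IsQMS P) : Q 0 1 = 1 :=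
  (hS.fixed_iff 1).2 hP.unital

theorem SpectralResolution.proj_proj (hS : SpectralResolution P S Q) (X : N) :
    Q 0 (Q 0 X) = Q 0 X := by rw [hS.mul_apply, if_pos rfl]

theorem SpectralResolution.semigroup_proj_zero (hS : SpectralResolution P S Q) (t : ℝ≥0) :
    P t ∘ₗ Q 0 = Q 0 := by
  ext1 X
  rw [LinearMap.comp_apply, hS.semigroup_proj]
  simp

theorem SpectralResolution.proj_zero_semigroup (hS : SpectralResolution P S Q) (t : ℝ≥0) :
    Q 0 ∘ₗ P t = Q 0 := by
  ext1 X
  rw [LinearMap.comp_apply, hS.proj_semigroup]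
  simp

theorem SpectralResolution.invariant (hS : SpectralResolution P S Q) (hσ : IsGNSSymmetric P σ)
    (X : N) : (σ * Q 0 X : Matrix n n ℂ).trace = (σ * X : Matrix n n ℂ).trace := by
  have h := tendsto_trace_mul (hS.tendsto X) (σ : Matrix n n ℂ)
  simp only [hσ.invariant] at h
  exact tendsto_nhds_unique h tendsto_const_nhds

theorem SpectralResolution.preadjoint_proj (hS : SpectralResolution P S Q)
    (hσ : IsGNSSymmetric P σ) : preadjoint (Q 0) σ = σ :=
  preadjoint_eq fun Y => (hS.invariant hσ Y).symm

theorem IsGNSSymmetric.preadjoint_semigroup (hσ : IsGNSSymmetric P σ) (t : ℝ≥0) :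
    preadjoint (P t) σ = σ :=
  preadjoint_eq fun Y => (hσ.invariant t Y).symm

theorem SpectralResolution.preadjoint_semigroup_proj (hS : SpectralResolution P S Q) (t : ℝ≥0)
    (X : N) : preadjoint (Q 0) (preadjoint (P t) X) = preadjoint (Q 0) X := by
  rw [← preadjoint_comp, hS.semigroup_proj_zero]

theorem IsQMS.map_star (hP : IsQMS P) (t : ℝ≥0) (X : N) : P t (star X) = star (P t X) :=
  (hP.completelyPositive t).map_star X

/-- Fixed points commute with the Kraus operators. Applied to star a, this also moves a past the
adjoints K†. -/
theorem IsQMS.map_mul_mul_of_fixed (hP : IsQMS P) (hσ : IsGNSSymmetric P σ) (t : ℝ≥0) {a b : N}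
    (ha : P t a = a) (hb : P t b = b) (X : N) : P t (a * X * b) = a * P t X * b := by
  obtain ⟨K, hK⟩ := (hP.completelyPositive t).exists_kraus
  have hb' := hK.commute_of_fixed (hP.unital t) hσ.fullRank (hσ.invariant t) hb
  have ha' := hK.commute_of_fixed (hP.unital t) hσ.fullRank (hσ.invariant t)
    (X := star a) (by rw [hP.map_star, ha])
  have hac : ∀ j, (K j)ᴴ * (a : Matrix n n ℂ) = a * (K j)ᴴ := by
    intro j
    have h := congrArg Matrix.conjTranspose (ha' j)
    have hst : ((star a : N) : Matrix n n ℂ) = (a : Matrix n n ℂ)ᴴ := rfl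
    simpa only [hst, Matrix.conjTranspose_mul, Matrix.conjTranspose_conjTranspose] using h
  apply Subtype.ext
  rw [hK]
  simp only [MulMemClass.coe_mul]
  rw [hK X, Finset.mul_sum, Finset.sum_mul]
  refine Finset.sum_congr rfl fun j _ => ?_
  calc (K j)ᴴ * ((a : Matrix n n ℂ) * X * b) * K j
      = ((K j)ᴴ * a) * X * (b * K j) := by simp only [Matrix.mul_assoc]
    _ = _ := by rw [hac, hb']; simp only [Matrix.mul_assoc]

/-- The algebra of fixed points of a quantum Markov semigroup with a faithful invariant state. -/
def fixedPoints (hP : IsQMS P) (hσ : IsGNSSymmetric P σ) : StarSubalgebra ℂ N where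
  carrier := {X | ∀ t, P t X = X}
  mul_mem' {a b} ha hb t := by
    have h := hP.map_mul_mul_of_fixed hσ t (ha t) (hb t) 1
    rw [hP.unital, mul_one] at h
    exact h
  add_mem' {a b} ha hb t := by rw [map_add, ha t, hb t]
  algebraMap_mem' r t := by
    rw [Algebra.algebraMap_eq_smul_one, map_smul, hP.unital]
  star_mem' {a} ha t := by rw [hP.map_star, ha t]

theorem mem_fixedPoints {hP : IsQMS P} {hσ : IsGNSSymmetric P σ} {X : N} :
    X ∈ fixedPoints hP hσ ↔ ∀ t, P t X = X := Iff.rfl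

theorem SpectralResolution.proj_mul_mul (hS : SpectralResolution P S Q) (hP : IsQMS P)
    (hσ : IsGNSSymmetric P σ) {a b : N} (ha : Q 0 a = a) (hb : Q 0 b = b) (X : N) :
    Q 0 (a * X * b) = a * Q 0 X * b := by
  have h1 := hS.tendsto (a * X * b)
  have h2 : ∀ t, P t (a * X * b) = a * P t X * b := fun t =>
    hP.map_mul_mul_of_fixed hσ t ((hS.fixed_iff a).1 ha t) ((hS.fixed_iff b).1 hb t) X
  simp only [h2] at h1
  refine tendsto_nhds_unique h1 ?_
  exact ((hS.tendsto X).const_mul a).mul_const b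

theorem SpectralResolution.isCondExp (hS : SpectralResolution P S Q) (hP : IsQMS P)
    (hσ : IsGNSSymmetric P σ) : IsCondExp (fixedPoints hP hσ) (Q 0) where
  completelyPositive := hS.completelyPositive hP
  unital := hS.proj_one hP
  mem X := (hS.fixed_iff _).1 (hS.proj_proj X)
  id_on X hX := (hS.fixed_iff X).2 hX
  bimodule a ha b hb X := hS.proj_mul_mul hP hσ ((hS.fixed_iff a).2 ha) ((hS.fixed_iff b).2 hb) X

/-- Detailed balance holds already under E, hence for every state factoring through E. Let W be E of
the difference Z of the two arguments. Detailed balance for XW and Y, with P_t(XW) = P_t(X)W, gives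
tr(σW*Z) = 0; by the module property this is tr(σW*W), so W = 0. -/
theorem SpectralResolution.proj_star_mul (hS : SpectralResolution P S Q) (hP : IsQMS P)
    (hσ : IsGNSSymmetric P σ) (t : ℝ≥0) (X Y : N) :
    Q 0 (star X * P t Y) = Q 0 (star (P t X) * Y) := by
  set Z : N := star X * P t Y - star (P t X) * Y with hZ
  set W : N := Q 0 Z with hW
  have hWf : Q 0 W = W := hS.proj_proj Z
  have hWs : Q 0 (star W) = star W := by
    rw [(hS.completelyPositive hP).map_star, hWf]
  have hst : ∀ Z : N, ((star Z : N) : Matrix n n ℂ) = (Z : Matrix n n ℂ)ᴴ := fun _ => rfl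
  have h1 : Q 0 (star W * Z) = star W * W := by
    have := hS.proj_mul_mul hP hσ hWs (hS.proj_one hP) Z
    rwa [mul_one, mul_one] at this
  have h2 := hS.invariant hσ (star W * Z)
  have h3 : (σ * (star W * Z : N) : Matrix n n ℂ).trace = 0 := by
    have h4 := hσ.detailedBalance t (X * W) Y
    have h5 : P t (X * W) = P t X * W := by
      have := hP.map_mul_mul_of_fixed hσ t (hP.unital t) ((hS.fixed_iff W).1 hWf t) X
      rwa [one_mul, one_mul] at this
    rw [h5] at h4
    simp only [MulMemClass.coe_mul, Matrix.conjTranspose_mul] at h4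
    simp only [hZ, MulMemClass.coe_mul, AddSubgroupClass.coe_sub, hst, Matrix.mul_sub,
      Matrix.trace_sub]
    simp only [Matrix.mul_assoc] at h4 ⊢
    rw [h4, sub_self]
  rw [h1, h3, MulMemClass.coe_mul, hst] at h2
  have h6 : (W : Matrix n n ℂ) = 0 :=
    eq_zero_of_trace_mul_eq_zero hσ.fullRank (by rw [h2, Complex.zero_re])
  have h7 : Q 0 (star X * P t Y) - Q 0 (star (P t X) * Y) = 0 := by
    rw [← map_sub]
    exact Subtype.ext h6
  exact sub_eq_zero.1 h7

/-- Detailed balance with respect to one faithful invariant state implies it for all of them. -/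
theorem SpectralResolution.isGNSSymmetric_preadjoint (hS : SpectralResolution P S Q)
    (hP : IsQMS P) (hσ : IsGNSSymmetric P σ) {ρ : N} (hρ : IsState ρ)
    (hρp : (ρ : Matrix n n ℂ).PosDef) : IsGNSSymmetric P (preadjoint (Q 0) ρ) where
  isState := isState_preadjoint (hS.completelyPositive hP) (hS.proj_one hP) hρ
  fullRank := preadjoint_posDef (hS.completelyPositive hP) hσ.fullRank (hS.preadjoint_proj hσ) hρp
  invariant t X := by
    rw [trace_preadjoint_mul, trace_preadjoint_mul, ← LinearMap.comp_apply,
      hS.proj_zero_semigroup]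
  detailedBalance t X Y := by
    have h1 := trace_preadjoint_mul (Q 0) ρ (star X * P t Y)
    have h2 := trace_preadjoint_mul (Q 0) ρ (star (P t X) * Y)
    rw [hS.proj_star_mul hP hσ, ← h2] at h1
    rw [Matrix.mul_assoc, Matrix.mul_assoc]
    exact h1

end FixedPoints

/-! ### All hypotheses pass to N ⊗ 𝕄ₖ for k ≠ 0. -/

section Amplification

variable {n : Type*} [Fintype n] [DecidableEq n] {N : StarSubalgebra ℂ (Matrix n n ℂ)}
  {k : ℕ}

theorem block_mul (X Y : Matrix (n × Fin k) (n × Fin k) ℂ) (a b : Fin k) :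
    block (X * Y) a b = ∑ c, block X a c * block Y c b := by
  ext i j
  simp only [block, Matrix.of_apply, Matrix.mul_apply, Matrix.sum_apply, Fintype.sum_prod_type]
  rw [Finset.sum_comm]

theorem block_conjTranspose (X : Matrix (n × Fin k) (n × Fin k) ℂ) (a b : Fin k) :
    block Xᴴ a b = (block X b a)ᴴ := rfl

theorem block_ext {X Y : Matrix (n × Fin k) (n × Fin k) ℂ} (h : ∀ a b, block X a b = block Y a b) :
    X = Y := by
  ext ⟨i, a⟩ ⟨j, b⟩
  exact congrFun (congrFun (h a b) i) j

theorem block_sum {ι : Type*} (s : Finset ι) (X : ι → Matrix (n × Fin k) (n × Fin k) ℂ)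
    (a b : Fin k) : block (∑ i ∈ s, X i) a b = ∑ i ∈ s, block (X i) a b := by
  ext i j
  simp only [block, Matrix.of_apply, Matrix.sum_apply]

/-- The blocks of an element of `N ⊗ 𝕄ₖ` as elements of `N`. -/
def amplBlock (X : ampl N k) (a b : Fin k) : N := ⟨block X.1 a b, X.2 a b⟩

theorem amplBlock_ext {X Y : ampl N k} (h : ∀ a b, amplBlock X a b = amplBlock Y a b) : X = Y :=
  Subtype.ext (block_ext fun a b => congrArg Subtype.val (h a b))

theorem amplBlock_amplMap (Φ : N →ₗ[ℂ] N) (X : ampl N k) (a b : Fin k) :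
    amplBlock (amplMap Φ k X) a b = Φ (amplBlock X a b) := rfl

theorem block_amplMap (Φ : N →ₗ[ℂ] N) (X : ampl N k) (a b : Fin k) :
    block (amplMap Φ k X : Matrix (n × Fin k) (n × Fin k) ℂ) a b = Φ (amplBlock X a b) := rfl

theorem amplMap_id : amplMap (LinearMap.id : N →ₗ[ℂ] N) k = LinearMap.id := rfl

theorem amplMap_comp (Φ Ψ : N →ₗ[ℂ] N) : amplMap (Φ ∘ₗ Ψ) k = amplMap Φ k ∘ₗ amplMap Ψ k := rfl

theorem amplMap_zero : amplMap (0 : N →ₗ[ℂ] N) k = 0 := rfl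

theorem amplMap_add (Φ Ψ : N →ₗ[ℂ] N) : amplMap (Φ + Ψ) k = amplMap Φ k + amplMap Ψ k := rfl

theorem amplMap_sum {ι : Type*} (s : Finset ι) (Φ : ι → N →ₗ[ℂ] N) :
    amplMap (∑ i ∈ s, Φ i) k = ∑ i ∈ s, amplMap (Φ i) k := by
  classical
  induction s using Finset.induction_on with
  | empty => simp [amplMap_zero]
  | insert a s ha ih => rw [Finset.sum_insert ha, Finset.sum_insert ha, amplMap_add, ih]

theorem block_kronecker_one (K : Matrix n n ℂ) (a b : Fin k) :
    block (kroneckerMap (· * ·) K (1 : Matrix (Fin k) (Fin k) ℂ)) a b = if a = b then K else 0 := by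
  ext i j
  simp only [block, Matrix.of_apply, Matrix.kroneckerMap_apply, Matrix.one_apply]
  split_ifs <;> simp

theorem IsKraus.amplify {J : Type*} [Fintype J] {Φ : N →ₗ[ℂ] N} {K : J → Matrix n n ℂ}
    (hK : IsKraus Φ K) (k : ℕ) :
    IsKraus (amplMap Φ k) fun j => kroneckerMap (· * ·) (K j) (1 : Matrix (Fin k) (Fin k) ℂ) := by
  intro X
  apply block_ext
  intro a b
  rw [block_amplMap, hK, block_sum]
  refine Finset.sum_congr rfl fun j _ => ?_
  rw [block_mul]
  simp only [block_mul, block_conjTranspose, block_kronecker_one]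
  rw [Finset.sum_eq_single b]
  · rw [Finset.sum_eq_single a]
    · simp [amplBlock]
    · intro c _ hc
      simp [hc]
    · simp
  · intro c _ hc
    simp [hc]
  · simp

theorem IsKraus.completelyPositive {J : Type*} [Fintype J] {Φ : N →ₗ[ℂ] N}
    {K : J → Matrix n n ℂ} (hK : IsKraus Φ K) : IsCompletelyPositive Φ := by
  intro k X hX
  rw [hK.amplify k X]
  exact Matrix.posSemidef_sum _ fun j _ => hX.conjTranspose_mul_mul_same _

theorem IsCompletelyPositive.amplify {Φ : N →ₗ[ℂ] N} (h : IsCompletelyPositive Φ) (k : ℕ) :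
    IsCompletelyPositive (amplMap Φ k) := by
  obtain ⟨K, hK⟩ := h.exists_kraus
  exact (hK.amplify k).completelyPositive

theorem amplBlock_one (a b : Fin k) : amplBlock (1 : ampl N k) a b = if a = b then 1 else 0 := by
  apply Subtype.ext
  ext i j
  by_cases h : a = b
  · simp [amplBlock, block, Matrix.one_apply, h]
  · simp [amplBlock, block, h]

theorem amplMap_one {Φ : N →ₗ[ℂ] N} (h : Φ 1 = 1) : amplMap Φ k 1 = 1 := by
  apply amplBlock_ext
  intro a b
  rw [amplBlock_amplMap, amplBlock_one]
  split_ifs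
  · exact h
  · exact map_zero Φ

variable {P : ℝ≥0 → N →ₗ[ℂ] N} {σ : N} {S : Finset ℝ} {Q : ℝ → N →ₗ[ℂ] N}

theorem IsQMS.amplify (hP : IsQMS P) (k : ℕ) : IsQMS fun t => amplMap (P t) k where
  completelyPositive t := (hP.completelyPositive t).amplify k
  unital t := amplMap_one (hP.unital t)
  zero := by rw [hP.zero, amplMap_id]
  add s t := by rw [hP.add, amplMap_comp]
  continuous X := by
    refine Continuous.subtype_mk ?_ _
    refine continuous_pi fun p => continuous_pi fun q => ?_
    exact ((continuous_subtype_val.comp (hP.continuous (amplBlock X p.2 q.2))).matrix_elem p.1 q.1)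

theorem SpectralResolution.amplify (hS : SpectralResolution P S Q) (k : ℕ) :
    SpectralResolution (fun t => amplMap (P t) k) S fun l => amplMap (Q l) k where
  nonneg := hS.nonneg
  of_notMem l hl := by rw [hS.of_notMem l hl, amplMap_zero]
  sum := by rw [← amplMap_sum, hS.sum, amplMap_id]
  mul l m := by
    rw [← amplMap_comp, hS.mul]
    split_ifs
    · rfl
    · exact amplMap_zero
  apply t := by
    rw [hS.apply, amplMap_sum]
    rfl

/-- The product of a state with the maximally mixed state. -/
def amplState (σ : N) (k : ℕ) : ampl N k :=
  ⟨((k : ℝ)⁻¹ : ℂ) • kroneckerMap (· * ·) (σ : Matrix n n ℂ) (1 : Matrix (Fin k) (Fin k) ℂ), by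
    apply SMulMemClass.smul_mem
    intro a b
    rw [block_kronecker_one]
    split_ifs
    · exact σ.2
    · exact zero_mem N⟩

theorem trace_amplState_mul (σ : N) (X : Matrix (n × Fin k) (n × Fin k) ℂ) :
    (amplState σ k * X : Matrix (n × Fin k) (n × Fin k) ℂ).trace
      = ((k : ℝ)⁻¹ : ℂ) * ∑ a, (σ * block X a a : Matrix n n ℂ).trace := by
  rw [amplState, Matrix.smul_mul, Matrix.trace_smul, trace_mul_ampl, smul_eq_mul]
  congr 1
  refine Finset.sum_congr rfl fun a _ => ?_
  rw [Finset.sum_eq_single a]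
  · rw [block_kronecker_one, if_pos rfl]
  · intro b _ hb
    rw [block_kronecker_one, if_neg (Ne.symm hb), Matrix.zero_mul, Matrix.trace_zero]
  · simp

theorem IsGNSSymmetric.amplify (hσ : IsGNSSymmetric P σ) (hk : k ≠ 0) :
    IsGNSSymmetric (fun t => amplMap (P t) k) (amplState σ k) := by
  have hk' : (0 : ℝ) < (k : ℝ)⁻¹ := inv_pos.2 (Nat.cast_pos.2 (Nat.pos_of_ne_zero hk))
  have hpd : (amplState σ k : Matrix (n × Fin k) (n × Fin k) ℂ).PosDef := by
    have h := PosDef.smul_real (hσ.fullRank.kronecker (Matrix.PosDef.one (n := Fin k))) hk'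
    rw [Complex.ofReal_inv] at h
    exact h
  have hbl : ∀ (X Y : ampl N k) (a : Fin k),
      ((σ : Matrix n n ℂ) * block ((X : Matrix (n × Fin k) (n × Fin k) ℂ)ᴴ *
        (Y : Matrix (n × Fin k) (n × Fin k) ℂ)) a a).trace
        = ∑ c, (σ * (amplBlock X c a : Matrix n n ℂ)ᴴ * amplBlock Y c a : Matrix n n ℂ).trace := by
    intro X Y a
    rw [block_mul, Finset.mul_sum, Matrix.trace_sum]
    refine Finset.sum_congr rfl fun c _ => ?_
    rw [block_conjTranspose, ← Matrix.mul_assoc]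
    rfl
  refine ⟨⟨hpd.posSemidef, ?_⟩, hpd, fun t X => ?_, fun t X Y => ?_⟩
  · have h := trace_amplState_mul σ (1 : Matrix (n × Fin k) (n × Fin k) ℂ)
    rw [Matrix.mul_one] at h
    rw [h]
    have h1 : ∀ a : Fin k, block (1 : Matrix (n × Fin k) (n × Fin k) ℂ) a a = 1 := fun a => by
      ext i j
      simp [block, Matrix.one_apply]
    simp only [h1, hσ.isState.2, Finset.sum_const, Finset.card_univ,
      Fintype.card_fin, nsmul_eq_mul, mul_one]
    push_cast
    exact inv_mul_cancel₀ (Nat.cast_ne_zero.2 hk)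
  · rw [trace_amplState_mul, trace_amplState_mul]
    congr 1
    refine Finset.sum_congr rfl fun a _ => ?_
    exact hσ.invariant t (amplBlock X a a)
  · rw [Matrix.mul_assoc, Matrix.mul_assoc, trace_amplState_mul, trace_amplState_mul]
    congr 1
    refine Finset.sum_congr rfl fun a _ => ?_
    rw [hbl, hbl]
    exact Finset.sum_congr rfl fun c _ => hσ.detailedBalance t (amplBlock X c a) (amplBlock Y c a)

/-- Over ℂ⁰ every trace vanishes. Thus k = 0, where `amplState` is not a state, is vacuous
throughout. -/
theorem not_isState_ampl_zero (ρ : ampl N 0) : ¬ IsState ρ := fun h => by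
  have := h.2
  simp [Matrix.trace] at this

end Amplification

/-! ### Finiteness and attainment of the index. -/

section Index

variable {n : Type*} [Fintype n] [DecidableEq n] {N : StarSubalgebra ℂ (Matrix n n ℂ)}
  {P : ℝ≥0 → N →ₗ[ℂ] N} {σ : N} {S : Finset ℝ} {Q : ℝ → N →ₗ[ℂ] N}

theorem SpectralResolution.proj_cfc (hS : SpectralResolution P S Q) (hP : IsQMS P)
    (hσ : IsGNSSymmetric P σ) {G : N} (hG : Q 0 G = G) (f : ℝ → ℝ)
    (hf : cfc f (G : Matrix n n ℂ) ∈ N) :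
    Q 0 ⟨cfc f (G : Matrix n n ℂ), hf⟩ = ⟨cfc f (G : Matrix n n ℂ), hf⟩ := by
  have h : cfc f (G : Matrix n n ℂ) ∈ (fixedPoints hP hσ).map N.subtype :=
    cfc_mem (StarSubalgebra.mem_map.2 ⟨G, mem_fixedPoints.2 ((hS.fixed_iff G).1 hG), rfl⟩) f
  obtain ⟨Y, hY, hY2⟩ := h
  have : (⟨cfc f (G : Matrix n n ℂ), hf⟩ : N) = Y := Subtype.ext hY2.symm
  rw [this]
  exact (hS.fixed_iff Y).2 (mem_fixedPoints.1 hY)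

/-- A faithful conditional expectation in finite dimension dominates each positive element. -/
theorem SpectralResolution.exists_le_smul_proj (hS : SpectralResolution P S Q) (hP : IsQMS P)
    (hσ : IsGNSSymmetric P σ) {Y : N} (hY : (Y : Matrix n n ℂ).PosSemidef) :
    ∃ c : ℝ, 0 < c ∧ ((c : ℂ) • (Q 0 Y : Matrix n n ℂ) - Y).PosSemidef := by
  set G : Matrix n n ℂ := ((Q 0 Y : N) : Matrix n n ℂ) with hG
  have hGp : G.PosSemidef := (hS.completelyPositive hP).map_posSemidef hY
  -- p is the kernel projection of E(Y) and a fixed point. Hence E(pYp) = pE(Y)p = 0, and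
  -- faithfulness of σ gives Yp = 0.
  set p : N := ⟨specProj G 0, specProj_mem (Q 0 Y).2 0⟩ with hp
  have hpf : Q 0 p = p := hS.proj_cfc hP hσ (hS.proj_proj Y) _ _
  have hpG : G * p = 0 := by
    rw [hp, mul_specProj hGp.1]
    simp
  have hpH : (p : Matrix n n ℂ)ᴴ = p := specProj_conjTranspose G 0
  have h1 : Q 0 (p * Y * p) = 0 := by
    rw [hS.proj_mul_mul hP hσ hpf hpf]
    apply Subtype.ext
    simp only [MulMemClass.coe_mul, Matrix.mul_assoc]
    rw [← hG, hpG, Matrix.mul_zero]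
    rfl
  obtain ⟨B, hB, -⟩ := exists_eq_conjTranspose_mul_self hY
  have h2 : B * p = 0 := by
    apply eq_zero_of_trace_mul_eq_zero hσ.fullRank
    have h3 := hS.invariant hσ (p * Y * p)
    rw [h1] at h3
    simp only [MulMemClass.coe_mul, ZeroMemClass.coe_zero, Matrix.mul_zero, Matrix.trace_zero] at h3
    rw [Matrix.conjTranspose_mul, hpH]
    rw [hB] at h3
    simp only [Matrix.mul_assoc] at h3 ⊢
    rw [← h3, Complex.zero_re]
  have h4 : (Y : Matrix n n ℂ) * p = 0 := by rw [hB, Matrix.mul_assoc, h2, Matrix.mul_zero]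
  have h5 : (p : Matrix n n ℂ) * Y = 0 := by
    have := congrArg Matrix.conjTranspose h4
    rwa [Matrix.conjTranspose_mul, hpH, hY.1.eq, Matrix.conjTranspose_zero] at this
  obtain ⟨C, hC, h6⟩ := exists_le_smul_one hY.1
  obtain ⟨δ, hδ, h7⟩ : ∃ δ : ℝ, 0 < δ ∧ ∀ x ∈ eigs G, x ≠ 0 → δ ≤ x := by
    rcases ((eigs G).filter (· ≠ 0)).eq_empty_or_nonempty with h | h
    · refine ⟨1, one_pos, fun x hx hx0 => ?_⟩
      have : x ∈ (eigs G).filter (· ≠ 0) := Finset.mem_filter.2 ⟨hx, hx0⟩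
      rw [h] at this
      simp at this
    · have hm := Finset.mem_filter.1 (Finset.min'_mem _ h)
      exact ⟨_, lt_of_le_of_ne (eigs_nonneg hGp hm.1) (Ne.symm hm.2),
        fun x hx hx0 => Finset.min'_le _ _ (Finset.mem_filter.2 ⟨hx, hx0⟩)⟩
  -- Y ≤ C compressed by 1 - p gives Y ≤ C(1 - p), and 1 - p ≤ δ⁻¹E(Y), where δ bounds the nonzero
  -- eigenvalues of E(Y) from below.
  refine ⟨C / δ, by positivity, ?_⟩
  have hcomp : (1 - p : Matrix n n ℂ)ᴴ * ((C : ℂ) • (1 : Matrix n n ℂ) - Y) * (1 - p)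
      = (C : ℂ) • (1 - (p : Matrix n n ℂ)) - Y := by
    have hpp : (p : Matrix n n ℂ) * p = p := by
      rw [hp]
      simp only
      rw [specProj_mul_specProj, if_pos rfl]
    rw [Matrix.conjTranspose_sub, Matrix.conjTranspose_one, hpH]
    simp only [Matrix.sub_mul, Matrix.mul_sub, Matrix.one_mul, Matrix.mul_one, Matrix.smul_mul,
      Matrix.mul_smul, h4, h5, hpp, smul_sub, sub_zero, sub_self]
  have h8 := h6.conjTranspose_mul_mul_same (1 - p : Matrix n n ℂ)
  rw [hcomp] at h8
  refine posSemidef_coe_sub_trans ?_ h8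
  have e : ((C / δ : ℝ) : ℂ) • G - (C : ℂ) • (1 - (p : Matrix n n ℂ))
      = cfc (fun x : ℝ => C / δ * x - C * (1 - if x = 0 then 1 else 0)) G := by
    have hGs := hGp.1.isSelfAdjoint
    rw [cfc_sub _ _ G (continuousOn_spectrum _ _) (continuousOn_spectrum _ _),
      cfc_const_mul _ _ G (continuousOn_spectrum _ _),
      cfc_const_mul _ _ G (continuousOn_spectrum _ _),
      cfc_sub _ _ G (continuousOn_spectrum _ _) (continuousOn_spectrum _ _),
      cfc_id' ℝ G hGs, cfc_const_one ℝ G hGs]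
    rfl
  rw [e]
  refine posSemidef_cfc_of_eigs fun x hx => ?_
  by_cases hx0 : x = 0
  · simp [hx0]
  · rw [if_neg hx0, sub_zero, mul_one, sub_nonneg]
    calc C = C / δ * δ := by field_simp
      _ ≤ C / δ * x := mul_le_mul_of_nonneg_left (h7 x hx hx0) (by positivity)

theorem conjTranspose_scalar_sandwich {d k : ℕ} (w : Fin k → Fin d → ℂ)
    (Y : Matrix (n × Fin d) (n × Fin d) ℂ) (a b : Fin k) :
    block ((Matrix.of fun (p : n × Fin d) (q : n × Fin k) =>
        if p.1 = q.1 then w q.2 p.2 else 0)ᴴ * Y * (Matrix.of fun (p : n × Fin d) (q : n × Fin k) =>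
        if p.1 = q.1 then w q.2 p.2 else 0)) a b
      = ∑ l, ∑ m, (star (w a l) * w b m) • block Y l m := by
  ext i j
  simp only [block, Matrix.of_apply, Matrix.mul_apply, Matrix.conjTranspose_apply,
    Fintype.sum_prod_type, Matrix.sum_apply, Matrix.smul_apply, smul_eq_mul, apply_ite star,
    star_zero, ite_mul, zero_mul, mul_ite, mul_zero, Finset.sum_mul]
  simp only [Finset.sum_ite_irrel, Finset.sum_const_zero, Finset.sum_ite_eq', Finset.mem_univ,
    if_true]
  rw [Finset.sum_comm]
  exact Finset.sum_congr rfl fun l _ => Finset.sum_congr rfl fun m _ => by ring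

/-- Uniformity in k: for a basis u of N, of size d, the positive element Y = (u_l* u_m) of N ⊗ 𝕄_d
generates everything. Any positive Z = W*W is a sum Σ A_r† Y A_r with A_r acting as scalars on H,
and amplified maps commute with such compressions. The constant for Y thus serves every k. -/
theorem SpectralResolution.exists_forall_ampl_le (hS : SpectralResolution P S Q) (hP : IsQMS P)
    (hσ : IsGNSSymmetric P σ) :
    ∃ c : ℝ, 0 < c ∧ ∀ (k : ℕ) (Z : ampl N k),
      (Z : Matrix (n × Fin k) (n × Fin k) ℂ).PosSemidef →
      ((c : ℂ) • (amplMap (Q 0) k Z : Matrix (n × Fin k) (n × Fin k) ℂ) - Z).PosSemidef := by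
  set d := Module.finrank ℂ N with hd
  set u := Module.finBasis ℂ N with hu
  have : Nontrivial N := by
    refine ⟨σ, 0, fun h => ?_⟩
    have := hσ.isState.2
    rw [h] at this
    simp at this
  have hd0 : d ≠ 0 := Module.finrank_pos.ne'
  set R : Matrix n (n × Fin d) ℂ := Matrix.of fun i q => (u q.2 : Matrix n n ℂ) i q.1 with hR
  have hYb : ∀ l m, block (Rᴴ * R) l m = (star (u l) * u m : N) := by
    intro l m
    ext i j
    simp [block, hR, Matrix.mul_apply, Matrix.star_apply]
  set Y : ampl N d := ⟨Rᴴ * R, fun l m => by rw [hYb]; exact (star (u l) * u m).2⟩ with hY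
  have hYb' : ∀ l m, amplBlock Y l m = star (u l) * u m := fun l m => Subtype.ext (hYb l m)
  obtain ⟨c, hc, h⟩ := (hS.amplify d).exists_le_smul_proj (hP.amplify d) (hσ.amplify hd0)
    (Y := Y) (Matrix.posSemidef_conjTranspose_mul_self R)
  refine ⟨c, hc, fun k Z hZ => ?_⟩
  obtain ⟨W, hW, hWm⟩ := exists_eq_conjTranspose_mul_self hZ
  set W' : ampl N k := ⟨W, hWm _ Z.2⟩ with hW'
  -- A_r holds the coordinates, in the basis u, of the r-th row of blocks of W.
  set A : Fin k → Matrix (n × Fin d) (n × Fin k) ℂ := fun r => Matrix.of fun p q =>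
    if p.1 = q.1 then u.repr (amplBlock W' r q.2) p.2 else 0 with hA
  have hblk : ∀ a b, amplBlock Z a b = ∑ r, ∑ l, ∑ m,
      (star (u.repr (amplBlock W' r a) l) * u.repr (amplBlock W' r b) m) • amplBlock Y l m := by
    intro a b
    have h1 : amplBlock Z a b = ∑ r, star (amplBlock W' r a) * amplBlock W' r b := by
      apply Subtype.ext
      change block (Z : Matrix (n × Fin k) (n × Fin k) ℂ) a b = _
      rw [hW, block_mul]
      push_cast
      rfl
    rw [h1]
    refine Finset.sum_congr rfl fun r _ => ?_
    conv_lhs => rw [← u.sum_repr (amplBlock W' r a), ← u.sum_repr (amplBlock W' r b)]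
    rw [star_sum, Finset.sum_mul_sum]
    refine Finset.sum_congr rfl fun l _ => Finset.sum_congr rfl fun m _ => ?_
    rw [hYb', star_smul, smul_mul_smul_comm]
  have key : ∀ Φ : N →ₗ[ℂ] N, (amplMap Φ k Z : Matrix (n × Fin k) (n × Fin k) ℂ)
      = ∑ r, (A r)ᴴ * (amplMap Φ d Y : Matrix (n × Fin d) (n × Fin d) ℂ) * A r := by
    intro Φ
    apply block_ext
    intro a b
    rw [block_amplMap, hblk, block_sum]
    simp only [map_sum, map_smul]
    push_cast
    refine Finset.sum_congr rfl fun r _ => ?_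
    rw [hA]
    simp only
    rw [conjTranspose_scalar_sandwich (fun a l => u.repr (amplBlock W' r a) l)]
    rfl
  have h2 := key LinearMap.id
  rw [amplMap_id, amplMap_id] at h2
  simp only [LinearMap.id_apply] at h2
  rw [key (Q 0), h2, Finset.smul_sum, ← Finset.sum_sub_distrib]
  refine Matrix.posSemidef_sum _ fun r _ => ?_
  have h3 := h.conjTranspose_mul_mul_same (A r)
  rwa [Matrix.mul_sub, Matrix.sub_mul, Matrix.mul_smul, Matrix.smul_mul] at h3

/-- Duality: domination by `c E` on positive elements gives domination by `c E_*`. -/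
theorem IsCompletelyPositive.smul_preadjoint_sub_posSemidef {Φ : N →ₗ[ℂ] N}
    (hΦ : IsCompletelyPositive Φ) {c : ℝ}
    (h : ∀ Z : N, (Z : Matrix n n ℂ).PosSemidef → ((c : ℂ) • (Φ Z : Matrix n n ℂ) - Z).PosSemidef)
    {ρ : N} (hρ : (ρ : Matrix n n ℂ).PosSemidef) :
    ((c : ℂ) • (preadjoint Φ ρ : Matrix n n ℂ) - ρ).PosSemidef := by
  have hH : ((c : ℂ) • (preadjoint Φ ρ : Matrix n n ℂ)).IsHermitian := by
    unfold Matrix.IsHermitian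
    rw [Matrix.conjTranspose_smul, (hΦ.preadjoint_posSemidef hρ).1.eq]
    simp
  refine posSemidef_of_trace_mul_nonneg (N := N) (hH.sub hρ.1)
    (((c : ℂ) • preadjoint Φ ρ - ρ : N)).2 fun Z hZ hZp => ?_
  have h1 := trace_mul_re_nonneg hρ (h ⟨Z, hZ⟩ hZp)
  have h2 := trace_preadjoint_mul Φ ρ ⟨Z, hZ⟩
  simp only at h2
  rw [Matrix.sub_mul, Matrix.smul_mul, Matrix.trace_sub, Matrix.trace_smul, h2]
  rwa [Matrix.mul_sub, Matrix.mul_smul, Matrix.trace_sub, Matrix.trace_smul] at h1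

/-- The bound `ρ ≤ c E_* ρ` for all states `ρ`. -/
def IndexLE (E : N →ₗ[ℂ] N) (c : ℝ) : Prop :=
  ∀ ρ : N, IsState ρ → ((c : ℂ) • (preadjoint E ρ : Matrix n n ℂ) - ρ).PosSemidef

theorem IndexLE.mono {E : N →ₗ[ℂ] N} (hE : IsCompletelyPositive E) {c c' : ℝ} (h : IndexLE E c)
    (hc : c ≤ c') : IndexLE E c' := by
  intro ρ hρ
  have h1 := PosSemidef.smul_real (hE.preadjoint_posSemidef hρ.1) (sub_nonneg.2 hc)
  have h2 := h1.add (h ρ hρ)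
  convert h2 using 1
  push_cast
  module

theorem IndexLE.one_le {E : N →ₗ[ℂ] N} (h1 : E 1 = 1) {c : ℝ} (h : IndexLE E c)
    {ρ : N} (hρ : IsState ρ) : 1 ≤ c := by
  have h2 := (h ρ hρ).trace_nonneg
  rw [Matrix.trace_sub, Matrix.trace_smul, trace_preadjoint h1, hρ.2, smul_eq_mul, mul_one] at h2
  have h3 := (Complex.le_def.1 h2).1
  simp at h3
  exact h3

theorem index_le {E : N →ₗ[ℂ] N} {c : ℝ} (hc : 0 < c) (h : IndexLE E c) : index E ≤ (c : EReal) :=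
  iInf₂_le c ⟨hc, h⟩

/-- The infimum defining the index is attained. -/
theorem exists_index_eq {E : N →ₗ[ℂ] N} (hE : IsCompletelyPositive E) (h1 : E 1 = 1) {c : ℝ}
    (h : IndexLE E c) {ρ : N} (hρ : IsState ρ) :
    ∃ c₀ : ℝ, 1 ≤ c₀ ∧ index E = (c₀ : EReal) ∧ IndexLE E c₀ := by
  set V : Set ℝ := {c | IndexLE E c} with hV
  have hne : V.Nonempty := ⟨c, h⟩
  have hbdd : BddBelow V := ⟨1, fun x hx => IndexLE.one_le h1 hx hρ⟩
  have h2 : 1 ≤ sInf V := le_csInf hne fun x hx => IndexLE.one_le h1 hx hρ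
  have h3 : IndexLE E (sInf V) := by
    intro τ hτ
    refine posSemidef_of_tendsto (l := 𝓝[>] (sInf V))
      (A := fun x : ℝ => (x : ℂ) • (preadjoint E τ : Matrix n n ℂ) - (τ : Matrix n n ℂ)) ?_ ?_
    · have hc : Continuous fun x : ℝ =>
          (x : ℂ) • (preadjoint E τ : Matrix n n ℂ) - (τ : Matrix n n ℂ) := by
        fun_prop
      exact (hc.tendsto _).mono_left nhdsWithin_le_nhds
    · filter_upwards [self_mem_nhdsWithin] with x hx
      obtain ⟨y, hy, hyx⟩ := exists_lt_of_csInf_lt hne hx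
      exact IndexLE.mono hE hy hyx.le τ hτ
  refine ⟨sInf V, h2, le_antisymm (index_le (by linarith) h3) ?_, h3⟩
  exact le_iInf₂ fun x hx => EReal.coe_le_coe_iff.2 (csInf_le hbdd hx.2)

theorem SpectralResolution.exists_indexCB_eq (hS : SpectralResolution P S Q) (hP : IsQMS P)
    (hσ : IsGNSSymmetric P σ) :
    ∃ C : ℝ, 1 ≤ C ∧ indexCB (Q 0) = (C : EReal) ∧ ∀ k, IndexLE (amplMap (Q 0) k) C := by
  obtain ⟨c, hc, h⟩ := hS.exists_forall_ampl_le hP hσ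
  have hE := hS.completelyPositive hP
  have h1 : ∀ k, IndexLE (amplMap (Q 0) k) c := fun k ρ hρ =>
    (hE.amplify k).smul_preadjoint_sub_posSemidef (h k) hρ.1
  have h2 : ∀ k, k ≠ 0 → ∃ c₀ : ℝ, 1 ≤ c₀ ∧ index (amplMap (Q 0) k) = (c₀ : EReal) ∧
      IndexLE (amplMap (Q 0) k) c₀ := fun k hk =>
    exists_index_eq (hE.amplify k) (amplMap_one (hS.proj_one hP)) (h1 k) (hσ.amplify hk).isState
  have h3 : indexCB (Q 0) ≤ (c : EReal) := iSup_le fun k => index_le hc (h1 k)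
  have h4 : (1 : EReal) ≤ indexCB (Q 0) := by
    obtain ⟨c₀, h5, h6, -⟩ := h2 1 one_ne_zero
    refine le_trans ?_ (le_iSup _ 1)
    rw [h6]
    exact_mod_cast h5
  have h5 : ((indexCB (Q 0)).toReal : EReal) = indexCB (Q 0) := by
    apply EReal.coe_toReal
    · exact ne_top_of_le_ne_top (EReal.coe_ne_top c) h3
    · exact ne_bot_of_le_ne_bot (by exact EReal.coe_ne_bot 1) h4
  refine ⟨(indexCB (Q 0)).toReal, ?_, h5.symm, fun k => ?_⟩
  · rw [← h5] at h4
    exact_mod_cast h4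
  · rcases eq_or_ne k 0 with rfl | hk
    · exact fun ρ hρ => absurd hρ (not_isState_ampl_zero ρ)
    · obtain ⟨c₀, -, h7, h8⟩ := h2 k hk
      refine h8.mono (hE.amplify k) ?_
      rw [← EReal.coe_le_coe_iff, h5, ← h7]
      exact le_iSup (fun k => index (amplMap (Q 0) k)) k

theorem SpectralResolution.exists_index_eq (hS : SpectralResolution P S Q) (hP : IsQMS P)
    (hσ : IsGNSSymmetric P σ) :
    ∃ c : ℝ, 1 ≤ c ∧ index (Q 0) = (c : EReal) ∧ IndexLE (Q 0) c := by
  obtain ⟨c, hc, h⟩ := hS.exists_forall_ampl_le hP hσ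
  have hE := hS.completelyPositive hP
  refine QuantumMarkov.exists_index_eq hE (hS.proj_one hP) (c := c) (fun ρ hρ => ?_) hσ.isState
  refine hE.smul_preadjoint_sub_posSemidef (fun Z hZ => ?_) hρ.1
  have hb := block_kronecker_one (k := 1) (Z : Matrix n n ℂ)
  have hm : kroneckerMap (· * ·) (Z : Matrix n n ℂ) (1 : Matrix (Fin 1) (Fin 1) ℂ) ∈ ampl N 1 := by
    intro a b
    rw [hb]
    split_ifs
    · exact Z.2
    · exact zero_mem N
  have h1 := (h 1 ⟨_, hm⟩ (hZ.kronecker Matrix.PosSemidef.one)).submatrix fun i : n => (i, (0 : Fin 1))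
  have h2 : amplBlock (⟨_, hm⟩ : ampl N 1) 0 0 = Z := Subtype.ext (by
    change block _ 0 0 = _
    rw [hb, if_pos rfl])
  have h3 : (c : ℂ) • (Q 0 Z : Matrix n n ℂ) - Z
      = (c : ℂ) • (Q 0 (amplBlock (⟨_, hm⟩ : ampl N 1) 0 0) : Matrix n n ℂ)
        - amplBlock (⟨_, hm⟩ : ampl N 1) 0 0 := by rw [h2]
  rw [h3]
  exact h1

end Index

/-! ### The spectral gap in the BKM inner product. -/

section SpectralGap

variable {n : Type*} [Fintype n] [DecidableEq n] {N : StarSubalgebra ℂ (Matrix n n ℂ)}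
  {P : ℝ≥0 → N →ₗ[ℂ] N} {σ ω : N} {S : Finset ℝ} {Q : ℝ → N →ₗ[ℂ] N}

theorem IsCompletelyPositive.exists_isModularKraus {Φ : N →ₗ[ℂ] N} (hΦ : IsCompletelyPositive Φ)
    (hω : (ω : Matrix n n ℂ).PosDef) (h : GNSSymm (ω : Matrix n n ℂ) Φ) :
    ∃ (R : Finset ℝ) (K : (n × Fin (Fintype.card n)) × R → Matrix n n ℂ)
      (ν : (n × Fin (Fintype.card n)) × R → ℝ), IsModularKraus (ω : Matrix n n ℂ) Φ K ν := by
  obtain ⟨K, hK⟩ := hΦ.exists_kraus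
  obtain ⟨R, K', ν, h1, h2⟩ := hK.exists_modular hω ω.2 h
  exact ⟨R, K', ν, ⟨h1, fun j => (h2 j).1, fun j => (h2 j).2⟩⟩

theorem IsGNSSymmetric.trace_bkm_mul_map (hω : IsGNSSymmetric P ω) (hP : IsQMS P) (t : ℝ≥0)
    (Y Z : N) : (bkm (ω : Matrix n n ℂ) Y * (P t Z : Matrix n n ℂ)).trace
      = (bkm (ω : Matrix n n ℂ) (P t Y : Matrix n n ℂ) * Z).trace := by
  obtain ⟨R, K, ν, h⟩ :=
    (hP.completelyPositive t).exists_isModularKraus hω.fullRank (hω.gnsSymm t)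
  exact h.trace_bkm_mul_map hω.fullRank ω.2 (hω.gnsSymm t) Y Z

theorem bkm_dop_invLogMean {ω : Matrix n n ℂ} (hω : ω.PosDef) (Y : Matrix n n ℂ) :
    bkm ω (dop invLogMean ω ω Y) = Y := by
  rw [bkm, dop_dop, dop_congr (G := fun _ _ => 1), dop_one hω.1 hω.1]
  exact fun a ha b hb => logMean_mul_invLogMean (eigs_pos hω ha) (eigs_pos hω hb)

theorem dop_invLogMean_bkm {ω : Matrix n n ℂ} (hω : ω.PosDef) (Y : Matrix n n ℂ) :
    dop invLogMean ω ω (bkm ω Y) = Y := by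
  rw [bkm, dop_dop, dop_congr (G := fun _ _ => 1), dop_one hω.1 hω.1]
  intro a ha b hb
  rw [mul_comm]
  exact logMean_mul_invLogMean (eigs_pos hω ha) (eigs_pos hω hb)

/-- The squared norm of the inner product `⟨X, Y⟩ = tr (X† J Y)`, where `J` is `bkm ω`. -/
def bkmSq (ω X : Matrix n n ℂ) : ℝ := (Xᴴ * bkm ω X).trace.re

theorem bkmSq_eq_logForm {ω : Matrix n n ℂ} (hω : ω.PosDef) (X : Matrix n n ℂ) :
    bkmSq ω X = logForm 1 ω ω (bkm ω X) := by
  rw [logForm, bkmSq]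
  simp only [one_mul]
  rw [dop_invLogMean_bkm hω, bkm_conjTranspose, trace_bkm_mul]

theorem bkmSq_nonneg {ω : Matrix n n ℂ} (hω : ω.PosDef) (X : Matrix n n ℂ) : 0 ≤ bkmSq ω X := by
  rw [bkmSq_eq_logForm hω]
  exact logForm_nonneg one_pos hω hω _

theorem bkmSq_pos {ω : Matrix n n ℂ} (hω : ω.PosDef) {X : Matrix n n ℂ} (hX : X ≠ 0) :
    0 < bkmSq ω X := by
  rw [bkmSq_eq_logForm hω]
  refine logForm_pos one_pos hω hω fun h => hX ?_
  rw [← dop_invLogMean_bkm hω X, h, map_zero]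

/-- Expanding the powers of σ in spectral projections leaves ∫a^{1-s}b^s ds, the logarithmic mean,
on each block. -/
theorem innerBKM_eq {σ : Matrix n n ℂ} (hσ : σ.PosDef) (X Y : Matrix n n ℂ) :
    innerBKM σ X Y = (Xᴴ * bkm σ Y).trace := by
  have h : ∀ s : ℝ, (Xᴴ * cfc (fun x : ℝ => x ^ (1 - s)) σ * Y * cfc (fun x : ℝ => x ^ s) σ).trace
      = ∑ a ∈ eigs σ, ∑ b ∈ eigs σ, ((a ^ (1 - s) * b ^ s : ℝ) : ℂ) *
        (Xᴴ * (specProj σ a * Y * specProj σ b)).trace := by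
    intro s
    rw [cfc_eq_sum (fun x : ℝ => x ^ (1 - s)), cfc_eq_sum (fun x : ℝ => x ^ s)]
    simp only [Finset.mul_sum, Finset.sum_mul, Matrix.trace_sum, Matrix.mul_smul, Matrix.smul_mul,
      Matrix.trace_smul, smul_eq_mul, Matrix.mul_assoc]
    rw [Finset.sum_comm]
    refine Finset.sum_congr rfl fun a _ => Finset.sum_congr rfl fun b _ => ?_
    push_cast
    ring
  unfold innerBKM
  simp only [h]
  have hc : ∀ a ∈ eigs σ, ∀ b ∈ eigs σ, Continuous (fun s : ℝ =>
      ((a ^ (1 - s) * b ^ s : ℝ) : ℂ) * (Xᴴ * (specProj σ a * Y * specProj σ b)).trace) :=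
    fun a ha b hb => (Complex.continuous_ofReal.comp (continuous_rpow_mul_rpow (eigs_pos hσ ha)
      (eigs_pos hσ hb))).mul continuous_const
  rw [intervalIntegral.integral_finsetSum fun a ha =>
    (continuous_finsetSum _ fun b hb => hc a ha b hb).intervalIntegrable _ _]
  rw [bkm, dop_apply, Finset.mul_sum, Matrix.trace_sum]
  refine Finset.sum_congr rfl fun a ha => ?_
  rw [intervalIntegral.integral_finsetSum fun b hb => (hc a ha b hb).intervalIntegrable _ _, Finset.mul_sum,
    Matrix.trace_sum]
  refine Finset.sum_congr rfl fun b hb => ?_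
  rw [intervalIntegral.integral_mul_const, intervalIntegral.integral_ofReal, Matrix.mul_smul,
    Matrix.trace_smul, smul_eq_mul]
  rfl

theorem SpectralResolution.proj_eq_self (hS : SpectralResolution P S Q) {l : ℝ} {X : N}
    (h : ∀ t : ℝ≥0, P t X = (Real.exp (-l * t) : ℂ) • X) : Q l X = X := by
  have h1 : ∀ m ∈ S, m ≠ l → Q m X = 0 := by
    intro m _ hml
    have h2 := hS.proj_semigroup 1 m X
    rw [h 1, map_smul] at h2
    have h3 : ((Real.exp (-l * (1 : ℝ≥0)) : ℂ) - Real.exp (-m * (1 : ℝ≥0))) • Q m X = 0 := by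
      rw [sub_smul, h2, sub_self]
    refine (smul_eq_zero.1 h3).resolve_left fun h4 => hml ?_
    have h5 : Real.exp (-l * (1 : ℝ≥0)) = Real.exp (-m * (1 : ℝ≥0)) := by
      exact_mod_cast sub_eq_zero.1 h4
    have h6 := Real.exp_injective h5
    simpa using h6.symm
  conv_rhs => rw [← hS.sum_apply X]
  by_cases hl : l ∈ S
  · rw [Finset.sum_eq_single l (fun m hm hml => h1 m hm hml) (fun h' => absurd hl h')]
  · rw [hS.of_notMem l hl, Finset.sum_eq_zero]
    · rfl
    · intro m hm
      exact h1 m hm (by rintro rfl; exact hl hm)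

theorem SpectralResolution.proj_star (hS : SpectralResolution P S Q) (hP : IsQMS P) (l : ℝ)
    (X : N) : Q l (star X) = star (Q l X) := by
  have h1 : ∀ m, Q m (star (Q m X)) = star (Q m X) := by
    intro m
    apply hS.proj_eq_self
    intro t
    rw [hP.map_star, hS.semigroup_proj, star_smul]
    congr 1
    exact Complex.conj_ofReal _
  conv_lhs => rw [← hS.sum_apply X, star_sum, map_sum]
  by_cases hl : l ∈ S
  · rw [Finset.sum_eq_single l]
    · exact h1 l
    · intro m _ hml
      rw [← h1 m, hS.mul_apply, if_neg (Ne.symm hml)]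
    · exact fun h' => absurd hl h'
  · rw [hS.of_notMem l hl]
    simp

/-- Eigenvectors of the BKM-symmetric map P_1 for distinct eigenvalues are orthogonal. Since ω is
any state with detailed balance, the same Q_l are orthogonal for all of them, so one gap works for
every ω. -/
theorem SpectralResolution.trace_bkm_orthogonal (hS : SpectralResolution P S Q) (hP : IsQMS P)
    (hω : IsGNSSymmetric P ω) {l m : ℝ} (hlm : l ≠ m) (X Y : N) :
    (bkm (ω : Matrix n n ℂ) (Q l X : Matrix n n ℂ) * (Q m Y : Matrix n n ℂ)).trace = 0 := by
  have h1 := hω.trace_bkm_mul_map hP 1 (Q l X) (Q m Y)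
  rw [hS.semigroup_proj, hS.semigroup_proj] at h1
  simp only [SetLike.val_smul, map_smul, Matrix.mul_smul, Matrix.smul_mul, Matrix.trace_smul] at h1
  have h3 : ((Real.exp (-m * (1 : ℝ≥0)) : ℂ) - Real.exp (-l * (1 : ℝ≥0))) •
      (bkm (ω : Matrix n n ℂ) (Q l X : Matrix n n ℂ) * (Q m Y : Matrix n n ℂ)).trace = 0 := by
    rw [sub_smul, h1, sub_self]
  refine (smul_eq_zero.1 h3).resolve_left fun h4 => hlm ?_
  have h5 : Real.exp (-m * (1 : ℝ≥0)) = Real.exp (-l * (1 : ℝ≥0)) := by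
    exact_mod_cast sub_eq_zero.1 h4
  have h6 := Real.exp_injective h5
  simpa using h6.symm

theorem SpectralResolution.trace_bkm_proj (hS : SpectralResolution P S Q) (hP : IsQMS P)
    (hω : IsGNSSymmetric P ω) (l : ℝ) (X Y : N) :
    (bkm (ω : Matrix n n ℂ) X * (Q l Y : Matrix n n ℂ)).trace
      = (bkm (ω : Matrix n n ℂ) (Q l X : Matrix n n ℂ) * (Q l Y : Matrix n n ℂ)).trace := by
  by_cases hl : l ∈ S
  · conv_lhs => rw [← hS.sum_apply X]
    push_cast
    rw [map_sum, Finset.sum_mul, Matrix.trace_sum, Finset.sum_eq_single l]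
    · intro m _ hml
      exact hS.trace_bkm_orthogonal hP hω hml X Y
    · exact fun h' => absurd hl h'
  · rw [hS.of_notMem l hl]
    simp

theorem SpectralResolution.trace_bkm_proj_comm (hS : SpectralResolution P S Q) (hP : IsQMS P)
    (hω : IsGNSSymmetric P ω) (l : ℝ) (X Y : N) :
    (bkm (ω : Matrix n n ℂ) X * (Q l Y : Matrix n n ℂ)).trace
      = (bkm (ω : Matrix n n ℂ) (Q l X : Matrix n n ℂ) * Y).trace := by
  rw [hS.trace_bkm_proj hP hω, trace_bkm_mul, Matrix.trace_mul_comm,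
    ← hS.trace_bkm_proj hP hω l Y X, trace_bkm_mul, Matrix.trace_mul_comm]

theorem SpectralResolution.trace_conj_bkm_sum (hS : SpectralResolution P S Q) (hP : IsQMS P)
    (hω : IsGNSSymmetric P ω) (c : ℝ → ℝ) (X : N) :
    ((X : Matrix n n ℂ)ᴴ * bkm (ω : Matrix n n ℂ)
        (∑ l ∈ S, (c l : ℂ) • Q l X : N)).trace.re
      = ∑ l ∈ S, c l * bkmSq (ω : Matrix n n ℂ) (Q l X : Matrix n n ℂ) := by
  push_cast
  rw [map_sum, Finset.mul_sum, Matrix.trace_sum, Complex.re_sum]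
  refine Finset.sum_congr rfl fun l _ => ?_
  rw [map_smul, Matrix.mul_smul, Matrix.trace_smul, smul_eq_mul, Complex.re_ofReal_mul, bkmSq,
    ← trace_bkm_mul, ← trace_bkm_mul]
  have h := hS.trace_bkm_proj hP hω l (star X) X
  rw [hS.proj_star hP] at h
  congr 2

theorem SpectralResolution.proj_sub_proj_zero (hS : SpectralResolution P S Q) (l : ℝ) (X : N) :
    Q l (X - Q 0 X) = if l = 0 then 0 else Q l X := by
  rw [map_sub, hS.mul_apply]
  by_cases h : l = 0
  · rw [if_pos h, if_pos h, sub_self]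
  · rw [if_neg h, if_neg h, sub_zero]

theorem SpectralResolution.bkmSq_sub_proj (hS : SpectralResolution P S Q) (hP : IsQMS P)
    (hω : IsGNSSymmetric P ω) (X : N) :
    bkmSq (ω : Matrix n n ℂ) (X - Q 0 X : N)
      = ∑ l ∈ S, (if l = 0 then 0 else 1) * bkmSq (ω : Matrix n n ℂ) (Q l X : Matrix n n ℂ) := by
  have h := hS.trace_conj_bkm_sum hP hω (fun _ => 1) (X - Q 0 X)
  simp only [Complex.ofReal_one, one_smul, hS.sum_apply, one_mul] at h
  rw [bkmSq, h]
  refine Finset.sum_congr rfl fun l _ => ?_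
  rw [hS.proj_sub_proj_zero]
  by_cases hl : l = 0
  · simp [hl, bkmSq]
  · simp [hl]

/-- `g` bounds the nonzero part of the spectrum from below. -/
def IsGapBound (S : Finset ℝ) (Q : ℝ → N →ₗ[ℂ] N) (g : ℝ) : Prop :=
  ∀ l ∈ S, l ≠ 0 → Q l ≠ 0 → g ≤ l

/-- The spectral theorem for a monotone function of the rates. The identity gives the Poincaré
inequality of the generator, and l ↦ 1 - e^{-lt} gives its version for a finite time step. -/
theorem SpectralResolution.mul_bkmSq_le (hS : SpectralResolution P S Q) (hP : IsQMS P)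
    (hω : IsGNSSymmetric P ω) {g : ℝ} (hg : IsGapBound S Q g) {f : ℝ → ℝ} (hf : Monotone f)
    (hf0 : f 0 = 0) (X : N) :
    f g * bkmSq (ω : Matrix n n ℂ) (X - Q 0 X : N)
      ≤ ((X : Matrix n n ℂ)ᴴ * bkm (ω : Matrix n n ℂ)
        (∑ l ∈ S, (f l : ℂ) • Q l X : N)).trace.re := by
  rw [hS.trace_conj_bkm_sum hP hω, hS.bkmSq_sub_proj hP hω, Finset.mul_sum]
  refine Finset.sum_le_sum fun l hl => ?_
  by_cases hl0 : l = 0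
  · simp [hl0, hf0]
  · rw [if_neg hl0, one_mul]
    by_cases hQ : Q l = 0
    · simp [hQ, bkmSq]
    · exact mul_le_mul_of_nonneg_right (hf (hg l hl hl0 hQ)) (bkmSq_nonneg hω.fullRank _)

theorem IsGapBound.amplify {g : ℝ} (hg : IsGapBound S Q g) (k : ℕ) :
    IsGapBound S (fun l => amplMap (Q l) k) g := fun l hl hl0 hQ =>
  hg l hl hl0 fun h => hQ (by simp only [h, amplMap_zero])

/-- The generator of a semigroup with a spectral resolution. -/
def generator (S : Finset ℝ) (Q : ℝ → N →ₗ[ℂ] N) : N →ₗ[ℂ] N := ∑ l ∈ S, ((-l : ℝ) : ℂ) • Q l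

theorem SpectralResolution.isGenerator (hS : SpectralResolution P S Q) :
    IsGenerator P (generator S Q) := hS.tendsto_generator

theorem neg_generator_apply (X : N) : -(generator S Q X) = ∑ l ∈ S, (l : ℂ) • Q l X := by
  simp only [generator, LinearMap.sum_apply, LinearMap.smul_apply, ← Finset.sum_neg_distrib]
  refine Finset.sum_congr rfl fun l _ => ?_
  push_cast
  rw [neg_smul, neg_neg]

theorem neg_innerBKM_generator (hσ : (σ : Matrix n n ℂ).PosDef) (X : N) :
    -(innerBKM (σ : Matrix n n ℂ) X (generator S Q X)).re
      = ((X : Matrix n n ℂ)ᴴ * bkm (σ : Matrix n n ℂ)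
        (∑ l ∈ S, (l : ℂ) • Q l X : N)).trace.re := by
  rw [← neg_generator_apply, innerBKM_eq hσ]
  simp

/-- The spectral gap is the smallest nonzero eigenvalue of the negative of the generator. -/
theorem SpectralResolution.spectralGap_eq (hS : SpectralResolution P S Q) (hP : IsQMS P)
    (hσ : IsGNSSymmetric P σ) :
    (Q 0 = LinearMap.id ∧ spectralGap (generator S Q) (Q 0) σ = ⊤) ∨
    ∃ g : ℝ, 0 < g ∧ spectralGap (generator S Q) (Q 0) σ = (g : EReal) ∧ IsGapBound S Q g ∧
      Q g ≠ 0 := by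
  classical
  set S' := S.filter fun l => l ≠ 0 ∧ Q l ≠ 0 with hS'
  rcases S'.eq_empty_or_nonempty with he | hne
  · left
    have h1 : ∀ l ∈ S, l ≠ 0 → Q l = 0 := by
      intro l hl hl0
      by_contra h
      have : l ∈ S' := Finset.mem_filter.2 ⟨hl, hl0, h⟩
      rw [he] at this
      simp at this
    have h2 : Q 0 = LinearMap.id := by
      rw [← hS.sum]
      by_cases h0 : (0 : ℝ) ∈ S
      · rw [Finset.sum_eq_single 0 (fun l hl hl0 => h1 l hl hl0) (fun h' => absurd h0 h')]
      · rw [hS.of_notMem 0 h0, Finset.sum_eq_zero]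
        intro l hl
        exact h1 l hl (by rintro rfl; exact h0 hl)
    refine ⟨h2, ?_⟩
    rw [h2]
    simp [spectralGap]
  · right
    have hm := Finset.mem_filter.1 (S'.min'_mem hne)
    set g := S'.min' hne with hg
    have hgb : IsGapBound S Q g := fun l hl hl0 hQ =>
      Finset.min'_le _ _ (Finset.mem_filter.2 ⟨hl, hl0, hQ⟩)
    refine ⟨g, lt_of_le_of_ne (hS.nonneg g hm.1) (Ne.symm hm.2.1), le_antisymm ?_ ?_, hgb, hm.2.2⟩
    -- The infimum is attained at eigenvectors of rate g, which E annihilates.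
    · obtain ⟨X, hX⟩ : ∃ X, Q g X ≠ 0 := by
        by_contra h
        push Not at h
        exact hm.2.2 (LinearMap.ext h)
      have hE : Q 0 (Q g X) = 0 := by rw [hS.mul_apply, if_neg (Ne.symm hm.2.1)]
      refine (iInf₂_le (Q g X) (by rw [hE]; exact hX)).trans (EReal.coe_le_coe_iff.2 (le_of_eq ?_))
      have h1 : ∑ l ∈ S, (l : ℂ) • Q l (Q g X) = (g : ℂ) • Q g X := by
        rw [Finset.sum_eq_single g]
        · rw [hS.mul_apply, if_pos rfl]
        · intro l _ hl
          rw [hS.mul_apply, if_neg hl, smul_zero]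
        · exact fun h => absurd hm.1 h
      have h2 : 0 < bkmSq (σ : Matrix n n ℂ) (Q g X : Matrix n n ℂ) :=
        bkmSq_pos hσ.fullRank fun h => hX (Subtype.ext h)
      rw [neg_innerBKM_generator hσ.fullRank, h1, hE, sub_zero, innerBKM_eq hσ.fullRank]
      rw [SetLike.val_smul, map_smul, Matrix.mul_smul, Matrix.trace_smul, smul_eq_mul,
        Complex.re_ofReal_mul]
      exact mul_div_cancel_right₀ g h2.ne'
    · refine le_iInf₂ fun X hX => EReal.coe_le_coe_iff.2 ?_
      have h2 : 0 < bkmSq (σ : Matrix n n ℂ) (X - Q 0 X : N) :=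
        bkmSq_pos hσ.fullRank fun h => hX (sub_eq_zero.1 (Subtype.ext h))
      rw [neg_innerBKM_generator hσ.fullRank, innerBKM_eq hσ.fullRank]
      exact (le_div_iff₀ h2).2 (hS.mul_bkmSq_le hP hσ hgb (f := fun x => x) monotone_id rfl X)

end SpectralGap

/-! ### Continuity of the relative entropy up to the boundary of the state space. -/

section Continuity

variable {n : Type*} [Fintype n] [DecidableEq n]

open scoped Matrix.Norms.L2Operator in
theorem continuousOn_cfc_matrix {f : ℝ → ℝ} (hf : Continuous f) :
    ContinuousOn (cfc f : Matrix n n ℂ → Matrix n n ℂ) {A | IsSelfAdjoint A} :=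
  ContinuousOn.cfc_of_mem_nhdsSet (s := Set.univ) f (t := {A : Matrix n n ℂ | IsSelfAdjoint A})
    (a := fun A => A) Filter.univ_mem continuousOn_id (fun _ h => h) hf.continuousOn

theorem tendsto_cfc_matrix {ι : Type*} {l : Filter ι} {f : ℝ → ℝ} (hf : Continuous f)
    {A : ι → Matrix n n ℂ} {A₀ : Matrix n n ℂ} (h : Tendsto A l (𝓝 A₀))
    (hA : ∀ᶠ i in l, (A i).IsHermitian) (hA₀ : A₀.IsHermitian) :
    Tendsto (fun i => cfc f (A i)) l (𝓝 (cfc f A₀)) :=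
  (continuousOn_cfc_matrix hf A₀ hA₀).tendsto.comp (tendsto_nhdsWithin_iff.2 ⟨h, hA⟩)

theorem cfc_mul_log {A : Matrix n n ℂ} (hA : A.IsHermitian) :
    cfc (fun x : ℝ => x * Real.log x) A = A * cfc Real.log A := by
  rw [cfc_mul _ _ A (continuousOn_spectrum _ _) (continuousOn_spectrum _ _),
    cfc_id' ℝ A hA.isSelfAdjoint]

theorem cfc_log_mul_self {A : Matrix n n ℂ} (hA : A.IsHermitian) :
    cfc Real.log A * A = A * cfc Real.log A := by
  have := cfc_commute_cfc Real.log id A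
  rw [cfc_id ℝ A hA.isSelfAdjoint] at this
  exact this

theorem tendsto_mul_log {ι : Type*} {l : Filter ι} {A : ι → Matrix n n ℂ} {A₀ : Matrix n n ℂ}
    (h : Tendsto A l (𝓝 A₀)) (hA : ∀ᶠ i in l, (A i).IsHermitian) (hA₀ : A₀.IsHermitian) :
    Tendsto (fun i => A i * cfc Real.log (A i)) l (𝓝 (A₀ * cfc Real.log A₀)) := by
  have h1 := tendsto_cfc_matrix Real.continuous_mul_log h hA hA₀
  rw [cfc_mul_log hA₀] at h1
  exact h1.congr' (hA.mono fun i hi => cfc_mul_log hi)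

theorem continuous_trace_re : Continuous fun A : Matrix n n ℂ => A.trace.re :=
  Complex.continuous_re.comp continuous_id.matrix_trace

theorem tendsto_trace_re {ι : Type*} {l : Filter ι} {A : ι → Matrix n n ℂ} {A₀ : Matrix n n ℂ}
    (h : Tendsto A l (𝓝 A₀)) : Tendsto (fun i => (A i).trace.re) l (𝓝 A₀.trace.re) :=
  (continuous_trace_re.tendsto A₀).comp h

/-- The relative entropy is continuous in its first argument. -/
theorem tendsto_relEnt_left {ι : Type*} {l : Filter ι} {A : ι → Matrix n n ℂ} {A₀ : Matrix n n ℂ}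
    (τ : Matrix n n ℂ) (h : Tendsto A l (𝓝 A₀)) (hA : ∀ᶠ i in l, (A i).IsHermitian)
    (hA₀ : A₀.IsHermitian) : Tendsto (fun i => relEnt (A i) τ) l (𝓝 (relEnt A₀ τ)) := by
  refine tendsto_trace_re ((tendsto_mul_log h hA hA₀).sub ?_)
  exact ((continuous_id.matrix_mul continuous_const).tendsto A₀).comp h

theorem le_of_mem_eigs {A : Matrix n n ℂ} (hA : A.IsHermitian) {δ x : ℝ}
    (h : (A - (δ : ℂ) • (1 : Matrix n n ℂ)).PosSemidef) (hx : x ∈ eigs A) : δ ≤ x := by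
  have e : A - (δ : ℂ) • (1 : Matrix n n ℂ) = cfc (fun x : ℝ => x - δ) A := by
    rw [cfc_sub _ _ A (continuousOn_spectrum _ _) (continuousOn_spectrum _ _),
      cfc_id' ℝ A hA.isSelfAdjoint, cfc_const δ A hA.isSelfAdjoint]
    congr 1
    ext i j
    simp [Matrix.algebraMap_matrix_apply, Matrix.one_apply]
  rw [e] at h
  refine sub_nonneg.1 (eigs_nonneg h (mem_eigs.2 ?_))
  rw [cfc_map_spectrum (R := ℝ) (fun x : ℝ => x - δ) A hA.isSelfAdjoint (continuousOn_spectrum _ _)]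
  exact ⟨x, mem_eigs.1 hx, rfl⟩

theorem mem_eigs_le {A : Matrix n n ℂ} (hA : A.IsHermitian) {C x : ℝ}
    (h : ((C : ℂ) • (1 : Matrix n n ℂ) - A).PosSemidef) (hx : x ∈ eigs A) : x ≤ C := by
  have e : (C : ℂ) • (1 : Matrix n n ℂ) - A = cfc (fun x : ℝ => C - x) A := by
    rw [cfc_sub _ _ A (continuousOn_spectrum _ _) (continuousOn_spectrum _ _),
      cfc_id' ℝ A hA.isSelfAdjoint, cfc_const C A hA.isSelfAdjoint]
    congr 1
    ext i j
    simp [Matrix.algebraMap_matrix_apply, Matrix.one_apply]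
  rw [e] at h
  refine sub_nonneg.1 (eigs_nonneg h (mem_eigs.2 ?_))
  rw [cfc_map_spectrum (R := ℝ) (fun x : ℝ => C - x) A hA.isSelfAdjoint (continuousOn_spectrum _ _)]
  exact ⟨x, mem_eigs.1 hx, rfl⟩

/-- The segment from `ρ` to `σ`. -/
def mix (ρ σ : Matrix n n ℂ) (ε : ℝ) : Matrix n n ℂ := ((1 - ε : ℝ) : ℂ) • ρ + (ε : ℂ) • σ

theorem tendsto_mix (ρ σ : Matrix n n ℂ) : Tendsto (mix ρ σ) (𝓝[>] 0) (𝓝 ρ) := by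
  have hc : Continuous (mix ρ σ) := by
    unfold mix
    fun_prop
  have := (hc.tendsto 0).mono_left (nhdsWithin_le_nhds (s := Set.Ioi 0))
  simpa [mix] using this

theorem mix_posDef {ρ σ : Matrix n n ℂ} (hρ : ρ.PosSemidef) (hσ : σ.PosDef) {ε : ℝ} (h0 : 0 < ε)
    (h1 : ε ≤ 1) : (mix ρ σ ε).PosDef :=
  Matrix.PosDef.posSemidef_add (PosSemidef.smul_real hρ (sub_nonneg.2 h1))
    (PosDef.smul_real hσ h0)

theorem eventually_mem_Ioc : ∀ᶠ ε : ℝ in 𝓝[>] 0, 0 < ε ∧ ε ≤ 1 := by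
  filter_upwards [Ioc_mem_nhdsGT (zero_lt_one (α := ℝ))] with ε hε using hε

open scoped Matrix.Norms.L2Operator in
-- With δ ≤ σ and ω + σ ≤ C, the eigenvalues of the mixture lie in [εδ, C]. The logarithm is then
-- O(|log ε| + 1), which the factor ε beats.
theorem tendsto_smul_log_mix {ω σ : Matrix n n ℂ} (hω : ω.PosSemidef) (hσ : σ.PosDef) :
    Tendsto (fun ε : ℝ => (ε : ℂ) • cfc Real.log (mix ω σ ε)) (𝓝[>] 0) (𝓝 0) := by
  obtain ⟨δ, hδ, h1⟩ := exists_smul_one_le hσ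
  obtain ⟨C, hC, h2⟩ := exists_le_smul_one (hω.1.add hσ.1)
  have hlim : Tendsto (fun ε : ℝ => |ε * Real.log ε| + ε * (|Real.log δ| + |Real.log C|))
      (𝓝[>] 0) (𝓝 0) := by
    have hc : Continuous fun ε : ℝ => |ε * Real.log ε| + ε * (|Real.log δ| + |Real.log C|) :=
      (Real.continuous_mul_log.abs).add (by fun_prop)
    have := (hc.tendsto 0).mono_left (nhdsWithin_le_nhds (s := Set.Ioi 0))
    simpa using this
  refine squeeze_zero_norm' ?_ hlim
  filter_upwards [eventually_mem_Ioc] with ε hε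
  obtain ⟨h0, hε1⟩ := hε
  have hH := (mix_posDef hω hσ h0 hε1).1
  have e : (ε : ℂ) • cfc Real.log (mix ω σ ε) = cfc (fun x => ε * Real.log x) (mix ω σ ε) := by
    rw [cfc_const_mul _ _ _ (continuousOn_spectrum _ _)]
    rfl
  rw [e]
  refine norm_cfc_le (by positivity) fun x hx => ?_
  have hxl : ε * δ ≤ x := by
    refine le_of_mem_eigs hH ?_ (mem_eigs.2 hx)
    have e2 : mix ω σ ε - ((ε * δ : ℝ) : ℂ) • (1 : Matrix n n ℂ)
        = ((1 - ε : ℝ) : ℂ) • ω + (ε : ℂ) • (σ - (δ : ℂ) • (1 : Matrix n n ℂ)) := by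
      rw [mix]
      push_cast
      module
    rw [e2]
    exact (PosSemidef.smul_real hω (by linarith)).add (PosSemidef.smul_real h1 h0.le)
  have hxu : x ≤ C := by
    refine mem_eigs_le hH ?_ (mem_eigs.2 hx)
    have e2 : (C : ℂ) • (1 : Matrix n n ℂ) - mix ω σ ε
        = ((C : ℂ) • (1 : Matrix n n ℂ) - (ω + σ)) + ((ε : ℂ) • ω + ((1 - ε : ℝ) : ℂ) • σ) := by
      rw [mix]
      push_cast
      module
    rw [e2]
    exact h2.add ((PosSemidef.smul_real hω h0.le).add
      (PosSemidef.smul_real hσ.posSemidef (by linarith)))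
  have hεδ : 0 < ε * δ := by positivity
  have hx0 : 0 < x := hεδ.trans_le hxl
  have l1 : Real.log ε + Real.log δ ≤ Real.log x := by
    rw [← Real.log_mul h0.ne' hδ.ne']
    exact Real.log_le_log hεδ hxl
  have l2 : Real.log x ≤ Real.log C := Real.log_le_log hx0 hxu
  have l3 : |Real.log x| ≤ |Real.log ε| + (|Real.log δ| + |Real.log C|) := by
    rw [abs_le]
    constructor
    · linarith [neg_abs_le (Real.log ε), neg_abs_le (Real.log δ), abs_nonneg (Real.log C)]
    · linarith [le_abs_self (Real.log C), abs_nonneg (Real.log ε), abs_nonneg (Real.log δ)]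
  rw [Real.norm_eq_abs, abs_mul, abs_of_pos h0]
  calc ε * |Real.log x| ≤ ε * (|Real.log ε| + (|Real.log δ| + |Real.log C|)) :=
        mul_le_mul_of_nonneg_left l3 h0.le
    _ = _ := by rw [abs_mul, abs_of_pos h0]; ring

theorem mulVec_eq_zero_of_le {ρ ω : Matrix n n ℂ} (hρ : ρ.PosSemidef) {c : ℝ}
    (h : ((c : ℂ) • ω - ρ).PosSemidef) {v : n → ℂ} (hv : ω *ᵥ v = 0) : ρ *ᵥ v = 0 := by
  have h1 := h.dotProduct_mulVec_nonneg v
  rw [Matrix.sub_mulVec, Matrix.smul_mulVec, hv, smul_zero, zero_sub, dotProduct_neg] at h1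
  have h2 := hρ.dotProduct_mulVec_nonneg v
  exact (hρ.dotProduct_mulVec_zero_iff v).1 (le_antisymm (neg_nonneg.1 h1) h2)

/-- Domination gives ker ω ⊆ ker ρ, so Z can be taken as the pseudo-inverse of ω times ρ. -/
theorem exists_eq_mul_of_le {ρ ω : Matrix n n ℂ} (hρ : ρ.PosSemidef) (hω : ω.IsHermitian) {c : ℝ}
    (h : ((c : ℂ) • ω - ρ).PosSemidef) : ∃ Z : Matrix n n ℂ, ρ = ω * Z := by
  refine ⟨cfc (fun x : ℝ => x⁻¹) ω * ρ, ?_⟩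
  have h1 : ω * cfc (fun x : ℝ => x⁻¹) ω = 1 - specProj ω 0 := by
    have e : ω * cfc (fun x : ℝ => x⁻¹) ω = cfc (fun x : ℝ => x * x⁻¹) ω := by
      rw [cfc_mul _ _ ω (continuousOn_spectrum _ _) (continuousOn_spectrum _ _),
        cfc_id' ℝ ω hω.isSelfAdjoint]
    have e2 : (1 : Matrix n n ℂ) - specProj ω 0
        = cfc (fun x : ℝ => 1 - if x = 0 then 1 else 0) ω := by
      rw [cfc_sub _ _ ω (continuousOn_spectrum _ _) (continuousOn_spectrum _ _),
        cfc_const_one ℝ ω hω.isSelfAdjoint, specProj]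
    rw [e, e2]
    congr 1
    funext x
    by_cases hx : x = 0
    · simp [hx]
    · simp [hx]
  have h2 : ρ * specProj ω 0 = 0 := by
    apply Matrix.ext_of_mulVec_single
    intro i
    rw [← Matrix.mulVec_mulVec, Matrix.zero_mulVec]
    refine mulVec_eq_zero_of_le hρ h ?_
    rw [Matrix.mulVec_mulVec, mul_specProj hω, Complex.ofReal_zero, zero_smul, Matrix.zero_mulVec]
  have h3 : specProj ω 0 * ρ = 0 := by
    have := congrArg Matrix.conjTranspose h2
    rwa [Matrix.conjTranspose_mul, specProj_conjTranspose, hρ.1.eq, Matrix.conjTranspose_zero]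
      at this
  rw [← Matrix.mul_assoc, h1, Matrix.sub_mul, Matrix.one_mul, h3, sub_zero]

/-- The relative entropy is continuous along segments towards a faithful state when the first
state is dominated by the second. -/
theorem tendsto_relEnt_mix {ρ ω σ : Matrix n n ℂ} (hρ : ρ.PosSemidef) (hω : ω.PosSemidef)
    (hσ : σ.PosDef) {c : ℝ} (h : ((c : ℂ) • ω - ρ).PosSemidef) :
    Tendsto (fun ε => relEnt (mix ρ σ ε) (mix ω σ ε)) (𝓝[>] 0) (𝓝 (relEnt ρ ω)) := by
  obtain ⟨Z, hZ⟩ := exists_eq_mul_of_le hρ hω.1 h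
  have hH : ∀ {τ : Matrix n n ℂ}, τ.PosSemidef → ∀ᶠ ε : ℝ in 𝓝[>] 0, (mix τ σ ε).IsHermitian :=
    fun hτ => eventually_mem_Ioc.mono fun ε hε => (mix_posDef hτ hσ hε.1 hε.2).1
  have h1 := tendsto_trace_re (tendsto_mul_log (tendsto_mix ρ σ) (hH hρ) hρ.1)
  -- The logarithm of the second argument may blow up. Writing ρ_ε = ω_ε Z + εσ(1 - Z), it occurs
  -- only in ω_ε log ω_ε, which converges, and in ε log ω_ε, which vanishes.
  have h2 : Tendsto (fun ε => (mix ρ σ ε * cfc Real.log (mix ω σ ε)).trace.re) (𝓝[>] 0)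
      (𝓝 (ρ * cfc Real.log ω).trace.re) := by
    have h3 := tendsto_mul_log (tendsto_mix ω σ) (hH hω) hω.1
    have h4 := tendsto_trace_re
      (((continuous_id.matrix_mul (continuous_const (y := Z))).tendsto _).comp h3)
    have h5 := tendsto_trace_re
      (((continuous_id.matrix_mul (continuous_const (y := σ * (1 - Z)))).tendsto _).comp
        (tendsto_smul_log_mix hω hσ))
    have h6 := h4.add h5
    simp only [Function.comp_def, id_eq, Matrix.zero_mul, Matrix.trace_zero, Complex.zero_re,
      add_zero] at h6
    have e0 : (ω * cfc Real.log ω * Z).trace.re = (ρ * cfc Real.log ω).trace.re := by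
      rw [← cfc_log_mul_self hω.1, Matrix.mul_assoc, ← hZ, Matrix.trace_mul_comm]
    rw [e0] at h6
    refine h6.congr' ?_
    filter_upwards [hH hω] with ε hε
    rw [← cfc_log_mul_self hε, ← Complex.add_re, ← Matrix.trace_add, Matrix.trace_mul_comm (mix ρ σ ε)]
    congr 2
    have e1 : mix ρ σ ε = mix ω σ ε * Z + (ε : ℂ) • (σ * (1 - Z)) := by
      rw [mix, mix, Matrix.add_mul, Matrix.smul_mul, Matrix.smul_mul, ← hZ, Matrix.mul_sub,
        Matrix.mul_one]
      module
    rw [e1, Matrix.mul_add, Matrix.mul_assoc, Matrix.mul_smul, Matrix.smul_mul]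
  have h7 := h1.sub h2
  simp only [← Complex.sub_re, ← Matrix.trace_sub] at h7
  exact h7

end Continuity

/-! ### Exponential decay from short-time contraction. -/

theorem tendsto_mul_one_sub_exp (g : ℝ) :
    Tendsto (fun k : ℕ => (k : ℝ) * (1 - Real.exp (-g / k))) atTop (𝓝 g) := by
  have hd : HasDerivAt (fun x : ℝ => Real.exp (-g * x)) (-g) 0 := by
    have := ((hasDerivAt_id (0 : ℝ)).const_mul (-g)).exp
    simpa using this
  have hs := hd.tendsto_slope_zero_right
  simp only [zero_add, mul_zero, Real.exp_zero, smul_eq_mul] at hs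
  have h1 : Tendsto (fun k : ℕ => (k : ℝ)⁻¹) atTop (𝓝[>] 0) := by
    refine tendsto_nhdsWithin_iff.2 ⟨tendsto_inv_atTop_nhds_zero_nat, ?_⟩
    filter_upwards [eventually_gt_atTop 0] with k hk
    exact Set.mem_Ioi.2 (inv_pos.2 (Nat.cast_pos.2 hk))
  have h2 := (hs.comp h1).neg
  rw [neg_neg] at h2
  refine h2.congr fun k => ?_
  simp only [Function.comp_def, inv_inv]
  rw [div_eq_mul_inv]
  ring

/-- A function on the half line that contracts up to a quadratic error decays exponentially. -/
theorem le_exp_mul_of_le_add_sq {f : ℝ≥0 → ℝ} (hf : ∀ s, 0 ≤ f s) {c g C : ℝ} (hc : 1 ≤ c)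
    (hg : 0 ≤ g)
    (h : ∀ s u : ℝ≥0, f (s + u) ≤ (1 - c⁻¹ * (1 - Real.exp (-g * u))) * f s + C * (u : ℝ) ^ 2)
    (t : ℝ≥0) : f t ≤ Real.exp (-(g / c) * t) * f 0 := by
  have hc0 : 0 < c := by linarith
  -- With k steps of length t/k, the quadratic errors add up to at most |C|t²/k.
  have hbound : ∀ k : ℕ, 0 < k →
      f t ≤ Real.exp (-(c⁻¹ * (k * (1 - Real.exp (-(g * t) / k))))) * f 0
        + |C| * (t : ℝ) ^ 2 * (k : ℝ)⁻¹ := by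
    intro k hk
    have hk' : (0 : ℝ) < k := Nat.cast_pos.2 hk
    set u : ℝ≥0 := t / k with hu
    have huc : (u : ℝ) = t / k := by simp [hu]
    set q : ℝ := 1 - c⁻¹ * (1 - Real.exp (-g * u)) with hq
    have he1 : Real.exp (-g * u) ≤ 1 :=
      Real.exp_le_one_iff.2 (by nlinarith [u.coe_nonneg])
    have hci : c⁻¹ ≤ 1 := inv_le_one_of_one_le₀ hc
    have hci0 : 0 < c⁻¹ := inv_pos.2 hc0
    -- Here c ≥ 1 is needed: the contraction factor must be nonnegative to be iterated.
    have hq0 : 0 ≤ q := by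
      have := mul_le_mul hci (sub_le_self 1 (Real.exp_pos (-g * u)).le) (by linarith) zero_le_one
      rw [hq]
      linarith
    have hq1 : q ≤ 1 := by
      have := mul_nonneg hci0.le (sub_nonneg.2 he1)
      rw [hq]
      linarith
    have hind : ∀ j : ℕ, f (j * u) ≤ q ^ j * f 0 + j * (|C| * (u : ℝ) ^ 2) := by
      intro j
      induction j with
      | zero => simp
      | succ j ih =>
        have h1 := h (j * u) u
        have e : ((j + 1 : ℕ) : ℝ≥0) * u = j * u + u := by push_cast; ring
        rw [e]
        calc f (j * u + u) ≤ q * f (j * u) + C * (u : ℝ) ^ 2 := h1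
          _ ≤ q * (q ^ j * f 0 + j * (|C| * (u : ℝ) ^ 2)) + |C| * (u : ℝ) ^ 2 := by
              gcongr
              exact le_abs_self C
          _ = q ^ (j + 1) * f 0 + q * (j * (|C| * (u : ℝ) ^ 2)) + |C| * (u : ℝ) ^ 2 := by ring
          _ ≤ q ^ (j + 1) * f 0 + 1 * (j * (|C| * (u : ℝ) ^ 2)) + |C| * (u : ℝ) ^ 2 := by
              gcongr
          _ = _ := by push_cast; ring
    have h2 := hind k
    have e1 : (k : ℝ≥0) * u = t := by
      rw [hu]
      exact mul_div_cancel₀ t (Nat.cast_ne_zero.2 hk.ne')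
    rw [e1] at h2
    refine h2.trans (add_le_add (mul_le_mul_of_nonneg_right ?_ (hf 0)) (le_of_eq ?_))
    · have h3 : q ≤ Real.exp (-(c⁻¹ * (1 - Real.exp (-g * u)))) := by
        have := Real.add_one_le_exp (-(c⁻¹ * (1 - Real.exp (-g * u))))
        rw [hq]
        linarith
      refine (pow_le_pow_left₀ hq0 h3 k).trans (le_of_eq ?_)
      rw [← Real.exp_nat_mul]
      congr 1
      rw [huc, show -g * ((t : ℝ) / k) = -(g * t) / k by ring]
      ring
    · rw [huc]
      field_simp
  have hlim : Tendsto (fun k : ℕ => Real.exp (-(c⁻¹ * (k * (1 - Real.exp (-(g * t) / k))))) * f 0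
      + |C| * (t : ℝ) ^ 2 * (k : ℝ)⁻¹) atTop (𝓝 (Real.exp (-(c⁻¹ * (g * t))) * f 0
      + |C| * (t : ℝ) ^ 2 * 0)) := by
    refine Tendsto.add (Tendsto.mul_const _ ?_) (tendsto_inv_atTop_nhds_zero_nat.const_mul _)
    exact (Real.continuous_exp.tendsto _).comp ((tendsto_mul_one_sub_exp (g * t)).const_mul _).neg
  have h3 := ge_of_tendsto hlim ((eventually_gt_atTop 0).mono hbound)
  rw [mul_zero, add_zero] at h3
  refine h3.trans (le_of_eq ?_)
  congr 2
  rw [div_eq_mul_inv]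
  ring

/-! ### Exponential decay of the entropy at rate g/c. -/

section EntropyDecay

variable {n : Type*} [Fintype n] [DecidableEq n] {N : StarSubalgebra ℂ (Matrix n n ℂ)}
  {P : ℝ≥0 → N →ₗ[ℂ] N} {σ ω ρ X : N} {S : Finset ℝ} {Q : ℝ → N →ₗ[ℂ] N}

/-- BKM symmetry read on states: J_ω intertwines the Heisenberg and Schrödinger evolutions. -/
theorem IsGNSSymmetric.preadjoint_bkm (hω : IsGNSSymmetric P ω) (hP : IsQMS P) {t : ℝ≥0}
    (hρ : (ρ : Matrix n n ℂ) = bkm (ω : Matrix n n ℂ) X) :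
    (preadjoint (P t) ρ : Matrix n n ℂ) = bkm (ω : Matrix n n ℂ) (P t X : Matrix n n ℂ) := by
  apply eq_of_trace_mul_eq (preadjoint (P t) ρ).2 (bkm_mem ω.2 (P t X).2)
  intro Z hZ
  have h1 := trace_preadjoint_mul (P t) ρ ⟨Z, hZ⟩
  have h2 := hω.trace_bkm_mul_map hP t X ⟨Z, hZ⟩
  rw [hρ] at h1
  exact h1.trans h2

theorem SpectralResolution.preadjoint_proj_bkm (hS : SpectralResolution P S Q) (hP : IsQMS P)
    (hω : IsGNSSymmetric P ω) (hρ : (ρ : Matrix n n ℂ) = bkm (ω : Matrix n n ℂ) X) (l : ℝ) :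
    (preadjoint (Q l) ρ : Matrix n n ℂ) = bkm (ω : Matrix n n ℂ) (Q l X : Matrix n n ℂ) := by
  apply eq_of_trace_mul_eq (preadjoint (Q l) ρ).2 (bkm_mem ω.2 (Q l X).2)
  intro Z hZ
  have h1 := trace_preadjoint_mul (Q l) ρ ⟨Z, hZ⟩
  have h2 := hS.trace_bkm_proj_comm hP hω l X ⟨Z, hZ⟩
  rw [hρ] at h1
  exact h1.trans h2

/-- The entropy production bound in integrated form. -/
theorem SpectralResolution.mul_logForm_le (hS : SpectralResolution P S Q) (hP : IsQMS P)
    (hω : IsGNSSymmetric P ω) {g : ℝ} (hg : IsGapBound S Q g)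
    (hρ : (ρ : Matrix n n ℂ).PosDef) (hρω : preadjoint (Q 0) ρ = ω) {c : ℝ} (hc : 0 < c)
    (hle : ((c : ℂ) • (ω : Matrix n n ℂ) - ρ).PosSemidef) (t : ℝ≥0) :
    (1 - Real.exp (-g * t)) * logForm 1 (ω : Matrix n n ℂ) ω (ρ - ω)
      ≤ c * ((ρ - preadjoint (P t) ρ : Matrix n n ℂ) *
        (cfc Real.log (ρ : Matrix n n ℂ) - cfc Real.log (ω : Matrix n n ℂ))).trace.re := by
  -- X = J_ω⁻¹(ρ), so that J_ω(X - E X) = ρ - ω and the BKM variance of X at ω is χ²(ρ, ω).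
  set X : N := ⟨dop invLogMean (ω : Matrix n n ℂ) ω ρ, dop_mem ω.2 ω.2 ρ.2 _⟩ with hX
  have hρX : (ρ : Matrix n n ℂ) = bkm (ω : Matrix n n ℂ) X := (bkm_dop_invLogMean hω.fullRank _).symm
  set G : N := ⟨cfc Real.log (ρ : Matrix n n ℂ) - cfc Real.log (ω : Matrix n n ℂ),
    sub_mem (cfc_mem ρ.2 _) (cfc_mem ω.2 _)⟩ with hG
  obtain ⟨R, K, ν, hK⟩ :=
    (hP.completelyPositive t).exists_isModularKraus hω.fullRank (hω.gnsSymm t)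
  have h1 := hK.dirichlet_le hω.fullRank ω.2 (hω.gnsSymm t) (hP.unital t) hρ hρX hc hle
    (G := G) rfl
  have e1 : (ρ * G - ρ * P t G : Matrix n n ℂ).trace
      = ((ρ - preadjoint (P t) ρ : Matrix n n ℂ) * G).trace := by
    rw [Matrix.sub_mul, Matrix.trace_sub, Matrix.trace_sub, trace_preadjoint_mul]
  rw [e1] at h1
  refine le_trans ?_ h1
  have hf : Monotone fun l : ℝ => 1 - Real.exp (-l * t) := by
    intro a b hab
    have : -b * (t : ℝ) ≤ -a * t := by nlinarith [t.coe_nonneg]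
    have := Real.exp_le_exp.2 this
    simp only
    linarith
  have h2 := hS.mul_bkmSq_le hP hω hg hf (by simp) X
  have e2 : (∑ l ∈ S, ((1 - Real.exp (-l * t) : ℝ) : ℂ) • Q l X : N) = X - P t X := by
    have h3 := hS.sum_apply X
    rw [hS.apply_apply]
    nth_rw 2 [← h3]
    rw [← Finset.sum_sub_distrib]
    refine Finset.sum_congr rfl fun l _ => ?_
    push_cast
    rw [sub_smul, one_smul]
  rw [e2] at h2
  have e3 : bkmSq (ω : Matrix n n ℂ) (X - Q 0 X : N)
      = logForm 1 (ω : Matrix n n ℂ) ω (ρ - ω) := by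
    rw [bkmSq_eq_logForm hω.fullRank, AddSubgroupClass.coe_sub, map_sub, ← hρX,
      ← hS.preadjoint_proj_bkm hP hω hρX, hρω]
  rw [e3] at h2
  refine h2.trans (le_of_eq ?_)
  have hXH : (X : Matrix n n ℂ)ᴴ = X := by
    rw [← dop_invLogMean_bkm hω.fullRank (X : Matrix n n ℂ)ᴴ, ← bkm_conjTranspose, ← hρX, hρ.1.eq]
  rw [hXH, ← trace_bkm_mul, ← hρX, AddSubgroupClass.coe_sub, Matrix.mul_sub]

theorem SpectralResolution.bkmSq_eq_sum (hS : SpectralResolution P S Q) (hP : IsQMS P)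
    (hω : IsGNSSymmetric P ω) (X : N) :
    bkmSq (ω : Matrix n n ℂ) X = ∑ l ∈ S, bkmSq (ω : Matrix n n ℂ) (Q l X : Matrix n n ℂ) := by
  have h := hS.trace_conj_bkm_sum hP hω (fun _ => 1) X
  simp only [Complex.ofReal_one, one_smul, hS.sum_apply, one_mul] at h
  exact h

theorem bkmSq_smul (ω X : Matrix n n ℂ) (a : ℝ) : bkmSq ω ((a : ℂ) • X) = a ^ 2 * bkmSq ω X := by
  simp only [bkmSq, map_smul, Matrix.conjTranspose_smul, Matrix.smul_mul, Matrix.mul_smul,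
    Matrix.trace_smul, smul_eq_mul, Complex.star_def, Complex.conj_ofReal, Complex.re_ofReal_mul]
  ring

/-- The mode of rate l moves by e^{-ls}(1 - e^{-lu}) ≤ lu. The bound is quadratic in u uniformly in
s, which controls the discretisation error. -/
theorem SpectralResolution.exists_bkmSq_sub_le (hS : SpectralResolution P S Q) (hP : IsQMS P)
    (hω : IsGNSSymmetric P ω) (X : N) :
    ∃ C : ℝ, ∀ s u : ℝ≥0, bkmSq (ω : Matrix n n ℂ) (P s X - P (s + u) X : N) ≤ C * (u : ℝ) ^ 2 := by
  refine ⟨∑ l ∈ S, l ^ 2 * bkmSq (ω : Matrix n n ℂ) (Q l X : Matrix n n ℂ), fun s u => ?_⟩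
  rw [hS.bkmSq_eq_sum hP hω, Finset.sum_mul]
  refine Finset.sum_le_sum fun l hl => ?_
  have e : Q l (P s X - P (s + u) X)
      = ((Real.exp (-l * s) * (1 - Real.exp (-l * u)) : ℝ) : ℂ) • Q l X := by
    rw [map_sub, hS.proj_semigroup, hS.proj_semigroup, ← sub_smul]
    congr 1
    have : -l * ((s + u : ℝ≥0) : ℝ) = -l * s + -l * u := by push_cast; ring
    rw [this, Real.exp_add]
    push_cast
    ring
  rw [e, SetLike.val_smul, bkmSq_smul]
  have hl0 := hS.nonneg l hl
  have h1 : Real.exp (-l * s) ≤ 1 := Real.exp_le_one_iff.2 (by nlinarith [s.coe_nonneg])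
  have h2 : Real.exp (-l * u) ≤ 1 := Real.exp_le_one_iff.2 (by nlinarith [u.coe_nonneg])
  have h3 : 1 - Real.exp (-l * u) ≤ l * u := by
    have := Real.add_one_le_exp (-l * (u : ℝ))
    linarith
  have h4 : Real.exp (-l * s) * (1 - Real.exp (-l * u)) ≤ l * u := by
    have := mul_le_mul h1 h3 (by linarith) zero_le_one
    linarith
  have h5 : 0 ≤ Real.exp (-l * s) * (1 - Real.exp (-l * u)) :=
    mul_nonneg (Real.exp_pos _).le (by linarith)
  have h6 := pow_le_pow_left₀ h5 h4 2
  have h7 := mul_le_mul_of_nonneg_right h6 (bkmSq_nonneg hω.fullRank (Q l X : Matrix n n ℂ))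
  refine h7.trans (le_of_eq ?_)
  ring

theorem preadjoint_sub_smul_posSemidef {Φ : N →ₗ[ℂ] N} (hΦ : IsCompletelyPositive Φ)
    (hω : preadjoint Φ ω = ω) {δ : ℝ}
    (h : ((ρ : Matrix n n ℂ) - (δ : ℂ) • (ω : Matrix n n ℂ)).PosSemidef) :
    ((preadjoint Φ ρ : Matrix n n ℂ) - (δ : ℂ) • (ω : Matrix n n ℂ)).PosSemidef := by
  have h1 := hΦ.preadjoint_posSemidef (X := ρ - (δ : ℂ) • ω) h
  rw [map_sub, map_smul, hω] at h1
  exact h1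

/-- The entropy decay for faithful states. -/
theorem SpectralResolution.relEnt_decay_of_posDef (hS : SpectralResolution P S Q) (hP : IsQMS P)
    (hσ : IsGNSSymmetric P σ) {g : ℝ} (hg : IsGapBound S Q g) (hg0 : 0 ≤ g) {c : ℝ} (hc : 1 ≤ c)
    (hcE : IndexLE (Q 0) c) (hρ : IsState ρ) (hρp : (ρ : Matrix n n ℂ).PosDef) (t : ℝ≥0) :
    relEnt (preadjoint (P t) ρ : Matrix n n ℂ) (preadjoint (Q 0) ρ)
      ≤ Real.exp (-(g / c) * t) * relEnt (ρ : Matrix n n ℂ) (preadjoint (Q 0) ρ) := by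
  have hω := hS.isGNSSymmetric_preadjoint hP hσ hρ hρp
  set ω := preadjoint (Q 0) ρ with hωdef
  set r : ℝ≥0 → N := fun s => preadjoint (P s) ρ with hr
  have hst : ∀ s, IsState (r s) := fun s =>
    isState_preadjoint (hP.completelyPositive s) (hP.unital s) hρ
  have hpd : ∀ s, (r s : Matrix n n ℂ).PosDef := fun s =>
    preadjoint_posDef (hP.completelyPositive s) hσ.fullRank (hσ.preadjoint_semigroup s) hρp
  have hrE : ∀ s, preadjoint (Q 0) (r s) = ω := fun s => hS.preadjoint_semigroup_proj s ρ
  have hradd : ∀ s u, preadjoint (P u) (r s) = r (s + u) := by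
    intro s u
    simp only [hr]
    rw [← preadjoint_comp, hP.add]
  have htr : ∀ s, (r s : Matrix n n ℂ).trace = (ω : Matrix n n ℂ).trace := fun s => by
    rw [(hst s).2, hω.isState.2]
  -- The bound ρ ≥ δω persists along the orbit, so logarithmic forms at orbit points are at most δ⁻¹
  -- times the form at ω.
  obtain ⟨δ, hδ, hδ'⟩ := exists_smul_le hρp hω.fullRank.1
  have hδs : ∀ s, ((r s : Matrix n n ℂ) - (δ : ℂ) • (ω : Matrix n n ℂ)).PosSemidef := fun s =>
    preadjoint_sub_smul_posSemidef (hP.completelyPositive s) (hω.preadjoint_semigroup s)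
      (hδ' δ hδ.le le_rfl).posSemidef
  have hδi : ∀ s, (((δ⁻¹ : ℝ) : ℂ) • (r s : Matrix n n ℂ) - (ω : Matrix n n ℂ)).PosSemidef := by
    intro s
    have h := PosSemidef.smul_real (hδs s) (inv_pos.2 hδ).le
    rw [smul_sub, smul_smul, ← Complex.ofReal_mul, inv_mul_cancel₀ hδ.ne', Complex.ofReal_one,
      one_smul] at h
    exact h
  set X : N := ⟨dop invLogMean (ω : Matrix n n ℂ) ω ρ, dop_mem ω.2 ω.2 ρ.2 _⟩ with hX
  have hρX : (ρ : Matrix n n ℂ) = bkm (ω : Matrix n n ℂ) X := (bkm_dop_invLogMean hω.fullRank _).symm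
  have hrX : ∀ s, (r s : Matrix n n ℂ) = bkm (ω : Matrix n n ℂ) (P s X : Matrix n n ℂ) := fun s =>
    hω.preadjoint_bkm hP hρX
  obtain ⟨C, hC⟩ := hS.exists_bkmSq_sub_le hP hω X
  have hc0 : 0 < c := by linarith
  have key := le_exp_mul_of_le_add_sq (f := fun s => relEnt (r s : Matrix n n ℂ) ω)
    (fun s => relEnt_nonneg (hpd s).posSemidef hω.fullRank (htr s)) hc hg0 (C := δ⁻¹ * C) (by
      intro s u
      -- The tangent inequality at r(s+u) bounds the change of entropy by -T plus a remainder, where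
      -- T uses the logarithm at r(s). The gap and the χ² bound give T ≥ c⁻¹(1 - e^{-gu})D, and the
      -- remainder is at most δ⁻¹Cu².
      have a1 := relEnt_sub_relEnt_le (ω : Matrix n n ℂ) (hpd (s + u)) (hpd s).posSemidef
        ((htr _).trans (htr s).symm)
      have a2 := hS.mul_logForm_le hP hω hg (hpd s) (hrE s) hc0
        (by rw [← hrE s]; exact hcE (r s) (hst s)) u
      rw [hradd] at a2
      have a3 := relEnt_le_logForm (hpd s) hω.fullRank (htr s)
      have a4 := trace_sub_mul_log_sub (hpd s) (hpd (s + u))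
      have a5 := logForm_le (c := 1) one_pos hω.fullRank hω.fullRank (hpd s) (hpd (s + u))
        (inv_pos.2 hδ) (hδi s) (hδi (s + u)) (r s - r (s + u) : Matrix n n ℂ)
      have a6 : logForm 1 (ω : Matrix n n ℂ) ω (r s - r (s + u) : Matrix n n ℂ)
          ≤ C * (u : ℝ) ^ 2 := by
        refine le_trans (le_of_eq ?_) (hC s u)
        rw [bkmSq_eq_logForm hω.fullRank, AddSubgroupClass.coe_sub, map_sub, ← hrX, ← hrX]
      have e : ((r (s + u) - r s : Matrix n n ℂ) *
            (cfc Real.log (r (s + u) : Matrix n n ℂ) - cfc Real.log (ω : Matrix n n ℂ))).trace.re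
          = ((r s - r (s + u) : Matrix n n ℂ) *
            (cfc Real.log (r s : Matrix n n ℂ) - cfc Real.log (r (s + u) : Matrix n n ℂ))).trace.re
          - ((r s - r (s + u) : Matrix n n ℂ) *
            (cfc Real.log (r s : Matrix n n ℂ) - cfc Real.log (ω : Matrix n n ℂ))).trace.re := by
        simp only [Matrix.sub_mul, Matrix.mul_sub, Matrix.trace_sub, Complex.sub_re]
        ring
      rw [e, a4] at a1
      set T := ((r s - r (s + u) : Matrix n n ℂ) *
            (cfc Real.log (r s : Matrix n n ℂ) - cfc Real.log (ω : Matrix n n ℂ))).trace.re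
      have he1 : 0 ≤ 1 - Real.exp (-g * u) :=
        sub_nonneg.2 (Real.exp_le_one_iff.2 (by nlinarith [u.coe_nonneg]))
      have a7 : c⁻¹ * (1 - Real.exp (-g * u)) * relEnt (r s : Matrix n n ℂ) ω ≤ T := by
        have b1 := (mul_le_mul_of_nonneg_left a3 he1).trans a2
        rw [mul_assoc, inv_mul_le_iff₀ hc0]
        exact b1
      have a8 := a5.trans (mul_le_mul_of_nonneg_left a6 (inv_pos.2 hδ).le)
      linarith) t
  have hr0 : r 0 = ρ := preadjoint_eq fun Y => by rw [hP.zero]; rfl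
  simp only [hr0] at key
  exact key

theorem preadjoint_mix {Φ : N →ₗ[ℂ] N} (hσ : preadjoint Φ σ = σ) (ε : ℝ) :
    (preadjoint Φ (((1 - ε : ℝ) : ℂ) • ρ + (ε : ℂ) • σ) : Matrix n n ℂ)
      = mix (preadjoint Φ ρ : Matrix n n ℂ) σ ε := by
  rw [map_add, map_smul, map_smul, hσ]
  rfl

/-- The entropy decay for all states. -/
theorem SpectralResolution.relEnt_decay (hS : SpectralResolution P S Q) (hP : IsQMS P)
    (hσ : IsGNSSymmetric P σ) {g : ℝ} (hg : IsGapBound S Q g) (hg0 : 0 ≤ g) {c : ℝ} (hc : 1 ≤ c)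
    (hcE : IndexLE (Q 0) c) (hρ : IsState ρ) (t : ℝ≥0) :
    relEnt (preadjoint (P t) ρ : Matrix n n ℂ) (preadjoint (Q 0) ρ)
      ≤ Real.exp (-(g / c) * t) * relEnt (ρ : Matrix n n ℂ) (preadjoint (Q 0) ρ) := by
  have hωp := (hS.completelyPositive hP).preadjoint_posSemidef hρ.1
  have hst : IsState (preadjoint (P t) ρ) :=
    isState_preadjoint (hP.completelyPositive t) (hP.unital t) hρ
  -- Mixing with σ makes ρ faithful and commutes with P_{t*} and E_*. The index bound supplies the
  -- domination that makes both entropies converge.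
  have h1 := tendsto_relEnt_mix hρ.1 hωp hσ.fullRank (hcE ρ hρ)
  have h2 := tendsto_relEnt_mix hst.1 hωp hσ.fullRank (by
    have := hcE _ hst
    rwa [hS.preadjoint_semigroup_proj] at this)
  refine le_of_tendsto_of_tendsto h2 (h1.const_mul _) ?_
  filter_upwards [eventually_mem_Ioc] with ε hε
  set ρε : N := ((1 - ε : ℝ) : ℂ) • ρ + (ε : ℂ) • σ with hρε
  have hρεc : (ρε : Matrix n n ℂ) = mix (ρ : Matrix n n ℂ) σ ε := rfl
  have hpd : (ρε : Matrix n n ℂ).PosDef := mix_posDef hρ.1 hσ.fullRank hε.1 hε.2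
  have hs : IsState ρε := by
    refine ⟨hpd.posSemidef, ?_⟩
    rw [hρεc, mix, Matrix.trace_add, Matrix.trace_smul, Matrix.trace_smul, hρ.2, hσ.isState.2]
    push_cast
    simp
  have h3 := hS.relEnt_decay_of_posDef hP hσ hg hg0 hc hcE hs hpd t
  rw [hρε, preadjoint_mix (hσ.preadjoint_semigroup t), preadjoint_mix (hS.preadjoint_proj hσ)] at h3
  exact h3

end EntropyDecay

/-! ### The Sobolev inequality, entropy decay and the upper bound on the rate. -/

section Sobolev

variable {n : Type*} [Fintype n] [DecidableEq n] {N : StarSubalgebra ℂ (Matrix n n ℂ)}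
  {P : ℝ≥0 → N →ₗ[ℂ] N} {σ ω ρ X : N} {S : Finset ℝ} {Q : ℝ → N →ₗ[ℂ] N}

/-- Exponential decay of the relative entropy with rate `α`. -/
def EntropyDecay (P : ℝ≥0 → N →ₗ[ℂ] N) (E : N →ₗ[ℂ] N) (α : ℝ) : Prop :=
  ∀ (t : ℝ≥0) (ρ : N), IsState ρ →
    relEnt (preadjoint (P t) ρ : Matrix n n ℂ) (preadjoint E ρ)
      ≤ Real.exp (-α * t) * relEnt (ρ : Matrix n n ℂ) (preadjoint E ρ)

/-- Domination implies the support condition, so a finite index keeps the entropies relative to E_*ρ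
out of the branch `⊤` and all computations can be done in ℝ. -/
theorem relEntropy_eq_relEnt {ρ ω : Matrix n n ℂ} (hρ : ρ.PosSemidef) {c : ℝ}
    (h : ((c : ℂ) • ω - ρ).PosSemidef) : relEntropy ρ ω = (relEnt ρ ω : EReal) :=
  if_pos fun _ hv => mulVec_eq_zero_of_le hρ h hv

theorem IndexLE.relEntropy_eq {E : N →ₗ[ℂ] N} {c : ℝ} (hc : IndexLE E c) (hρ : IsState ρ) :
    relEntropy (ρ : Matrix n n ℂ) (preadjoint E ρ)
      = (relEnt (ρ : Matrix n n ℂ) (preadjoint E ρ) : EReal) :=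
  relEntropy_eq_relEnt hρ.1 (hc ρ hρ)

theorem IsQMS.isState (hP : IsQMS P) (t : ℝ≥0) (hρ : IsState ρ) : IsState (preadjoint (P t) ρ) :=
  isState_preadjoint (hP.completelyPositive t) (hP.unital t) hρ

theorem SpectralResolution.relEntropy_semigroup_eq (hS : SpectralResolution P S Q) (hP : IsQMS P)
    {c : ℝ} (hc : IndexLE (Q 0) c) (hρ : IsState ρ) (t : ℝ≥0) :
    relEntropy (preadjoint (P t) ρ : Matrix n n ℂ) (preadjoint (Q 0) ρ)
      = (relEnt (preadjoint (P t) ρ : Matrix n n ℂ) (preadjoint (Q 0) ρ) : EReal) := by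
  have h := hc.relEntropy_eq (hP.isState t hρ)
  rwa [hS.preadjoint_semigroup_proj] at h

theorem SpectralResolution.entropyProduction_eq (hS : SpectralResolution P S Q) (hP : IsQMS P)
    {c : ℝ} (hc : IndexLE (Q 0) c) (hρ : IsState ρ) :
    entropyProduction P (Q 0) ρ = liminf (fun t : ℝ≥0 =>
      (((relEnt (ρ : Matrix n n ℂ) (preadjoint (Q 0) ρ)
        - relEnt (preadjoint (P t) ρ : Matrix n n ℂ) (preadjoint (Q 0) ρ)) / t : ℝ) : EReal))
      (𝓝[>] 0) := by
  unfold entropyProduction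
  congr 1
  funext t
  rw [hc.relEntropy_eq hρ, hS.relEntropy_semigroup_eq hP hc hρ, ← EReal.coe_sub, ← EReal.coe_div]

theorem tendsto_coe_nhdsGT_zero : Tendsto (fun t : ℝ≥0 => (t : ℝ)) (𝓝[>] 0) (𝓝[>] 0) := by
  refine tendsto_nhdsWithin_iff.2 ⟨?_, ?_⟩
  · exact (NNReal.continuous_coe.tendsto 0).mono_left nhdsWithin_le_nhds
  · filter_upwards [self_mem_nhdsWithin] with t ht
    exact NNReal.coe_pos.2 ht

instance neBot_nhdsGT_nnreal_zero : (𝓝[>] (0 : ℝ≥0)).NeBot := nhdsGT_neBot 0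

/-- Exponential decay of the entropy implies the modified logarithmic Sobolev inequality. -/
theorem SpectralResolution.mlsi_of_decay (hS : SpectralResolution P S Q) (hP : IsQMS P)
    {c : ℝ} (hc : IndexLE (Q 0) c) {α : ℝ} (h : EntropyDecay P (Q 0) α) : MLSI P (Q 0) α := by
  intro ρ hρ
  rw [hS.entropyProduction_eq hP hc hρ, hc.relEntropy_eq hρ, ← EReal.coe_mul]
  set D := relEnt (ρ : Matrix n n ℂ) (preadjoint (Q 0) ρ)
  have hd : HasDerivAt (fun x : ℝ => Real.exp (-α * x)) (-α) 0 := by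
    have := ((hasDerivAt_id (0 : ℝ)).const_mul (-α)).exp
    simpa using this
  have hs := hd.tendsto_slope_zero_right
  simp only [zero_add, mul_zero, Real.exp_zero, smul_eq_mul] at hs
  have h1 := ((hs.comp tendsto_coe_nhdsGT_zero).neg).mul_const D
  rw [neg_neg] at h1
  have h2 := (EReal.continuous_coe_iff.2 continuous_id).tendsto (α * D) |>.comp h1
  rw [← (show liminf _ _ = ((α * D : ℝ) : EReal) from h2.liminf_eq)]
  refine liminf_le_liminf ?_
  filter_upwards [self_mem_nhdsWithin] with t ht
  have ht' : (0 : ℝ) < t := NNReal.coe_pos.2 ht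
  refine EReal.coe_le_coe_iff.2 ?_
  simp only [Function.comp_def, id_eq]
  have h3 := h t ρ hρ
  rw [le_div_iff₀ ht']
  have e : -((t : ℝ)⁻¹ * (Real.exp (-α * t) - 1)) * D * t = D - Real.exp (-α * t) * D := by
    field_simp
    ring
  rw [e]
  linarith

theorem SpectralResolution.continuous_preadjoint (hS : SpectralResolution P S Q) (ρ : N) :
    Continuous fun t : ℝ≥0 => (preadjoint (P t) ρ : Matrix n n ℂ) := by
  have h : ∀ t : ℝ≥0, preadjoint (P t) ρ
      = ∑ l ∈ S, (Real.exp (-l * t) : ℂ) • preadjoint (Q l) ρ := by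
    intro t
    apply preadjoint_eq
    intro Y
    push_cast
    rw [Finset.sum_mul, Matrix.trace_sum, hS.apply_apply]
    push_cast
    rw [Finset.mul_sum, Matrix.trace_sum]
    refine Finset.sum_congr rfl fun l _ => ?_
    rw [Matrix.smul_mul, Matrix.mul_smul, Matrix.trace_smul, Matrix.trace_smul,
      trace_preadjoint_mul]
  simp only [h]
  push_cast
  exact continuous_finsetSum _ fun l _ => by fun_prop

theorem SpectralResolution.continuous_relEnt (hS : SpectralResolution P S Q) (hP : IsQMS P)
    (hρ : IsState ρ) (τ : Matrix n n ℂ) :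
    Continuous fun t : ℝ≥0 => relEnt (preadjoint (P t) ρ : Matrix n n ℂ) τ :=
  continuous_iff_continuousAt.2 fun t =>
    tendsto_relEnt_left τ ((hS.continuous_preadjoint ρ).tendsto t)
      (Eventually.of_forall fun s => (hP.isState s hρ).1.1) (hP.isState t hρ).1.1

/-- The modified logarithmic Sobolev inequality implies exponential decay of the entropy. -/
theorem SpectralResolution.decay_of_mlsi (hS : SpectralResolution P S Q) (hP : IsQMS P)
    {c : ℝ} (hc : IndexLE (Q 0) c) {α : ℝ} (h : MLSI P (Q 0) α) : EntropyDecay P (Q 0) α := by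
  intro t ρ hρ
  set D : ℝ≥0 → ℝ := fun s => relEnt (preadjoint (P s) ρ : Matrix n n ℂ) (preadjoint (Q 0) ρ)
    with hD
  have hcont : Continuous D := hS.continuous_relEnt hP hρ _
  -- The inequality is applied to the evolved state at time s, whose image under E_* is still E_*ρ.
  have hprod : ∀ s : ℝ≥0, ((α * D s : ℝ) : EReal) ≤ liminf (fun u : ℝ≥0 =>
      (((D s - D (s + u)) / u : ℝ) : EReal)) (𝓝[>] 0) := by
    intro s
    have h1 := h _ (hP.isState s hρ)
    rw [hS.entropyProduction_eq hP hc (hP.isState s hρ), hc.relEntropy_eq (hP.isState s hρ),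
      ← EReal.coe_mul] at h1
    simp only [hS.preadjoint_semigroup_proj, ← preadjoint_comp, ← hP.add] at h1
    exact h1
  -- Gronwall with K = -α for a continuous function whose lower right derivative is controlled. D
  -- need not be differentiable, as the entropy production may be infinite.
  have key := le_gronwallBound_of_liminf_deriv_right_le (f := fun x : ℝ => D x.toNNReal)
    (f' := fun x : ℝ => -α * D x.toNNReal) (δ := D 0) (K := -α) (ε := 0) (a := 0) (b := t)
    (hcont.comp continuous_real_toNNReal).continuousOn (by
      intro x hx r hr
      refine Eventually.frequently ?_
      have h1 : ((-r : ℝ) : EReal) < liminf (fun u : ℝ≥0 =>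
          (((D x.toNNReal - D (x.toNNReal + u)) / u : ℝ) : EReal)) (𝓝[>] 0) :=
        lt_of_lt_of_le (EReal.coe_lt_coe_iff.2 (by linarith)) (hprod x.toNNReal)
      have h2 := eventually_lt_of_lt_liminf h1
      have h3 : Tendsto (fun z : ℝ => (z - x).toNNReal) (𝓝[>] x) (𝓝[>] 0) := by
        refine tendsto_nhdsWithin_iff.2 ⟨?_, ?_⟩
        · have hcz : Continuous fun z : ℝ => (z - x).toNNReal :=
            continuous_real_toNNReal.comp (continuous_id.sub continuous_const)
          have := (hcz.tendsto x).mono_left (nhdsWithin_le_nhds (s := Set.Ioi x))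
          simpa using this
        · filter_upwards [self_mem_nhdsWithin] with z hz
          exact Real.toNNReal_pos.2 (sub_pos.2 hz)
      filter_upwards [h3.eventually h2, self_mem_nhdsWithin] with z hz hzx
      have hzx' : 0 < z - x := sub_pos.2 hzx
      rw [EReal.coe_lt_coe_iff, ← Real.toNNReal_add hx.1 hzx'.le, add_sub_cancel,
        Real.coe_toNNReal _ hzx'.le] at hz
      rw [div_eq_mul_inv] at hz
      nlinarith) (by simp) (by intro x _; simp)
  have h4 := key t ⟨t.coe_nonneg, le_rfl⟩
  simp only [Real.toNNReal_coe, gronwallBound_ε0, sub_zero] at h4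
  have h0 : D 0 = relEnt (ρ : Matrix n n ℂ) (preadjoint (Q 0) ρ) := by
    have : preadjoint (P 0) ρ = ρ := preadjoint_eq fun Y => by rw [hP.zero]; rfl
    rw [hD]
    simp only [this]
  rw [h0, mul_comm] at h4
  exact h4

theorem SpectralResolution.relEnt_nonneg (hS : SpectralResolution P S Q) (hP : IsQMS P)
    (hσ : IsGNSSymmetric P σ) {c : ℝ} (hc : IndexLE (Q 0) c) (hρ : IsState ρ) :
    0 ≤ relEnt (ρ : Matrix n n ℂ) (preadjoint (Q 0) ρ) := by
  have hω := isState_preadjoint (hS.completelyPositive hP) (hS.proj_one hP) hρ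
  refine ge_of_tendsto (tendsto_relEnt_mix hρ.1 hω.1 hσ.fullRank (hc ρ hρ)) ?_
  filter_upwards [eventually_mem_Ioc] with ε hε
  refine QuantumMarkov.relEnt_nonneg (mix_posDef hρ.1 hσ.fullRank hε.1 hε.2).posSemidef
    (mix_posDef hω.1 hσ.fullRank hε.1 hε.2) ?_
  simp only [mix, Matrix.trace_add, Matrix.trace_smul, hρ.2, hω.2]

theorem SpectralResolution.decay_mono (hS : SpectralResolution P S Q) (hP : IsQMS P)
    (hσ : IsGNSSymmetric P σ) {c : ℝ} (hc : IndexLE (Q 0) c) {α β : ℝ}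
    (h : EntropyDecay P (Q 0) β) (hαβ : α ≤ β) : EntropyDecay P (Q 0) α := by
  intro t ρ hρ
  refine (h t ρ hρ).trans (mul_le_mul_of_nonneg_right (Real.exp_le_exp.2 ?_)
    (hS.relEnt_nonneg hP hσ hc hρ))
  nlinarith [t.coe_nonneg]

/-- Decay is a closed condition on the rate, so it holds at the best constant even though that is
defined as a supremum. -/
theorem entropyDecay_of_forall_lt {E : N →ₗ[ℂ] N} {α : ℝ}
    (h : ∀ β < α, EntropyDecay P E β) : EntropyDecay P E α := by
  intro t ρ hρ
  have hc : Continuous fun β : ℝ =>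
      Real.exp (-β * t) * relEnt (ρ : Matrix n n ℂ) (preadjoint E ρ) := by fun_prop
  refine ge_of_tendsto ((hc.tendsto α).mono_left (nhdsWithin_le_nhds (s := Set.Iio α))) ?_
  filter_upwards [self_mem_nhdsWithin] with β hβ
  exact h β hβ t ρ hρ

theorem SpectralResolution.exists_hermitian_eigenvector (hS : SpectralResolution P S Q)
    (hP : IsQMS P) {g : ℝ} (hQ : Q g ≠ 0) :
    ∃ X : N, X ≠ 0 ∧ (X : Matrix n n ℂ).IsHermitian ∧ Q g X = X := by
  obtain ⟨Y, hY⟩ : ∃ Y, Q g Y ≠ 0 := by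
    by_contra h
    push Not at h
    exact hQ (LinearMap.ext h)
  set Z := Q g Y with hZ
  have hZZ : Q g Z = Z := by rw [hZ, hS.mul_apply, if_pos rfl]
  have hZs : Q g (star Z) = star Z := by rw [hS.proj_star hP, hZZ]
  by_cases h1 : Z + star Z = 0
  -- Z is skew-Hermitian here, so iZ is Hermitian.
  · refine ⟨Complex.I • Z, smul_ne_zero Complex.I_ne_zero hY, ?_, by rw [map_smul, hZZ]⟩
    have h2 : star Z = -Z := (neg_eq_of_add_eq_zero_right h1).symm
    have h3 : star (Complex.I • Z) = Complex.I • Z := by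
      rw [star_smul, h2, smul_neg, ← neg_smul]
      congr 1
      simp
    exact congrArg Subtype.val h3
  · refine ⟨Z + star Z, h1, ?_, by rw [map_add, hZZ, hZs]⟩
    have h3 : star (Z + star Z) = Z + star Z := by rw [star_add, star_star, add_comm]
    exact congrArg Subtype.val h3

/-- The rate of exponential decay is at most twice each nonzero eigenvalue. -/
theorem SpectralResolution.decay_rate_le (hS : SpectralResolution P S Q) (hP : IsQMS P)
    (hσ : IsGNSSymmetric P σ) {g : ℝ} (hg : 0 < g) (hQ : Q g ≠ 0) {α : ℝ}
    (h : EntropyDecay P (Q 0) α) : α ≤ 2 * g := by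
  obtain ⟨X, hX0, hXH, hX⟩ := hS.exists_hermitian_eigenvector hP hQ
  -- η = J_σ(X) is Hermitian, killed by E_* and multiplied by e^{-gt} under P_{t*}. A small
  -- perturbation σ + εη is therefore a state with E_* equal to σ and an explicit orbit.
  set η : N := ⟨bkm (σ : Matrix n n ℂ) X, bkm_mem σ.2 X.2⟩ with hη
  have hηc : (η : Matrix n n ℂ) = bkm (σ : Matrix n n ℂ) X := rfl
  have hηH : (η : Matrix n n ℂ).IsHermitian := by
    unfold Matrix.IsHermitian
    rw [hηc, bkm_conjTranspose, hXH.eq]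
  have hη0 : (η : Matrix n n ℂ) ≠ 0 := fun h0 => hX0 (Subtype.ext (by
    rw [← dop_invLogMean_bkm hσ.fullRank (X : Matrix n n ℂ), ← hηc, h0, map_zero]
    rfl))
  have hEX : Q 0 X = 0 := by rw [← hX, hS.mul_apply, if_neg hg.ne]
  have hEη : preadjoint (Q 0) η = 0 := Subtype.ext (by
    rw [hS.preadjoint_proj_bkm hP hσ hηc, hEX]
    simp)
  have hPη : ∀ t : ℝ≥0, preadjoint (P t) η = (Real.exp (-g * t) : ℂ) • η := fun t =>
    Subtype.ext (by
      rw [hσ.preadjoint_bkm hP hηc, ← hX, hS.semigroup_proj, hX, SetLike.val_smul, map_smul]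
      rfl)
  have htr : (η : Matrix n n ℂ).trace = 0 := by
    rw [← trace_preadjoint (hS.proj_one hP) η, hEη]
    simp
  obtain ⟨ε₁, hε₁, h1⟩ := exists_smul_le hσ.fullRank hηH
  obtain ⟨ε₂, hε₂, h2⟩ := exists_smul_le hσ.fullRank hηH.neg
  set ε := min ε₁ ε₂ with hε
  have hε0 : 0 < ε := lt_min hε₁ hε₂
  have hminus : ∀ s : ℝ, 0 ≤ s → s ≤ ε → ((σ : Matrix n n ℂ) - (s : ℂ) • η).PosDef :=
    fun s hs hsε => h1 s hs (hsε.trans (min_le_left _ _))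
  have hplus : ∀ s : ℝ, 0 ≤ s → s ≤ ε → ((σ : Matrix n n ℂ) + (s : ℂ) • η).PosDef := by
    intro s hs hsε
    have := h2 s hs (hsε.trans (min_le_right _ _))
    rwa [smul_neg, sub_neg_eq_add] at this
  set ρ : N := σ + (ε : ℂ) • η with hρdef
  have hρ : IsState ρ := by
    refine ⟨(hplus ε hε0.le le_rfl).posSemidef, ?_⟩
    have : (ρ : Matrix n n ℂ) = (σ : Matrix n n ℂ) + (ε : ℂ) • (η : Matrix n n ℂ) := rfl
    rw [this, Matrix.trace_add, Matrix.trace_smul, htr, smul_zero, add_zero, hσ.isState.2]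
  have hEρ : preadjoint (Q 0) ρ = σ := by
    rw [hρdef, map_add, map_smul, hEη, smul_zero, add_zero, hS.preadjoint_proj hσ]
  set m := logForm 1 (σ : Matrix n n ℂ) σ η with hm
  have hm0 : 0 < m := logForm_pos one_pos hσ.fullRank hσ.fullRank hη0
  set D := relEnt (ρ : Matrix n n ℂ) σ with hD
  -- The orbit point is σ + 2sη with s = e^{-gt}ε/2; the halving fits the perturbation σ + 2η of
  -- `logForm_le_relEnt`. The entropy is thus at least a constant times e^{-2gt} and at most a
  -- constant times e^{-αt}.
  have hlow : ∀ t : ℝ≥0, (Real.exp (-g * t) * (ε / 2)) ^ 2 * m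
      ≤ 2 * (Real.exp (-α * t) * D) := by
    intro t
    set s : ℝ := Real.exp (-g * t) * (ε / 2) with hs
    have he : Real.exp (-g * t) ≤ 1 := Real.exp_le_one_iff.2 (by nlinarith [t.coe_nonneg])
    have hs0 : 0 ≤ s := by positivity
    have hs2 : 2 * s ≤ ε := by
      have := mul_le_mul_of_nonneg_right he hε0.le
      rw [hs]
      linarith
    have h3 := h t ρ hρ
    rw [hEρ] at h3
    have e1 : (preadjoint (P t) ρ : Matrix n n ℂ)
        = (σ : Matrix n n ℂ) + (2 : ℂ) • ((s : ℂ) • (η : Matrix n n ℂ)) := by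
      rw [hρdef, map_add, map_smul, hσ.preadjoint_semigroup, hPη]
      have : (2 : ℂ) • ((s : ℂ) • (η : Matrix n n ℂ))
          = (ε : ℂ) • ((Real.exp (-g * t) : ℂ) • (η : Matrix n n ℂ)) := by
        rw [smul_smul, smul_smul, hs]
        congr 1
        push_cast
        ring
      rw [this]
      rfl
    have h4 := logForm_le_relEnt (η := (s : ℂ) • (η : Matrix n n ℂ)) hσ.fullRank
      (by
        unfold Matrix.IsHermitian
        rw [Matrix.conjTranspose_smul, hηH.eq, Complex.star_def, Complex.conj_ofReal])
      (hplus s hs0 (by linarith))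
      (by
        have := hplus (2 * s) (by linarith) hs2
        rw [smul_smul]
        push_cast at this
        exact this)
      (hminus s hs0 (by linarith)).posSemidef
      (by rw [Matrix.trace_smul, htr, smul_zero])
    rw [logForm_smul, ← e1] at h4
    linarith
  by_contra hlt
  push Not at hlt
  have hlim : Tendsto (fun x : ℝ => 2 * D * Real.exp (-(α - 2 * g) * x)) atTop (𝓝 (2 * D * 0)) := by
    refine Tendsto.const_mul _ (Real.tendsto_exp_atBot.comp ?_)
    exact tendsto_id.const_mul_atTop_of_neg (by linarith)
  have h5 : (ε / 2) ^ 2 * m ≤ 2 * D * 0 := by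
    refine ge_of_tendsto hlim ?_
    filter_upwards [eventually_ge_atTop 0] with x hx
    have h6 := hlow ⟨x, hx⟩
    change (Real.exp (-g * x) * (ε / 2)) ^ 2 * m ≤ 2 * (Real.exp (-α * x) * D) at h6
    have e2 : (Real.exp (-g * x) * (ε / 2)) ^ 2 * m
        = Real.exp (-(2 * g) * x) * ((ε / 2) ^ 2 * m) := by
      rw [mul_pow, ← Real.exp_nat_mul, mul_assoc]
      congr 2
      push_cast
      ring
    have e3 : 2 * (Real.exp (-α * x) * D)
        = Real.exp (-(2 * g) * x) * (2 * D * Real.exp (-(α - 2 * g) * x)) := by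
      have : Real.exp (-α * x) = Real.exp (-(2 * g) * x) * Real.exp (-(α - 2 * g) * x) := by
        rw [← Real.exp_add]
        congr 1
        ring
      rw [this]
      ring
    rw [e2, e3] at h6
    exact le_of_mul_le_mul_left h6 (Real.exp_pos _)
  have h7 : 0 < (ε / 2) ^ 2 * m := by positivity
  linarith

theorem SpectralResolution.decay_of_isGapBound (hS : SpectralResolution P S Q) (hP : IsQMS P)
    (hσ : IsGNSSymmetric P σ) {g : ℝ} (hg : IsGapBound S Q g) (hg0 : 0 ≤ g) {c : ℝ} (hc : 1 ≤ c)
    (hcE : IndexLE (Q 0) c) : EntropyDecay P (Q 0) (g / c) :=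
  fun t _ hρ => hS.relEnt_decay hP hσ hg hg0 hc hcE hρ t

/-- If E is the identity there is no nonzero mode. Every g is then a gap bound, which matches the
convention inf ∅ = +∞. -/
theorem SpectralResolution.isGapBound_of_eq_id (hS : SpectralResolution P S Q)
    (h : Q 0 = LinearMap.id) (g : ℝ) : IsGapBound S Q g := by
  intro l _ hl0 hQ
  refine absurd ?_ hQ
  have := hS.mul l 0
  rwa [h, if_neg hl0, LinearMap.comp_id] at this

end Sobolev

/-! ### Passage to the best constants in the extended reals. -/

section BestConstants

variable {n : Type*} [Fintype n] [DecidableEq n] {N : StarSubalgebra ℂ (Matrix n n ℂ)}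
  {P : ℝ≥0 → N →ₗ[ℂ] N} {σ ρ : N} {S : Finset ℝ} {Q : ℝ → N →ₗ[ℂ] N}

theorem SpectralResolution.mlsi_of_isGapBound (hS : SpectralResolution P S Q) (hP : IsQMS P)
    (hσ : IsGNSSymmetric P σ) {g : ℝ} (hg : IsGapBound S Q g) (hg0 : 0 ≤ g) {c : ℝ} (hc : 1 ≤ c)
    (hcE : IndexLE (Q 0) c) : MLSI P (Q 0) (g / c) :=
  hS.mlsi_of_decay hP hcE (hS.decay_of_isGapBound hP hσ hg hg0 hc hcE)

theorem mlsi_ampl_zero (α : ℝ) :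
    MLSI (fun t => amplMap (P t) 0) (amplMap (Q 0) 0) α :=
  fun ρ hρ => absurd hρ (not_isState_ampl_zero ρ)

theorem SpectralResolution.cmlsi_of_isGapBound (hS : SpectralResolution P S Q) (hP : IsQMS P)
    (hσ : IsGNSSymmetric P σ) {g : ℝ} (hg : IsGapBound S Q g) (hg0 : 0 ≤ g) {c : ℝ} (hc : 1 ≤ c)
    (hcE : ∀ k, IndexLE (amplMap (Q 0) k) c) : CMLSI P (Q 0) (g / c) := by
  intro k
  rcases eq_or_ne k 0 with rfl | hk
  · exact mlsi_ampl_zero _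
  · exact (hS.amplify k).mlsi_of_isGapBound (hP.amplify k) (hσ.amplify hk) (hg.amplify k) hg0 hc
      (hcE k)

theorem amplMap_ne_zero {Φ : N →ₗ[ℂ] N} (h : Φ ≠ 0) : amplMap Φ 1 ≠ 0 := by
  intro h0
  refine h (LinearMap.ext fun X => ?_)
  have h1 := LinearMap.congr_fun h0 (⟨blockSingle (X : Matrix n n ℂ) 0 0, blockSingle_mem X.2 0 0⟩ :
    ampl N 1)
  have h2 : amplBlock (⟨blockSingle (X : Matrix n n ℂ) 0 0, blockSingle_mem X.2 0 0⟩ :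
      ampl N 1) 0 0 = X := Subtype.ext (by
    change block _ 0 0 = _
    rw [block_blockSingle, if_pos ⟨rfl, rfl⟩])
  have h3 := congrArg (fun Z : ampl N 1 => amplBlock Z 0 0) h1
  simp only [amplBlock_amplMap, h2] at h3
  exact h3

theorem SpectralResolution.mlsi_le (hS : SpectralResolution P S Q) (hP : IsQMS P)
    (hσ : IsGNSSymmetric P σ) {c : ℝ} (hcE : IndexLE (Q 0) c) {g : ℝ} (hg : 0 < g) (hQ : Q g ≠ 0)
    {α : ℝ} (h : MLSI P (Q 0) α) : α ≤ 2 * g :=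
  hS.decay_rate_le hP hσ hg hQ (hS.decay_of_mlsi hP hcE h)

theorem two_mul_coe (g : ℝ) : (2 : EReal) * (g : EReal) = ((2 * g : ℝ) : EReal) := by
  rw [EReal.coe_mul]
  rfl

theorem two_mul_top : (2 : EReal) * ⊤ = ⊤ :=
  EReal.coe_mul_top_of_pos (x := 2) two_pos

/-- Bounds by the spectral gap for the best constant in a family of inequalities. -/
theorem iSup_bounds {gap : EReal} {A : ℝ → Prop} {c : ℝ} (hc : 1 ≤ c)
    (hgap : (gap = ⊤ ∧ ∀ g : ℝ, 0 < g → A (g / c)) ∨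
      ∃ g : ℝ, 0 < g ∧ gap = (g : EReal) ∧ A (g / c) ∧ ∀ α, A α → α ≤ 2 * g) :
    0 < (⨆ (α : ℝ) (_ : 0 < α ∧ A α), (α : EReal)) ∧
      gap / (c : EReal) ≤ (⨆ (α : ℝ) (_ : 0 < α ∧ A α), (α : EReal)) ∧
      (⨆ (α : ℝ) (_ : 0 < α ∧ A α), (α : EReal)) ≤ 2 * gap := by
  have hc0 : 0 < c := by linarith
  have hle : ∀ α : ℝ, 0 < α → A α → (α : EReal) ≤ ⨆ (α : ℝ) (_ : 0 < α ∧ A α), (α : EReal) :=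
    fun α h0 hA => le_iSup₂_of_le α ⟨h0, hA⟩ le_rfl
  rcases hgap with ⟨rfl, h⟩ | ⟨g, hg, rfl, h, hu⟩
  -- With infinite gap every positive rate is admissible, and the supremum is +∞.
  · have htop : (⨆ (α : ℝ) (_ : 0 < α ∧ A α), (α : EReal)) = ⊤ := by
      refine EReal.eq_top_iff_forall_lt _ |>.2 fun y => ?_
      have h1 : 0 < |y| + 1 := by positivity
      have h2 := hle ((|y| + 1) * c / c) (by positivity) (h _ (by positivity))
      rw [mul_div_cancel_right₀ _ hc0.ne'] at h2
      refine lt_of_lt_of_le (EReal.coe_lt_coe_iff.2 ?_) h2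
      linarith [le_abs_self y]
    rw [htop, two_mul_top]
    exact ⟨EReal.coe_lt_top 0, le_top, le_rfl⟩
  · have h1 := hle (g / c) (by positivity) h
    have h2 : (0 : EReal) < ((g / c : ℝ) : EReal) := EReal.coe_pos.2 (by positivity)
    refine ⟨h2.trans_le h1, ?_, ?_⟩
    · rw [← EReal.coe_div]
      exact h1
    · rw [two_mul_coe]
      exact iSup₂_le fun α hα => EReal.coe_le_coe_iff.2 (hu α hα.2)

theorem SpectralResolution.alphaMLSI_bounds (hS : SpectralResolution P S Q) (hP : IsQMS P)
    (hσ : IsGNSSymmetric P σ) :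
    spectralGap (generator S Q) (Q 0) σ / index (Q 0) ≤ alphaMLSI P (Q 0) ∧
      alphaMLSI P (Q 0) ≤ 2 * spectralGap (generator S Q) (Q 0) σ := by
  obtain ⟨c, hc, hidx, hcE⟩ := hS.exists_index_eq hP hσ
  rw [hidx]
  refine (iSup_bounds (A := MLSI P (Q 0)) hc ?_).2
  rcases hS.spectralGap_eq hP hσ with ⟨hid, hgap⟩ | ⟨g, hg, hgap, hgb, hQ⟩
  · exact Or.inl ⟨hgap, fun g hg =>
      hS.mlsi_of_isGapBound hP hσ (hS.isGapBound_of_eq_id hid g) hg.le hc hcE⟩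
  · exact Or.inr ⟨g, hg, hgap, hS.mlsi_of_isGapBound hP hσ hgb hg.le hc hcE,
      fun α hα => hS.mlsi_le hP hσ hcE hg hQ hα⟩

theorem SpectralResolution.alphaCMLSI_bounds (hS : SpectralResolution P S Q) (hP : IsQMS P)
    (hσ : IsGNSSymmetric P σ) :
    0 < alphaCMLSI P (Q 0) ∧
      spectralGap (generator S Q) (Q 0) σ / indexCB (Q 0) ≤ alphaCMLSI P (Q 0) ∧
      alphaCMLSI P (Q 0) ≤ 2 * spectralGap (generator S Q) (Q 0) σ := by
  obtain ⟨c, hc, hidx, hcE⟩ := hS.exists_indexCB_eq hP hσ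
  rw [hidx]
  refine iSup_bounds (A := CMLSI P (Q 0)) hc ?_
  rcases hS.spectralGap_eq hP hσ with ⟨hid, hgap⟩ | ⟨g, hg, hgap, hgb, hQ⟩
  · exact Or.inl ⟨hgap, fun g hg =>
      hS.cmlsi_of_isGapBound hP hσ (hS.isGapBound_of_eq_id hid g) hg.le hc hcE⟩
  -- The lower bound needs the index uniformly in k, while k = 1 alone suffices for the upper bound.
  · exact Or.inr ⟨g, hg, hgap, hS.cmlsi_of_isGapBound hP hσ hgb hg.le hc hcE,
      fun α hα => (hS.amplify 1).mlsi_le (hP.amplify 1) (hσ.amplify one_ne_zero) (hcE 1) hg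
        (amplMap_ne_zero hQ) (hα 1)⟩

theorem SpectralResolution.entropyDecay_iff (hS : SpectralResolution P S Q) (hP : IsQMS P)
    {c : ℝ} (hc : IndexLE (Q 0) c) {α : ℝ} :
    EntropyDecay P (Q 0) α ↔ ∀ (t : ℝ≥0) (ρ : N), IsState ρ →
      relEntropy (preadjoint (P t) ρ : Matrix n n ℂ) (preadjoint (Q 0) ρ)
        ≤ ((Real.exp (-α * t) : ℝ) : EReal) *
          relEntropy (ρ : Matrix n n ℂ) (preadjoint (Q 0) ρ) := by
  refine forall₃_congr fun t ρ hρ => ?_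
  rw [hc.relEntropy_eq hρ, hS.relEntropy_semigroup_eq hP hc hρ, ← EReal.coe_mul,
    EReal.coe_le_coe_iff]

theorem SpectralResolution.le_alphaCMLSI_iff (hS : SpectralResolution P S Q) (hP : IsQMS P)
    (hσ : IsGNSSymmetric P σ) {α : ℝ} (hα : 0 < α) :
    (α : EReal) ≤ alphaCMLSI P (Q 0) ↔
      ∀ (k : ℕ) (t : ℝ≥0) (ρ : ampl N k), IsState ρ →
        relEntropy (preadjoint (amplMap (P t) k) ρ : Matrix (n × Fin k) (n × Fin k) ℂ)
            (preadjoint (amplMap (Q 0) k) ρ)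
          ≤ ((Real.exp (-α * t) : ℝ) : EReal) *
            relEntropy (ρ : Matrix (n × Fin k) (n × Fin k) ℂ) (preadjoint (amplMap (Q 0) k) ρ) := by
  obtain ⟨c, hc, hidx, hcE⟩ := hS.exists_indexCB_eq hP hσ
  constructor
  · intro h k
    rcases eq_or_ne k 0 with rfl | hk
    · exact fun t ρ hρ => absurd hρ (not_isState_ampl_zero ρ)
    refine ((hS.amplify k).entropyDecay_iff (hP.amplify k) (hcE k)).1 ?_
    refine entropyDecay_of_forall_lt fun β hβ => ?_
    have h1 : (β : EReal) < alphaCMLSI P (Q 0) := (EReal.coe_lt_coe_iff.2 hβ).trans_le h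
    obtain ⟨γ, h2⟩ := lt_iSup_iff.1 h1
    obtain ⟨⟨-, hγ⟩, h3⟩ := lt_iSup_iff.1 h2
    exact (hS.amplify k).decay_mono (hP.amplify k) (hσ.amplify hk) (hcE k)
      ((hS.amplify k).decay_of_mlsi (hP.amplify k) (hcE k) (hγ k)) (EReal.coe_lt_coe_iff.1 h3).le
  · intro h
    refine le_iSup₂_of_le α ⟨hα, fun k => ?_⟩ le_rfl
    exact (hS.amplify k).mlsi_of_decay (hP.amplify k) (hcE k)
      (((hS.amplify k).entropyDecay_iff (hP.amplify k) (hcE k)).2 (h k))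

end BestConstants

end

end QuantumMarkov

/-! ### The main theorem. -/

theorem theorem1 {n : Type*} [Fintype n] [DecidableEq n] (M : StarSubalgebra ℂ (Matrix n n ℂ))
    (P : ℝ≥0 → M →ₗ[ℂ] M) (hP : IsQMS P)
    (hext : ∃ Q : ℝ≥0 → (⊤ : StarSubalgebra ℂ (Matrix n n ℂ)) →ₗ[ℂ]
        (⊤ : StarSubalgebra ℂ (Matrix n n ℂ)),
      IsQMS Q ∧ ∀ (t : ℝ≥0) (X : M),
        (Q t ⟨(X : Matrix n n ℂ), trivial⟩ : Matrix n n ℂ) = (P t X : Matrix n n ℂ))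
    (σ : M) (hσ : IsGNSSymmetric P σ) :
    -- the generator `L`, the fixed-point algebra `F` and the limit `E = lim P_t`, which is a
    -- conditional expectation onto `F`, exist (and are unique)
    ∃ (L E : M →ₗ[ℂ] M) (F : StarSubalgebra ℂ M),
      IsGenerator P L ∧
      (∀ X, X ∈ F ↔ ∀ t, P t X = X) ∧
      IsCondExp F E ∧
      (∀ X, Tendsto (fun t => P t X) atTop (𝓝 (E X))) ∧
      -- the complete modified logarithmic Sobolev inequality, with bounds on its constant
      0 < alphaCMLSI P E ∧
      spectralGap L E σ / indexCB E ≤ alphaCMLSI P E ∧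
      alphaCMLSI P E ≤ 2 * spectralGap L E σ ∧
      -- the bounds on the constant of the modified logarithmic Sobolev inequality
      spectralGap L E σ / index E ≤ alphaMLSI P E ∧
      alphaMLSI P E ≤ 2 * spectralGap L E σ ∧
      -- the constant is also the best rate of exponential decay of the relative entropy
      (∀ α : ℝ, 0 < α → ((α : EReal) ≤ alphaCMLSI P E ↔
        ∀ (k : ℕ) (t : ℝ≥0) (ρ : ampl M k), IsState ρ →
          relEntropy (preadjoint (amplMap (P t) k) ρ : Matrix (n × Fin k) (n × Fin k) ℂ)
              (preadjoint (amplMap E k) ρ)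
            ≤ ((Real.exp (-α * t) : ℝ) : EReal) *
              relEntropy (ρ : Matrix (n × Fin k) (n × Fin k) ℂ) (preadjoint (amplMap E k) ρ))) := by
  obtain ⟨S, Q, hS⟩ := hP.exists_spectralResolution hσ
  obtain ⟨h1, h2, h3⟩ := hS.alphaCMLSI_bounds hP hσ
  obtain ⟨h4, h5⟩ := hS.alphaMLSI_bounds hP hσ
  exact ⟨generator S Q, Q 0, fixedPoints hP hσ, hS.isGenerator, fun X => mem_fixedPoints,
    hS.isCondExp hP hσ, hS.tendsto, h1, h2, h3, h4, h5,
    fun α hα => hS.le_alphaCMLSI_iff hP hσ hα⟩
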